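/- Theorem. Let $p_{vc}$-path-width be the following parameterized problem: an instance is a triple $(G,k,S)$ consisting of a finite graph $G=(V,E)$, a number $k\in\mathbb{N}$, and a set $S\subseteq V$; the parameter is $|S|$; the instance is a yes-instance if $S$ is a vertex cover of $G$ and the path width of $G$ is at most $k$. Instances are encoded as binary words (the number of vertices in unary, the adjacency matrix of $G$, the characteristic vector of $S$, and $k$ in binary); words that encode no triple are no-instances with parameter $0$. Then there are a function $K\colon\{0,1\}^*\to\{0,1\}^*$ and a \textsc{dlogtime}-uniform family $(C_n)_{n\in\mathbb{N}}$ of $\mathrm{TC}^0$-circuits (circuits with not-gates and with and-, or- and threshold gates of unbounded fan-in, of constant depth and of size polynomial in $n$, whose description can be computed bit by bit by a single deterministic Turing machine in time $O(\log n)$) such that $C_{|x|}$ outputs $K(x)$ on every input $x\in\{0,1\}^*$, and such that $K$ is a kernelization with $O(|S|^3)$ vertices, that is: 1. for every word $x$, $x$ is a yes-instance if and only if $K(x)$ is a yes-instance; 2. there is a computable function $f\colon\mathbb{N}\to\mathbb{N}$ such that $|K(x)|\le f(s)$ for every word $x$ with parameter $s$; 3. there is a constant $c$ such that for every word $x$ with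 parameter $s$, $K(x)$ encodes a triple $(G',k',S')$ in which $G'$ has at most $c\,s^3+c$ vertices. -/

import Mathlib

/-! ### Path width -/

/-- A tree decomposition of `G` whose tree is the path with nodes `0, 1, …, len`.
On a path, a set of nodes is connected if and only if it is an interval. -/
structure PathDecomposition {V : Type*} (G : SimpleGraph V) where
  len : ℕ
  bag : Fin (len + 1) → Finset V
  vertex_mem : ∀ v, ∃ i, v ∈ bag i
  edge_mem : ∀ u v, G.Adj u v → ∃ i, u ∈ bag i ∧ v ∈ bag i
  connected : ∀ v i j l, i ≤ j → j ≤ l → v ∈ bag i → v ∈ bag l → v ∈ bag j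

/-- The maximum size of a bag, minus one. (The subtraction truncates only if every bag is empty,
that is, only for the graph without vertices, whose width is read as `0`.) -/
def PathDecomposition.width {V : Type*} {G : SimpleGraph V} (D : PathDecomposition G) : ℕ :=
  (Finset.univ.sup fun i => (D.bag i).card) - 1

/-- The minimum width of a path decomposition of `G`. -/
noncomputable def pathWidth {V : Type*} (G : SimpleGraph V) : ℕ :=
  sInf (Set.range fun D : PathDecomposition G => D.width)

/-! ### The problem: instances and their encoding as binary words -/

/-- A triple `(G, k, S)` with `G` a graph on the vertex set `{0, …, order - 1}`. -/
structure PWInstance where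
  order : ℕ
  graph : SimpleGraph (Fin order)
  k : ℕ
  S : Finset (Fin order)

namespace PWInstance

/-- `S` is a vertex cover of `G` and `G` has path width at most `k`. -/
def IsYes (I : PWInstance) : Prop :=
  I.graph.IsVertexCover (I.S : Set (Fin I.order)) ∧ pathWidth I.graph ≤ I.k

open Classical in
/-- The binary word `1ⁿ 0 A M B`, where `n` is the number of vertices, `A` is the adjacency matrix
(`n²` bits, row by row), `M` is the characteristic vector of `S` (`n` bits), and `B` is the binary
representation of `k` (least significant bit first, without superfluous zeros). -/
noncomputable def encode (I : PWInstance) : List Bool :=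
  List.replicate I.order true ++ false ::
    (List.ofFn (fun p : Fin (I.order * I.order) => decide (I.graph.Adj p.divNat p.modNat)) ++
      (List.ofFn (fun v : Fin I.order => decide (v ∈ I.S)) ++ I.k.bits))

theorem encode_injective : Function.Injective encode := by
  classical
  have key : ∀ (m n : ℕ) (a b : List Bool),
      List.replicate m true ++ false :: a = List.replicate n true ++ false :: b →
        m = n ∧ a = b := by
    intro m
    induction m with
    | zero =>
      intro n a b h
      cases n with
      | zero => simpa using h
      | succ n => simp [List.replicate_succ] at h
    | succ m ih =>
      intro n a b h
      cases n with
      | zero => simp [List.replicate_succ] at h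
      | succ n =>
        simp only [List.replicate_succ, List.cons_append, List.cons.injEq, true_and] at h
        obtain ⟨h1, h2⟩ := ih n a b h
        exact ⟨by omega, h2⟩
  rintro ⟨n, G, k, S⟩ ⟨n', G', k', S'⟩ h
  obtain ⟨hn, h⟩ := key _ _ _ _ h
  simp only at hn
  subst hn
  obtain ⟨hA, h⟩ := List.append_inj h (by simp)
  obtain ⟨hM, hB⟩ := List.append_inj h (by simp)
  have hA' := List.ofFn_injective hA
  have hM' := List.ofFn_injective hM
  have hG : G = G' := by
    ext u v
    have := congrFun hA' (finProdFinEquiv (u, v))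
    have e : (Fin.divNat (finProdFinEquiv (u, v)), Fin.modNat (finProdFinEquiv (u, v))) = (u, v) :=
      finProdFinEquiv.symm_apply_apply (u, v)
    rw [Prod.mk.injEq] at e
    simpa [e.1, e.2] using this
  have hS : S = S' := by
    ext v
    simpa using congrFun hM' v
  have hk : k = k' := by
    have h2 := congrArg (fun l : List Bool => l.foldr Nat.bit 0) hB
    have h3 : ∀ m : ℕ, m.bits.foldr Nat.bit 0 = m := by
      intro m
      induction m using Nat.binaryRec' with
      | zero => simp
      | bit b m hb ih => rw [Nat.bits_append_bit m b hb, List.foldr_cons, ih]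
    simpa [h3] using h2
  subst hG hS hk
  rfl

end PWInstance

/-! ### Parameterized problems and kernelizations -/

/-- A language of binary words together with a parameterization. -/
structure ParamProblem where
  language : Set (List Bool)
  param : List Bool → ℕ

/-- `K` is a self-reduction of the problem whose values have length bounded by a computable function
of the parameter. -/
def ParamProblem.IsKernelization (P : ParamProblem) (K : List Bool → List Bool) : Prop :=
  (∀ x, x ∈ P.language ↔ K x ∈ P.language) ∧
    ∃ f : ℕ → ℕ, Computable f ∧ ∀ x, (K x).length ≤ f (P.param x)

open Classical in
/-- Path width parameterized by a given vertex cover: the words encoding a triple `(G, k, S)` such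
that `S` is a vertex cover of `G` and `pw(G) ≤ k`, with parameter `|S|`.
(Words that encode no triple are no-instances with parameter `0`.) -/
noncomputable def pathWidthVC : ParamProblem where
  language := {x | ∃ I : PWInstance, I.encode = x ∧ I.IsYes}
  param x := if h : ∃ I : PWInstance, I.encode = x then h.choose.S.card else 0

theorem pathWidthVC_param_encode (I : PWInstance) :
    pathWidthVC.param I.encode = I.S.card := by
  have h : ∃ J : PWInstance, J.encode = I.encode := ⟨I, rfl⟩
  have : h.choose = I := PWInstance.encode_injective h.choose_spec
  simp only [pathWidthVC, h, dif_pos]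
  rw [this]

theorem mem_pathWidthVC_encode (I : PWInstance) :
    I.encode ∈ pathWidthVC.language ↔ I.IsYes := by
  constructor
  · rintro ⟨J, hJ, h⟩
    rwa [PWInstance.encode_injective hJ] at h
  · exact fun h => ⟨I, rfl, h⟩

/-! ### Threshold circuits -/

/-- The kinds of gates of a threshold circuit with `n` input bits; a gate `threshold t` tests
whether at least `t` of its inputs are true. -/
inductive GateKind (n : ℕ) where
  | input (i : Fin n)
  | not
  | and
  | or
  | threshold (t : ℕ)
  deriving DecidableEq

/-- The value of a gate on the input bits `x`, given the values `v` of the gates wired into it. -/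
def GateKind.eval {n : ℕ} (x : Fin n → Bool) {ι : Type} [Fintype ι] (v : ι → Bool) :
    GateKind n → Bool
  | .input i => x i
  | .not => decide (∀ h, v h = false)
  | .and => decide (∀ h, v h = true)
  | .or => decide (∃ h, v h = true)
  | .threshold t => decide (t ≤ (Finset.univ.filter fun h => v h = true).card)

/-- A circuit with `n` input bits whose `and`-, `or`- and threshold gates have unbounded fan-in.
The circuit outputs a word of at most `outLen` bits: for each output position `j`, the gate
`outUsed j` says whether the output word has a `j`-th bit, and the gate `outBit j` gives it. -/
structure TCCircuit (n : ℕ) where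
  /-- the number of gates -/
  size : ℕ
  kind : Fin size → GateKind n
  /-- `wire g h` means that gate `h` is an input of gate `g`. -/
  wire : Fin size → Fin size → Bool
  not_fanIn : ∀ g, kind g = .not → ∃! h, wire g h = true
  /-- a division into layers, which makes the circuit acyclic; the number of layers bounds the
  depth -/
  layer : Fin size → ℕ
  layer_lt : ∀ g h, wire g h = true → layer h < layer g
  outLen : ℕ
  outUsed : Fin outLen → Fin size
  outBit : Fin outLen → Fin size

namespace TCCircuit

variable {n : ℕ}

/-- The value of gate `g` on the input bits `x`. -/
def value (C : TCCircuit n) (x : Fin n → Bool) (g : Fin C.size) : Bool :=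
  (C.kind g).eval x fun h : {h // C.wire g h = true} => C.value x h.1
termination_by C.layer g
decreasing_by exact C.layer_lt _ _ h.2

/-- On the input bits `x`, the circuit outputs the word `w`. -/
def Outputs (C : TCCircuit n) (x : Fin n → Bool) (w : List Bool) : Prop :=
  w.length ≤ C.outLen ∧
    ∀ j : Fin C.outLen, (C.value x (C.outUsed j) = true ↔ (j : ℕ) < w.length) ∧
      ∀ hj : (j : ℕ) < w.length, C.value x (C.outBit j) = w[(j : ℕ)]

end TCCircuit

/-! ### Uniformity -/

/-- The kinds of bits in the description of a circuit. -/
inductive CircuitQuery where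
  | isInput
  | isNot
  | isAnd
  | isOr
  | isThreshold
  | isWire
  | isOutUsed
  | isOutBit
  deriving DecidableEq

instance : Fintype CircuitQuery :=
  ⟨{.isInput, .isNot, .isAnd, .isOr, .isThreshold, .isWire, .isOutUsed, .isOutBit},
    fun q => by cases q <;> simp⟩

open Classical in
/-- The encoding of a circuit as a table of bits (its direct connection language): the bit with
index `(q, a, b)` says whether gate `a` exists and is, respectively, the input bit `b`, a `not`-,
`and`- or `or`-gate, a threshold gate with threshold `b`, a gate with input gate `b`, the gate
`outUsed b`, or the gate `outBit b`. -/
noncomputable def TCCircuit.describe {n : ℕ} (C : TCCircuit n) (q : CircuitQuery) (a b : ℕ) :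
    Bool :=
  decide (∃ g : Fin C.size, (g : ℕ) = a ∧
    match q with
    | .isInput => ∃ i : Fin n, (i : ℕ) = b ∧ C.kind g = .input i
    | .isNot => C.kind g = .not
    | .isAnd => C.kind g = .and
    | .isOr => C.kind g = .or
    | .isThreshold => C.kind g = .threshold b
    | .isWire => ∃ h : Fin C.size, (h : ℕ) = b ∧ C.wire g h = true
    | .isOutUsed => ∃ j : Fin C.outLen, (j : ℕ) = b ∧ C.outUsed j = g
    | .isOutBit => ∃ j : Fin C.outLen, (j : ℕ) = b ∧ C.outBit j = g)

/-- The input alphabet of the machines that compute descriptions of circuits. -/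
inductive QuerySymbol where
  | query (q : CircuitQuery)
  | bit (b : Bool)
  | sep
  deriving DecidableEq

instance : Fintype QuerySymbol :=
  ⟨insert .sep (Finset.univ.image .query ∪ Finset.univ.image .bit),
    fun s => by cases s <;> simp⟩

/-- The binary representation of `m`, least significant bit first. -/
def binWord (m : ℕ) : List QuerySymbol := m.bits.map QuerySymbol.bit

/-- The word `q bin(a) # bin(b) # bin(n)`. -/
def queryWord (t : CircuitQuery × ℕ × ℕ × ℕ) : List QuerySymbol :=
  .query t.1 :: (binWord t.2.1 ++ .sep :: (binWord t.2.2.1 ++ .sep :: binWord t.2.2.2))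

/-- One deterministic multi-stack Turing machine computes the bit with index `(q, a, b)` of the
description of the `n`-th circuit in time linear in the length of `q bin(a) # bin(b) # bin(n)`.
For a family of polynomial size this is time `O(log n)` for all indices within the range of the
description. -/
def DLogTimeUniform (C : ∀ n, TCCircuit n) : Prop :=
  ∃ (M : Turing.TM2ComputableInTime queryWord Computability.encodeBool
      fun t : CircuitQuery × ℕ × ℕ × ℕ => (C t.2.2.2).describe t.1 t.2.1 t.2.2.1) (c : ℕ),
    ∀ m, M.time m ≤ c * m + c

/-- A `dlogtime`-uniform family of threshold circuits of constant depth and polynomial size. -/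
def IsUniformTC0 (C : ∀ n, TCCircuit n) : Prop :=
  (∃ d, ∀ n g, (C n).layer g ≤ d) ∧
    (∃ c, ∀ n, (C n).size + (C n).outLen ≤ c * n ^ c + c) ∧
      DLogTimeUniform C

/-- On every binary word `x`, the circuit for the length of `x` outputs `K x`. -/
def ComputedBy (K : List Bool → List Bool) (C : ∀ n, TCCircuit n) : Prop :=
  ∀ x : List Bool, (C x.length).Outputs x.get (K x)

/-! The kernel rests on two reduction rules, justified through interval representations
(`HasIntervals`, which expresses path width by `pathWidth_le_iff`). Let s be the size of the cover.
If k ≥ s, the sets S ∪ {v} are the bags of a path decomposition of width at most k, so assume k < s.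
First rule: two cover vertices with more than s common neighbors outside of the cover have more than
k of them, so their intervals meet in every representation and the two may be joined
(`HasIntervals.add_edges`). Second rule: a vertex outside of the cover whose neighborhood is now a
clique may be deleted if every pair of its neighbors has another such vertex as a common neighbor
(`HasIntervals.insert_vertex`); keeping the least one for every pair suffices. A surviving vertex
outside of the cover is either such a least one or has two non-adjacent neighbors in the cover,
which have at most s common neighbors. Hence at most s + s²(s + 1) vertices survive
(`CoverGraph.Good.card_kept_le`).

With the threshold s instead of k, the reduced graph does not depend on k, and the value of k is
never needed. Only its length is: more than s binary digits force k > s and a yes-instance, while at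
most s digits are copied unchanged. Each rule is applied once, to all vertices at the same time, and
this makes constant depth possible.

The circuits come from first-order logic with counting (`Fm`). A gate is a pair of a subformula and
an assignment of its variables; the depth is bounded by the height of the formulas, and the size is
polynomial because the number of variables is fixed (`FmSystem.value_iff`, `FmSystem.circuit_size`).
For uniformity, a gate number consists of a tag for the formula and the binary digits of the values
of the variables, interleaved. A bit of the description then depends only on tags and on the order
among the components of the query, n, the greatest element of the domain and 0
(`FmSystem.describe_eq`). A finite automaton finds all these comparisons in a single pass over the
digits (`FmSystem.comparisons_step`), so that a machine with stacks needs linear time.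

It remains to define the kernelization in this logic. A function f is represented by the relation c
≤ f, and counting pairs provides sums, products and cardinalities. The surviving vertices are
renumbered by counting the survivors below each of them (`CoverGraph.nth_keep_eq_iff`). -/

/-! ### Tuples of numbers encoded by interleaving binary digits -/

/-- The `i`-th component of the `w`-tuple of numbers whose binary digits are interleaved in `r`. -/
def fld (w i r : ℕ) : ℕ :=
  if h : r = 0 ∨ w = 0 then 0
  else ((r % 2 ^ w).testBit i).toNat + 2 * fld w i (r / 2 ^ w)
termination_by r
decreasing_by
  exact Nat.div_lt_self (by omega) (Nat.one_lt_two_pow (by omega))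

@[simp] theorem fld_zero (w i : ℕ) : fld w i 0 = 0 := by
  rw [fld]; simp

theorem fld_eq {w : ℕ} (hw : 0 < w) (i r : ℕ) :
    fld w i r = ((r % 2 ^ w).testBit i).toNat + 2 * fld w i (r / 2 ^ w) := by
  by_cases hr : r = 0
  · simp [hr]
  · rw [fld, dif_neg (by omega)]

theorem fld_mod_two {w : ℕ} (hw : 0 < w) (i r : ℕ) :
    fld w i r % 2 = ((r % 2 ^ w).testBit i).toNat := by
  rw [fld_eq hw]
  have := Bool.toNat_lt ((r % 2 ^ w).testBit i)
  omega

theorem fld_div_two {w : ℕ} (hw : 0 < w) (i r : ℕ) :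
    fld w i r / 2 = fld w i (r / 2 ^ w) := by
  rw [fld_eq hw i r]
  have := Bool.toNat_lt ((r % 2 ^ w).testBit i)
  omega

theorem fld_of_le {w i : ℕ} (hi : w ≤ i) (r : ℕ) : fld w i r = 0 := by
  induction r using Nat.strong_induction_on with
  | _ r ih =>
    rw [fld]
    split_ifs with h
    · rfl
    · rw [ih _ (Nat.div_lt_self (by omega) (Nat.one_lt_two_pow (by omega))),
        Nat.testBit_mod_two_pow]
      simp [hi]

/-- With blocks of a single digit nothing is interleaved. This allows the second argument of a query
to be treated uniformly, whether it is a gate number or a plain number. -/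
theorem fld_one (b : ℕ) : fld 1 0 b = b := by
  induction b using Nat.strong_induction_on with
  | _ b ih =>
    rcases Nat.eq_zero_or_pos b with rfl | hb
    · simp
    · rw [fld_eq one_pos, pow_one, ih _ (by omega)]
      have : ((b % 2).testBit 0).toNat = b % 2 := by
        rcases Nat.mod_two_eq_zero_or_one b with h | h <;> simp [h]
      omega

theorem fld_lt {w : ℕ} (hw : 0 < w) (i : ℕ) {L r : ℕ} (hr : r < (2 ^ w) ^ L) :
    fld w i r < 2 ^ L := by
  induction L generalizing r with
  | zero => have : r = 0 := by simpa using hr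
            simp [this]
  | succ L ih =>
    have h1 : r / 2 ^ w < (2 ^ w) ^ L := by
      rw [Nat.div_lt_iff_lt_mul (by positivity)]; simpa [pow_succ] using hr
    have h2 := ih h1
    have := Bool.toNat_lt ((r % 2 ^ w).testBit i)
    rw [fld_eq hw, pow_succ]
    omega

/-- Removing one block of `w` digits halves every component. After `L` blocks all components are
zero, which leaves no nonzero digit. -/
theorem lt_of_fld_lt {w : ℕ} (hw : 0 < w) {L r : ℕ} (h : ∀ i < w, fld w i r < 2 ^ L) :
    r < (2 ^ w) ^ L := by
  induction L generalizing r with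
  | zero =>
    by_contra hr
    have hr : r ≠ 0 := by simpa using hr
    have key : ∀ s, (∀ i < w, fld w i s = 0) → s = 0 := by
      intro s
      induction s using Nat.strong_induction_on with
      | _ s ih =>
        intro hs
        by_contra h0
        have h1 : s / 2 ^ w = 0 := by
          refine ih _ (Nat.div_lt_self (by omega) (Nat.one_lt_two_pow (by omega))) fun i hi => ?_
          rw [← fld_div_two hw, hs i hi]
        apply h0
        have h2 : s % 2 ^ w = s := Nat.mod_eq_of_lt ((Nat.div_eq_zero_iff_lt (by positivity)).1 h1)
        rw [← h2]
        apply Nat.eq_of_testBit_eq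
        intro i
        by_cases hi : i < w
        · have h3 := fld_mod_two hw i s
          rw [hs i hi] at h3
          cases h : (s % 2 ^ w).testBit i
          · simp
          · simp [h] at h3
        · simp [Nat.testBit_mod_two_pow, hi]
    exact hr (key r fun i hi => by simpa using h i hi)
  | succ L ih =>
    have h1 : r / 2 ^ w < (2 ^ w) ^ L := by
      refine ih fun i hi => ?_
      have := h i hi
      rw [← fld_div_two hw]
      rw [pow_succ] at this
      omega
    rw [Nat.div_lt_iff_lt_mul (by positivity)] at h1
    simpa [pow_succ] using h1

theorem fld_injective {w : ℕ} (hw : 0 < w) {r s : ℕ} (h : ∀ i < w, fld w i r = fld w i s) :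
    r = s := by
  induction r using Nat.strong_induction_on generalizing s with
  | _ r ih =>
    have hm : r % 2 ^ w = s % 2 ^ w := by
      apply Nat.eq_of_testBit_eq
      intro i
      by_cases hi : i < w
      · have h1 := fld_mod_two hw i r
        rw [h i hi, fld_mod_two hw] at h1
        revert h1
        cases (r % 2 ^ w).testBit i <;> cases (s % 2 ^ w).testBit i <;> simp
      · simp [Nat.testBit_mod_two_pow, hi]
    rcases Nat.eq_zero_or_pos r with rfl | hr
    · have := lt_of_fld_lt hw (L := 0) (r := s) fun i hi => by simp [← h i hi]
      simp at this; omega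
    · have hd := ih (r / 2 ^ w) (Nat.div_lt_self hr (Nat.one_lt_two_pow (by omega)))
        (s := s / 2 ^ w) fun i hi => by
          rw [← fld_div_two hw, ← fld_div_two hw, h i hi]
      rw [← Nat.div_add_mod r (2 ^ w), hd, hm, Nat.div_add_mod]

/-- The number that encodes the first `w` components of `v`, numbers with `L` binary digits. -/
def pack (w : ℕ) : ℕ → (ℕ → ℕ) → ℕ
  | 0, _ => 0
  | L + 1, v => Nat.ofBits (fun i : Fin w => (v i).testBit 0) + 2 ^ w * pack w L fun i => v i / 2

theorem pack_lt (w L : ℕ) (v : ℕ → ℕ) : pack w L v < (2 ^ w) ^ L := by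
  induction L generalizing v with
  | zero => simp [pack]
  | succ L ih =>
    have h1 := Nat.ofBits_lt_two_pow fun i : Fin w => (v i).testBit 0
    have h2 := ih fun i => v i / 2
    rw [pack, pow_succ]
    nlinarith

theorem fld_pack {w i : ℕ} (hi : i < w) {L : ℕ} {v : ℕ → ℕ} (h : v i < 2 ^ L) :
    fld w i (pack w L v) = v i := by
  induction L generalizing v with
  | zero =>
    have : v i = 0 := by simpa using h
    simp [pack, this]
  | succ L ih =>
    have h1 := Nat.ofBits_lt_two_pow fun i : Fin w => (v i).testBit 0
    rw [pack, fld_eq (by omega), Nat.add_mul_mod_self_left, Nat.mod_eq_of_lt h1,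
      Nat.add_mul_div_left _ _ (by positivity), Nat.div_eq_of_lt h1, zero_add,
      ih (v := fun i => v i / 2) (by rw [pow_succ] at h; omega),
      Nat.testBit_ofBits_lt _ _ hi]
    simp only [Nat.testBit_zero]
    rcases Nat.mod_two_eq_zero_or_one (v i) with h | h <;> simp [h] <;> omega

/-! ### First-order logic with counting -/

/-- Formulas with named variables: comparison, comparison with the length of the word, bits of the
word, negation, conjunction, existential quantification, and the comparison of a variable with the
number of pairs that satisfy a formula (the variables `i` and `i + 1` of `cnt i φ y` are bound). -/
inductive Fm where
  | lt (i j : ℕ)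
  | ltn (i : ℕ)
  | inp (i : ℕ)
  | neg (φ : Fm)
  | and (φ ψ : Fm)
  | ex (i : ℕ) (φ : Fm)
  | cnt (i : ℕ) (φ : Fm) (y : ℕ)
  deriving DecidableEq

namespace Fm

open Classical in
/-- Satisfaction in the word `x`, where variables range over the numbers less than `D`. -/
def sat (x : List Bool) (D : ℕ) : (ℕ → ℕ) → Fm → Prop
  | v, lt i j => v i < v j
  | v, ltn i => v i < x.length
  | v, inp i => x[v i]? = some true
  | v, neg φ => ¬ sat x D v φ
  | v, and φ ψ => sat x D v φ ∧ sat x D v ψ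
  | v, ex i φ => ∃ a < D, sat x D (Function.update v i a) φ
  | v, cnt i φ y => v y ≤ ((Finset.range D ×ˢ Finset.range D).filter fun p =>
      sat x D (Function.update (Function.update v i p.1) (i + 1) p.2) φ).card

/-- All variables have names less than `m`. -/
def VarsLT (m : ℕ) : Fm → Prop
  | lt i j => i < m ∧ j < m
  | ltn i => i < m
  | inp i => i < m
  | neg φ => φ.VarsLT m
  | and φ ψ => φ.VarsLT m ∧ ψ.VarsLT m
  | ex i φ => i < m ∧ φ.VarsLT m
  | cnt i φ y => i + 1 < m ∧ y < m ∧ φ.VarsLT m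

theorem VarsLT.mono {m m' : ℕ} (h : m ≤ m') {φ : Fm} (hφ : φ.VarsLT m) : φ.VarsLT m' := by
  induction φ with
  | lt | ltn | inp | cnt => simp only [VarsLT] at *; grind
  | neg φ ih => exact ih hφ
  | and φ ψ ih1 ih2 => exact ⟨ih1 hφ.1, ih2 hφ.2⟩
  | ex i φ ih => exact ⟨hφ.1.trans_le h, ih hφ.2⟩

theorem exists_varsLT (φ : Fm) : ∃ m, φ.VarsLT m := by
  induction φ with
  | lt i j => exact ⟨i + j + 1, by simp only [VarsLT]; omega⟩
  | ltn i => exact ⟨i + 1, by simp [VarsLT]⟩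
  | inp i => exact ⟨i + 1, by simp [VarsLT]⟩
  | neg φ ih => exact ih
  | and φ ψ ih1 ih2 =>
    obtain ⟨a, ha⟩ := ih1
    obtain ⟨b, hb⟩ := ih2
    exact ⟨a + b, ha.mono (by omega), hb.mono (by omega)⟩
  | ex i φ ih =>
    obtain ⟨a, ha⟩ := ih
    exact ⟨a + i + 1, by omega, ha.mono (by omega)⟩
  | cnt i φ y ih =>
    obtain ⟨a, ha⟩ := ih
    exact ⟨a + i + y + 2, by omega, by omega, ha.mono (by omega)⟩

/-- The immediate subformulas. -/
def children : Fm → List Fm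
  | neg φ => [φ]
  | and φ ψ => [φ, ψ]
  | ex _ φ => [φ]
  | cnt _ φ _ => [φ]
  | _ => []

/-- The variables bound at the root of a formula. -/
def binds : Fm → ℕ → Bool
  | ex i _, f => f = i
  | cnt i _ _, f => f = i || f = i + 1
  | _, _ => false

/-- The height of the syntax tree. -/
def height : Fm → ℕ
  | neg φ => φ.height + 1
  | and φ ψ => φ.height + ψ.height + 1
  | ex _ φ => φ.height + 1
  | cnt _ φ _ => φ.height + 1
  | _ => 0

/-- All subformulas. -/
def subs : Fm → List Fm
  | neg φ => neg φ :: φ.subs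
  | and φ ψ => and φ ψ :: (φ.subs ++ ψ.subs)
  | ex i φ => ex i φ :: φ.subs
  | cnt i φ y => cnt i φ y :: φ.subs
  | φ => [φ]

theorem height_lt_of_mem_children {φ ψ : Fm} (h : ψ ∈ φ.children) : ψ.height < φ.height := by
  cases φ <;> simp [children] at h <;> grind [height]

theorem mem_subs_self (φ : Fm) : φ ∈ φ.subs := by
  cases φ <;> simp [subs]

theorem mem_subs_of_mem_children {φ ψ χ : Fm} (h : ψ ∈ φ.subs) (h' : χ ∈ ψ.children) :
    χ ∈ φ.subs := by
  induction φ with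
  | lt | ltn | inp => simp only [subs, List.mem_singleton] at h; subst h; simp [children] at h'
  | neg φ ih | ex i φ ih | cnt i φ y ih =>
    simp only [subs, List.mem_cons] at h ⊢
    rcases h with rfl | h
    · simp only [children, List.mem_singleton] at h'
      subst h'
      exact Or.inr (mem_subs_self _)
    · exact Or.inr (ih h)
  | and φ ψ ih1 ih2 =>
    simp only [subs, List.mem_cons, List.mem_append] at h ⊢
    rcases h with rfl | h | h
    · simp only [children, List.mem_cons, List.not_mem_nil, or_false] at h'
      rcases h' with rfl | rfl
      · exact Or.inr (Or.inl (mem_subs_self _))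
      · exact Or.inr (Or.inr (mem_subs_self _))
    · exact Or.inr (Or.inl (ih1 h))
    · exact Or.inr (Or.inr (ih2 h))

theorem varsLT_of_mem_subs {m : ℕ} {φ ψ : Fm} (h : ψ ∈ φ.subs) (hφ : φ.VarsLT m) :
    ψ.VarsLT m := by
  induction φ with
  | lt | ltn | inp => simp only [subs, List.mem_singleton] at h; subst h; exact hφ
  | neg φ ih =>
    simp only [subs, List.mem_cons] at h
    rcases h with rfl | h
    · exact hφ
    · exact ih h hφ
  | ex i φ ih =>
    simp only [subs, List.mem_cons] at h
    rcases h with rfl | h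
    · exact hφ
    · exact ih h hφ.2
  | cnt i φ y ih =>
    simp only [subs, List.mem_cons] at h
    rcases h with rfl | h
    · exact hφ
    · exact ih h hφ.2.2
  | and φ ψ ih1 ih2 =>
    simp only [subs, List.mem_cons, List.mem_append] at h
    rcases h with rfl | h | h
    · exact hφ
    · exact ih1 h hφ.1
    · exact ih2 h hφ.2

end Fm

/-! ### The circuits that evaluate formulas -/

/-- The number of binary digits of the numbers that variables range over, for words of
length `n`. -/
def digitCount (n : ℕ) : ℕ := n.size + 4

/-- The variables range over the numbers less than `domSize n`, for words of length `n`. -/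
def domSize (n : ℕ) : ℕ := 2 ^ digitCount n

/-- The kind of the gate for a formula and the values `v` of the variables. -/
def Fm.gateKind (n : ℕ) (v : ℕ → ℕ) : Fm → GateKind n
  | lt i j => if v i < v j then .and else .or
  | ltn i => if v i < n then .and else .or
  | inp i => if h : v i < n then .input ⟨v i, h⟩ else .or
  | neg _ => .not
  | and _ _ => .and
  | ex _ _ => .or
  | cnt _ _ y => .threshold (v y)

/-- A finite list of formulas closed under subformulas, two of which define the output of a circuit,
with a number of variables large enough to encode all of them. -/
structure FmSystem where
  m : ℕ
  l : List Fm
  used : Fm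
  bit : Fm
  m_pos : 0 < m
  length_le : l.length ≤ 2 ^ m
  varsLT : ∀ φ ∈ l, φ.VarsLT m
  children_mem : ∀ φ ∈ l, ∀ ψ ∈ φ.children, ψ ∈ l
  used_mem : used ∈ l
  bit_mem : bit ∈ l

theorem exists_fmSystem (φ ψ : Fm) : ∃ F : FmSystem, F.used = φ ∧ F.bit = ψ := by
  obtain ⟨a, ha⟩ := φ.exists_varsLT
  obtain ⟨b, hb⟩ := ψ.exists_varsLT
  let l := φ.subs ++ ψ.subs
  refine ⟨⟨a + b + l.length + 1, l, φ, ψ, by omega, ?_, ?_, ?_, ?_, ?_⟩, rfl, rfl⟩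
  · exact (Nat.lt_two_pow_self (n := l.length)).le.trans
      (Nat.pow_le_pow_right (by norm_num) (by omega))
  · intro χ h
    rcases List.mem_append.1 h with h | h
    · exact Fm.varsLT_of_mem_subs h (ha.mono (by omega))
    · exact Fm.varsLT_of_mem_subs h (hb.mono (by omega))
  · intro χ h θ hθ
    rcases List.mem_append.1 h with h | h
    · exact List.mem_append.2 (Or.inl (Fm.mem_subs_of_mem_children h hθ))
    · exact List.mem_append.2 (Or.inr (Fm.mem_subs_of_mem_children h hθ))
  · exact List.mem_append.2 (Or.inl (Fm.mem_subs_self _))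
  · exact List.mem_append.2 (Or.inr (Fm.mem_subs_self _))

namespace FmSystem

variable (F : FmSystem)

/-- The kind of the gate for the formula with index `t` and the values `r` of the variables. -/
def kindAt (n t r : ℕ) : GateKind n :=
  match F.l[t]? with
  | none => .or
  | some φ => φ.gateKind n fun i => fld F.m i r

/-- The tags of the immediate subformulas of the formula with index `t`. -/
def childTags (t : ℕ) : List ℕ :=
  match F.l[t]? with
  | none => []
  | some φ => φ.children.map F.l.idxOf

/-- The variables bound by the formula with index `t`. -/
def bindsAt (t f : ℕ) : Bool :=
  match F.l[t]? with
  | none => false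
  | some φ => φ.binds f

/-- The wires between gates. -/
def wireAt (t r t' r' : ℕ) : Bool :=
  decide (t' ∈ F.childTags t) &&
    decide (∀ f < F.m, F.bindsAt t f = false → fld F.m f r = fld F.m f r')

/-- The height of the formula with index `t`. -/
def layerAt (t : ℕ) : ℕ :=
  match F.l[t]? with
  | none => 0
  | some φ => φ.height

theorem idxOf_lt {φ : Fm} (h : φ ∈ F.l) : F.l.idxOf φ < 2 ^ F.m :=
  (List.idxOf_lt_length_iff.2 h).trans_le F.length_le

theorem getElem?_idxOf {φ : Fm} (h : φ ∈ F.l) : F.l[F.l.idxOf φ]? = some φ := by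
  rw [List.getElem?_eq_getElem (List.idxOf_lt_length_iff.2 h), List.getElem_idxOf]

/-- The tag fills the lowest block of `F.m` digits, the values of the variables the next `digitCount
n` blocks. Using `F.m` both as the number of variables and as the width of the tag gives all blocks
the same width. -/
theorem tag_add_lt {n t r : ℕ} (ht : t < 2 ^ F.m) (hr : r < (2 ^ F.m) ^ digitCount n) :
    t + 2 ^ F.m * r < (2 ^ F.m) ^ (digitCount n + 1) := by
  rw [pow_succ]; nlinarith

/-- The number of the gate for a formula and values of the variables. -/
def gateNum (n t : ℕ) (v : ℕ → ℕ) : ℕ := t + 2 ^ F.m * pack F.m (digitCount n) v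

theorem gateNum_lt {n t : ℕ} (ht : t < 2 ^ F.m) (v : ℕ → ℕ) :
    F.gateNum n t v < (2 ^ F.m) ^ (digitCount n + 1) :=
  F.tag_add_lt ht (pack_lt _ _ _)

theorem gateNum_mod {n t : ℕ} (ht : t < 2 ^ F.m) (v : ℕ → ℕ) : F.gateNum n t v % 2 ^ F.m = t := by
  rw [gateNum, Nat.add_mul_mod_self_left, Nat.mod_eq_of_lt ht]

theorem gateNum_div {n t : ℕ} (ht : t < 2 ^ F.m) (v : ℕ → ℕ) :
    F.gateNum n t v / 2 ^ F.m = pack F.m (digitCount n) v := by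
  rw [gateNum, Nat.add_mul_div_left _ _ (by positivity), Nat.div_eq_of_lt ht, zero_add]

theorem div_lt {n : ℕ} (g : Fin ((2 ^ F.m) ^ (digitCount n + 1))) :
    (g : ℕ) / 2 ^ F.m < (2 ^ F.m) ^ digitCount n := by
  rw [Nat.div_lt_iff_lt_mul (by positivity)]
  exact g.2.trans_eq (pow_succ _ _)

theorem fld_div_lt {n : ℕ} (g : Fin ((2 ^ F.m) ^ (digitCount n + 1))) (i : ℕ) :
    fld F.m i ((g : ℕ) / 2 ^ F.m) < domSize n :=
  fld_lt F.m_pos i (F.div_lt g)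

/-- The circuit that evaluates the formulas `F.used` and `F.bit` for all values of the
variable `0`. -/
def circuit (n : ℕ) : TCCircuit n where
  size := (2 ^ F.m) ^ (digitCount n + 1)
  kind g := F.kindAt n (g % 2 ^ F.m) (g / 2 ^ F.m)
  wire g h := F.wireAt (g % 2 ^ F.m) (g / 2 ^ F.m) (h % 2 ^ F.m) (h / 2 ^ F.m)
  not_fanIn := by
    intro g hg
    -- Atoms and tags without a formula never yield `not`-gates, so the formula is a negation.
    have h1 : ∃ φ, F.l[(g : ℕ) % 2 ^ F.m]? = some (.neg φ) := by
      unfold kindAt at hg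
      rcases hl : F.l[(g : ℕ) % 2 ^ F.m]? with _ | φ
      · simp [hl] at hg
      · cases φ <;> simp only [hl, Fm.gateKind] at hg <;> (try split_ifs at hg) <;> simp_all
    obtain ⟨φ, hφ⟩ := h1
    have hmem : φ ∈ F.l := F.children_mem _ (List.mem_of_getElem? hφ) _ (by simp [Fm.children])
    have hlt := F.idxOf_lt hmem
    refine ⟨⟨F.l.idxOf φ + 2 ^ F.m * (g / 2 ^ F.m), F.tag_add_lt hlt (F.div_lt g)⟩, ?_, ?_⟩
    · simp [wireAt, childTags, hφ, Fm.children, Nat.mod_eq_of_lt hlt,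
        Nat.add_mul_div_left _ _ (show 0 < 2 ^ F.m by positivity), Nat.div_eq_of_lt hlt]
    · intro h hh
      -- A negation binds nothing, so a wired gate agrees in every variable and is determined by the
      -- tag of the subformula.
      simp only [wireAt, childTags, hφ, Fm.children, bindsAt, Fm.binds, List.map_cons,
        List.map_nil, List.mem_singleton, Bool.and_eq_true, decide_eq_true_eq, true_implies] at hh
      apply Fin.ext
      simp only
      rw [fld_injective F.m_pos hh.2, ← hh.1, Nat.mod_add_div]
  layer g := F.layerAt (g % 2 ^ F.m)
  layer_lt := by
    intro g h hgh
    simp only [wireAt, Bool.and_eq_true, decide_eq_true_eq] at hgh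
    replace hgh := hgh.1
    unfold childTags at hgh
    unfold layerAt
    rcases hg : F.l[(g : ℕ) % 2 ^ F.m]? with _ | φ
    · simp [hg] at hgh
    · simp only [hg, List.mem_map] at hgh
      obtain ⟨ψ, hψ, h1⟩ := hgh
      rw [← h1, F.getElem?_idxOf (F.children_mem _ (List.mem_of_getElem? hg) _ hψ)]
      exact Fm.height_lt_of_mem_children hψ
  outLen := domSize n
  outUsed j := ⟨F.gateNum n (F.l.idxOf F.used) (Function.update 0 0 (j : ℕ)),
    F.gateNum_lt (F.idxOf_lt F.used_mem) _⟩
  outBit j := ⟨F.gateNum n (F.l.idxOf F.bit) (Function.update 0 0 (j : ℕ)),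
    F.gateNum_lt (F.idxOf_lt F.bit_mem) _⟩

/-- The values of the variables encoded in a gate number. -/
def envOf (g : ℕ) : ℕ → ℕ := fun i => fld F.m i (g / 2 ^ F.m)

theorem envOf_gateNum {n t : ℕ} (ht : t < 2 ^ F.m) {v : ℕ → ℕ} (h1 : ∀ i < F.m, v i < domSize n)
    (h2 : ∀ i, F.m ≤ i → v i = 0) : F.envOf (F.gateNum n t v) = v := by
  funext i
  rw [envOf, F.gateNum_div ht]
  by_cases hi : i < F.m
  · exact fld_pack hi (h1 i hi)
  · rw [fld_of_le (by omega), h2 i (by omega)]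

/-- The components below `F.m` determine an interleaved number, so gates correspond to pairs of a
tag and an assignment, without any unused numbers. -/
theorem eq_gateNum {n : ℕ} (g : Fin ((2 ^ F.m) ^ (digitCount n + 1))) :
    (g : ℕ) = F.gateNum n (g % 2 ^ F.m) (F.envOf g) := by
  have h : (g : ℕ) / 2 ^ F.m = pack F.m (digitCount n) (F.envOf g) := by
    refine fld_injective F.m_pos fun i hi => ?_
    rw [fld_pack hi]
    · rfl
    · exact F.fld_div_lt g i
  rw [gateNum, ← h, Nat.mod_add_div]

theorem wire_iff {n : ℕ} {g h : Fin (F.circuit n).size} {φ : Fm}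
    (hg : F.l[(g : ℕ) % 2 ^ F.m]? = some φ) :
    (F.circuit n).wire g h = true ↔ ∃ ψ ∈ φ.children, (h : ℕ) % 2 ^ F.m = F.l.idxOf ψ ∧
      ∀ f < F.m, φ.binds f = false → F.envOf h f = F.envOf g f := by
  simp only [circuit, wireAt, childTags, hg, bindsAt, Bool.and_eq_true, decide_eq_true_eq,
    List.mem_map, envOf]
  constructor
  · rintro ⟨⟨ψ, h1, h2⟩, h3⟩
    exact ⟨ψ, h1, h2.symm, fun f hf hb => (h3 f hf hb).symm⟩
  · rintro ⟨ψ, h1, h2, h3⟩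
    exact ⟨⟨ψ, h1, h2.symm⟩, fun f hf hb => (h3 f hf hb).symm⟩

theorem envOf_of_le (g : ℕ) {i : ℕ} (hi : F.m ≤ i) : F.envOf g i = 0 := fld_of_le hi _

theorem envOf_lt {n : ℕ} (g : Fin (F.circuit n).size) (i : ℕ) : F.envOf g i < domSize n :=
  F.fld_div_lt g i

theorem domSize_pos (n : ℕ) : 0 < domSize n := by unfold domSize; positivity

/-- The gate for a formula of the system and values of the variables. -/
def gate (n : ℕ) {φ : Fm} (hφ : φ ∈ F.l) (v : ℕ → ℕ) : Fin (F.circuit n).size :=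
  ⟨F.gateNum n (F.l.idxOf φ) v, F.gateNum_lt (F.idxOf_lt hφ) v⟩

theorem gate_mod (n : ℕ) {φ : Fm} (hφ : φ ∈ F.l) (v : ℕ → ℕ) :
    (F.gate n hφ v : ℕ) % 2 ^ F.m = F.l.idxOf φ := F.gateNum_mod (F.idxOf_lt hφ) v

theorem eq_gate {n : ℕ} (g : Fin (F.circuit n).size) {φ : Fm} (hφ : φ ∈ F.l)
    (hg : (g : ℕ) % 2 ^ F.m = F.l.idxOf φ) : g = F.gate n hφ (F.envOf g) := by
  apply Fin.ext
  rw [F.eq_gateNum g, gate, hg]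
  congr 1
  rw [← hg, ← F.eq_gateNum g]

theorem value_eq {x : List Bool} {φ : Fm} {g : Fin (F.circuit x.length).size}
    (hg : F.l[(g : ℕ) % 2 ^ F.m]? = some φ) :
    (F.circuit x.length).value x.get g = (φ.gateKind x.length (F.envOf g)).eval x.get
        fun h : {h // (F.circuit x.length).wire g h = true} =>
          (F.circuit x.length).value x.get h.1 := by
  have hk : (F.circuit x.length).kind g = F.kindAt x.length (g % 2 ^ F.m) (g / 2 ^ F.m) := rfl
  rw [TCCircuit.value, hk, kindAt, hg]
  rfl

theorem not_wire_of_children_eq_nil {n : ℕ} {g : Fin (F.circuit n).size} {φ : Fm}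
    (hg : F.l[(g : ℕ) % 2 ^ F.m]? = some φ) (h0 : φ.children = []) (h : Fin (F.circuit n).size) :
    ¬ (F.circuit n).wire g h = true := by
  intro hw
  obtain ⟨ψ, hψ, -⟩ := (F.wire_iff hg).1 hw
  simp [h0] at hψ

/-- Gates for subformulas are wired to the gate for a formula. -/
theorem wire_gate {n : ℕ} {g : Fin (F.circuit n).size} {φ ψ : Fm}
    (hg : F.l[(g : ℕ) % 2 ^ F.m]? = some φ) (hψ : ψ ∈ F.l) (hc : ψ ∈ φ.children) {v : ℕ → ℕ}
    (h1 : ∀ i, v i < domSize n) (h2 : ∀ i, φ.binds i = false → v i = F.envOf g i)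
    (h3 : ∀ i, F.m ≤ i → v i = 0) :
    (F.circuit n).wire g (F.gate n hψ v) = true ∧ F.envOf (F.gate n hψ v) = v := by
  have h4 : F.envOf (F.gate n hψ v) = v :=
    F.envOf_gateNum (F.idxOf_lt hψ) (fun i _ => h1 i) h3
  refine ⟨(F.wire_iff hg).2 ⟨ψ, hc, F.gate_mod n hψ v, fun f _ hb => ?_⟩, h4⟩
  rw [h4, h2 f hb]

theorem envOf_eq_of_wire {n : ℕ} {g h : Fin (F.circuit n).size} {φ : Fm}
    (hg : F.l[(g : ℕ) % 2 ^ F.m]? = some φ) (hw : (F.circuit n).wire g h = true) {f : ℕ}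
    (hb : φ.binds f = false) : F.envOf h f = F.envOf g f := by
  obtain ⟨ψ, -, -, h2⟩ := (F.wire_iff hg).1 hw
  by_cases hf : f < F.m
  · exact h2 f hf hb
  · rw [F.envOf_of_le _ (by omega), F.envOf_of_le _ (by omega)]

/-- On the gate for a formula, the circuit computes its truth value. -/
theorem value_iff {x : List Bool} {φ : Fm} (hφ : φ ∈ F.l)
    (g : Fin (F.circuit x.length).size) (hg : (g : ℕ) % 2 ^ F.m = F.l.idxOf φ) :
    (F.circuit x.length).value x.get g = true ↔ φ.sat x (domSize x.length) (F.envOf g) := by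
  classical
  have hl : F.l[(g : ℕ) % 2 ^ F.m]? = some φ := by rw [hg, F.getElem?_idxOf hφ]
  have hv := F.varsLT φ hφ
  have hD := F.envOf_lt g
  rw [F.value_eq hl]
  induction φ generalizing g with
  | lt i j =>
    simp only [Fm.sat, Fm.gateKind]
    -- The gate has no inputs: such an `and` is constantly true, such an `or` constantly false.
    split_ifs with h <;> simp [GateKind.eval, F.not_wire_of_children_eq_nil hl rfl, h]
  | ltn i =>
    simp only [Fm.sat, Fm.gateKind]
    split_ifs with h <;> simp [GateKind.eval, F.not_wire_of_children_eq_nil hl rfl, h]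
  | inp i =>
    simp only [Fm.sat, Fm.gateKind]
    split_ifs with h
    · simp [GateKind.eval, List.getElem?_eq_getElem h]
    · simp [GateKind.eval, F.not_wire_of_children_eq_nil hl rfl,
        List.getElem?_eq_none (not_lt.1 h)]
  | neg φ ih =>
    have hm : φ ∈ F.l := F.children_mem _ hφ _ (by simp [Fm.children])
    have key : ∀ h, (F.circuit x.length).wire g h = true →
        ((F.circuit x.length).value x.get h = true ↔
          φ.sat x (domSize x.length) (F.envOf g)) := by
      intro h hw
      obtain ⟨ψ, hψ, h1, -⟩ := (F.wire_iff hl).1 hw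
      have h2 : F.envOf h = F.envOf g := funext fun f => F.envOf_eq_of_wire hl hw rfl
      simp only [Fm.children, List.mem_singleton] at hψ
      subst hψ
      have hl' : F.l[(h : ℕ) % 2 ^ F.m]? = some ψ := by rw [h1, F.getElem?_idxOf hm]
      rw [F.value_eq hl', ← h2]
      exact ih hm h h1 hl' hv (F.envOf_lt h)
    obtain ⟨h1, -⟩ := F.wire_gate hl hm (by simp [Fm.children]) hD (fun _ _ => rfl)
      fun i hi => F.envOf_of_le _ hi
    simp only [GateKind.eval, decide_eq_true_eq, Fm.sat, Fm.gateKind, Subtype.forall]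
    constructor
    · intro h
      rw [← key _ h1, h _ h1]
      simp
    · intro h h' hw
      rw [← key h' hw] at h
      simpa using h
  | and φ ψ ih1 ih2 =>
    have hm1 : φ ∈ F.l := F.children_mem _ hφ _ (by simp [Fm.children])
    have hm2 : ψ ∈ F.l := F.children_mem _ hφ _ (by simp [Fm.children])
    have key1 : ∀ h, (F.circuit x.length).wire g h = true → (h : ℕ) % 2 ^ F.m = F.l.idxOf φ →
        ((F.circuit x.length).value x.get h = true ↔
          φ.sat x (domSize x.length) (F.envOf g)) := by
      intro h hw h1
      have h2 : F.envOf h = F.envOf g := funext fun f => F.envOf_eq_of_wire hl hw rfl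
      have hl' : F.l[(h : ℕ) % 2 ^ F.m]? = some φ := by rw [h1, F.getElem?_idxOf hm1]
      rw [F.value_eq hl', ← h2]
      exact ih1 hm1 h h1 hl' hv.1 (F.envOf_lt h)
    have key2 : ∀ h, (F.circuit x.length).wire g h = true → (h : ℕ) % 2 ^ F.m = F.l.idxOf ψ →
        ((F.circuit x.length).value x.get h = true ↔
          ψ.sat x (domSize x.length) (F.envOf g)) := by
      intro h hw h1
      have h2 : F.envOf h = F.envOf g := funext fun f => F.envOf_eq_of_wire hl hw rfl
      have hl' : F.l[(h : ℕ) % 2 ^ F.m]? = some ψ := by rw [h1, F.getElem?_idxOf hm2]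
      rw [F.value_eq hl', ← h2]
      exact ih2 hm2 h h1 hl' hv.2 (F.envOf_lt h)
    obtain ⟨h1, -⟩ := F.wire_gate hl hm1 (by simp [Fm.children]) hD (fun _ _ => rfl)
      fun i hi => F.envOf_of_le _ hi
    obtain ⟨h2, -⟩ := F.wire_gate hl hm2 (by simp [Fm.children]) hD (fun _ _ => rfl)
      fun i hi => F.envOf_of_le _ hi
    simp only [GateKind.eval, decide_eq_true_eq, Fm.sat, Fm.gateKind, Subtype.forall]
    constructor
    · intro h
      exact ⟨(key1 _ h1 (F.gate_mod _ _ _)).1 (h _ h1), (key2 _ h2 (F.gate_mod _ _ _)).1 (h _ h2)⟩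
    · rintro ⟨hs1, hs2⟩ h hw
      obtain ⟨χ, hχ, h3, -⟩ := (F.wire_iff hl).1 hw
      simp only [Fm.children, List.mem_cons, List.not_mem_nil, or_false] at hχ
      rcases hχ with rfl | rfl
      · exact (key1 h hw h3).2 hs1
      · exact (key2 h hw h3).2 hs2
  | ex i φ ih =>
    have hm : φ ∈ F.l := F.children_mem _ hφ _ (by simp [Fm.children])
    have key : ∀ h, (F.circuit x.length).wire g h = true →
        ((F.circuit x.length).value x.get h = true ↔
          φ.sat x (domSize x.length) (Function.update (F.envOf g) i (F.envOf h i))) := by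
      intro h hw
      obtain ⟨ψ, hψ, h1, -⟩ := (F.wire_iff hl).1 hw
      -- A wired gate differs from `g` at most in the bound variable, so the wires run through all
      -- witnesses for the quantifier.
      have h2 : F.envOf h = Function.update (F.envOf g) i (F.envOf h i) := by
        funext f
        by_cases hf : f = i
        · subst hf; simp
        · rw [Function.update_of_ne hf, F.envOf_eq_of_wire hl hw (by simp [Fm.binds, hf])]
      simp only [Fm.children, List.mem_singleton] at hψ
      subst hψ
      have hl' : F.l[(h : ℕ) % 2 ^ F.m]? = some ψ := by rw [h1, F.getElem?_idxOf hm]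
      rw [F.value_eq hl', ← h2]
      exact ih hm h h1 hl' hv.2 (F.envOf_lt h)
    simp only [GateKind.eval, decide_eq_true_eq, Fm.sat, Fm.gateKind, Subtype.exists]
    constructor
    · rintro ⟨h, hw, hs⟩
      exact ⟨_, F.envOf_lt h i, (key h hw).1 hs⟩
    · rintro ⟨a, ha, hs⟩
      obtain ⟨h1, h2⟩ := F.wire_gate (v := Function.update (F.envOf g) i a) hl hm
        (by simp [Fm.children])
        (fun f => by
          by_cases hf : f = i
          · subst hf; simpa using ha
          · rw [Function.update_of_ne hf]; exact hD f)
        (fun f hf => by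
          rw [Function.update_of_ne]; rintro rfl; simp [Fm.binds] at hf)
        (fun f hf => by
          have := hv.1
          rw [Function.update_of_ne (by omega)]; exact F.envOf_of_le _ hf)
      refine ⟨_, h1, (key _ h1).2 ?_⟩
      rw [h2]
      simpa using hs
  | cnt i φ y ih =>
    have hm : φ ∈ F.l := F.children_mem _ hφ _ (by simp [Fm.children])
    have henv : ∀ h, (F.circuit x.length).wire g h = true → F.envOf h =
        Function.update (Function.update (F.envOf g) i (F.envOf h i)) (i + 1)
          (F.envOf h (i + 1)) := by
      intro h hw
      funext f
      by_cases hf : f = i + 1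
      · subst hf; simp
      · rw [Function.update_of_ne hf]
        by_cases hf' : f = i
        · subst hf'; simp
        · rw [Function.update_of_ne hf', F.envOf_eq_of_wire hl hw (by simp [Fm.binds, hf, hf'])]
    have htag : ∀ h, (F.circuit x.length).wire g h = true →
        (h : ℕ) % 2 ^ F.m = F.l.idxOf φ := by
      intro h hw
      obtain ⟨ψ, hψ, h1, -⟩ := (F.wire_iff hl).1 hw
      simp only [Fm.children, List.mem_singleton] at hψ
      rwa [← hψ]
    have key : ∀ h, (F.circuit x.length).wire g h = true →
        ((F.circuit x.length).value x.get h = true ↔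
          φ.sat x (domSize x.length) (F.envOf h)) := by
      intro h hw
      have hl' : F.l[(h : ℕ) % 2 ^ F.m]? = some φ := by rw [htag h hw, F.getElem?_idxOf hm]
      rw [F.value_eq hl']
      exact ih hm h (htag h hw) hl' hv.2.2 (F.envOf_lt h)
    simp only [GateKind.eval, decide_eq_true_eq, Fm.sat, Fm.gateKind]
    rw [iff_iff_eq]
    congr 1
    have hup : ∀ p ∈ Finset.range (domSize x.length) ×ˢ Finset.range (domSize x.length),
        (F.circuit x.length).wire g (F.gate x.length hm
          (Function.update (Function.update (F.envOf g) i p.1) (i + 1) p.2)) = true ∧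
        F.envOf (F.gate x.length hm
          (Function.update (Function.update (F.envOf g) i p.1) (i + 1) p.2)) =
          Function.update (Function.update (F.envOf g) i p.1) (i + 1) p.2 := by
      intro p hp
      simp only [Finset.mem_product, Finset.mem_range] at hp
      refine F.wire_gate hl hm (by simp [Fm.children]) (fun f => ?_) (fun f hf => ?_)
        (fun f hf => ?_)
      · by_cases hf : f = i + 1
        · subst hf; simpa using hp.2
        · rw [Function.update_of_ne hf]
          by_cases hf' : f = i
          · subst hf'; simpa using hp.1
          · rw [Function.update_of_ne hf']; exact hD f
      · simp only [Fm.binds, Bool.or_eq_false_iff, decide_eq_false_iff_not] at hf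
        rw [Function.update_of_ne hf.2, Function.update_of_ne hf.1]
      · have := hv.1
        rw [Function.update_of_ne (by omega), Function.update_of_ne (by omega)]
        exact F.envOf_of_le _ hf
    -- The values of the two bound variables identify a wired gate, so true inputs of the threshold
    -- gate correspond to satisfying pairs.
    refine Finset.card_bij (fun h _ => (F.envOf h.1 i, F.envOf h.1 (i + 1))) ?_ ?_ ?_
    · rintro ⟨h, hw⟩ hh
      simp only [Finset.mem_filter, Finset.mem_univ, true_and] at hh
      simp only [Finset.mem_filter, Finset.mem_product, Finset.mem_range]
      refine ⟨⟨F.envOf_lt h _, F.envOf_lt h _⟩, ?_⟩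
      rw [← henv h hw]
      exact (key h hw).1 hh
    · rintro ⟨h, hw⟩ - ⟨h', hw'⟩ - heq
      simp only [Prod.mk.injEq] at heq
      simp only [Subtype.mk.injEq]
      rw [F.eq_gate h hm (htag h hw), F.eq_gate h' hm (htag h' hw'), henv h hw, henv h' hw',
        heq.1, heq.2]
    · intro p hp
      obtain ⟨hp1, hp2⟩ := Finset.mem_filter.1 hp
      obtain ⟨h1, h2⟩ := hup p hp1
      refine ⟨⟨_, h1⟩, ?_, ?_⟩
      · simp only [Finset.mem_filter, Finset.mem_univ, true_and]
        rw [key _ h1, h2]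
        exact hp2
      · rw [h2]
        ext <;> simp

/-- Output position `j` is read off the gates of the two output formulas at the assignment with
value `j` for the variable `0` and zero for all others. -/
theorem circuit_outputs {x w : List Bool} (hw : w.length ≤ domSize x.length)
    (h1 : ∀ j < domSize x.length,
      F.used.sat x (domSize x.length) (Function.update (0 : ℕ → ℕ) 0 j) ↔ j < w.length)
    (h2 : ∀ j (h : j < w.length),
      F.bit.sat x (domSize x.length) (Function.update (0 : ℕ → ℕ) 0 j) ↔ w[j] = true) :
    (F.circuit x.length).Outputs x.get w := by
  have henv : ∀ {φ : Fm} (hφ : φ ∈ F.l) (j : ℕ), j < domSize x.length →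
      F.envOf (F.gate x.length hφ (Function.update (0 : ℕ → ℕ) 0 j)) = Function.update (0 : ℕ → ℕ) 0 j := by
    intro φ hφ j hj
    refine F.envOf_gateNum (F.idxOf_lt hφ) (fun i _ => ?_) (fun i hi => ?_)
    · by_cases h : i = 0
      · subst h; simpa using hj
      · rw [Function.update_of_ne h]; exact domSize_pos _
    · have := F.m_pos
      rw [Function.update_of_ne (by omega)]; rfl
  refine ⟨hw, fun j => ⟨?_, fun hj => ?_⟩⟩
  · have h := F.value_iff F.used_mem (F.gate x.length F.used_mem (Function.update 0 0 (j : ℕ)))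
      (F.gate_mod _ _ _)
    rw [henv F.used_mem j j.2, h1 j j.2] at h
    exact h
  · have h := F.value_iff F.bit_mem (F.gate x.length F.bit_mem (Function.update 0 0 (j : ℕ)))
      (F.gate_mod _ _ _)
    rw [henv F.bit_mem j j.2, h2 j hj] at h
    exact Bool.eq_iff_iff.2 h

/-- The depth and the size of the circuits. -/
theorem circuit_depth : ∃ d, ∀ n g, (F.circuit n).layer g ≤ d := by
  refine ⟨(F.l.map Fm.height).sum, fun n g => ?_⟩
  change F.layerAt _ ≤ _
  unfold layerAt
  rcases h : F.l[(g : ℕ) % 2 ^ F.m]? with _ | φ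
  · simp
  · exact List.single_le_sum (by simp) _ (List.mem_map_of_mem (List.mem_of_getElem? h))

theorem two_pow_size_le (n : ℕ) : 2 ^ n.size ≤ 2 * n + 1 := by
  rcases Nat.eq_zero_or_pos n with rfl | hn
  · simp
  · have h : 0 < n.size := Nat.size_pos.2 hn
    have h2 := Nat.lt_size (m := n.size - 1) (n := n) |>.1 (by omega)
    have h3 : 2 ^ n.size = 2 * 2 ^ (n.size - 1) := by
      rw [← pow_succ']; congr 1; omega
    omega

theorem domSize_le (n : ℕ) : domSize n ≤ 32 * n + 16 := by
  have := two_pow_size_le n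
  rw [domSize, digitCount, pow_add]
  omega

/-- This is what the four additional digits are for: the domain reaches beyond `n`, so positions
have successors in it, and even for the empty word it contains all positions of the nine-bit word of
the fixed no-instance. -/
theorem lt_domSize (n : ℕ) : 16 * n + 15 < domSize n := by
  have := n.lt_size_self
  rw [domSize, digitCount, pow_add]
  omega

theorem circuit_size : ∃ c, ∀ n, (F.circuit n).size + (F.circuit n).outLen ≤ c * n ^ c + c := by
  have key : ∀ n, (F.circuit n).size + (F.circuit n).outLen ≤
      (2 ^ F.m + 1) * (32 * n + 16) ^ F.m := by
    intro n
    -- Exchanging the exponents shows that the size is polynomial: `F.m` is constant and `domSize n`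
    -- is linear in `n`.
    have h1 : (F.circuit n).size = 2 ^ F.m * domSize n ^ F.m := by
      change (2 ^ F.m) ^ (digitCount n + 1) = _
      rw [pow_succ', domSize, ← pow_mul, ← pow_mul, mul_comm F.m]
    have h2 : (F.circuit n).outLen = domSize n := rfl
    have h3 : domSize n ≤ domSize n ^ F.m := Nat.le_self_pow F.m_pos.ne' _
    have h4 : domSize n ^ F.m ≤ (32 * n + 16) ^ F.m := Nat.pow_le_pow_left (domSize_le n) _
    have h5 := Nat.mul_le_mul_left (2 ^ F.m) h4
    rw [h1, h2, add_mul, one_mul]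
    exact Nat.add_le_add h5 (h3.trans h4)
  -- For n ≥ 1, 32n + 16 ≤ 48n; the summand `F.m` makes the exponent large enough.
  refine ⟨(2 ^ F.m + 1) * 48 ^ F.m + F.m, fun n => (key n).trans ?_⟩
  rcases Nat.eq_zero_or_pos n with rfl | hn
  · have : 16 ^ F.m ≤ 48 ^ F.m := Nat.pow_le_pow_left (by norm_num) _
    have := Nat.mul_le_mul_left (2 ^ F.m + 1) this
    simp only [mul_zero, zero_add]
    omega
  · have h1 : (32 * n + 16) ^ F.m ≤ 48 ^ F.m * n ^ F.m := by
      rw [← mul_pow]; exact Nat.pow_le_pow_left (by omega) _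
    have h2 : n ^ F.m ≤ n ^ ((2 ^ F.m + 1) * 48 ^ F.m + F.m) :=
      Nat.pow_le_pow_right hn (by omega)
    calc _ ≤ (2 ^ F.m + 1) * (48 ^ F.m * n ^ F.m) := Nat.mul_le_mul_left _ h1
      _ = ((2 ^ F.m + 1) * 48 ^ F.m) * n ^ F.m := by ring
      _ ≤ ((2 ^ F.m + 1) * 48 ^ F.m + F.m) * n ^ ((2 ^ F.m + 1) * 48 ^ F.m + F.m) :=
        Nat.mul_le_mul (by omega) h2
      _ ≤ _ := by omega

end FmSystem

/-! ### A finite automaton for the descriptions of the circuits -/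

/-- The numbers compared by the automaton: the components encoded in two gate numbers, the length of
the word, the greatest value of a variable, and zero. -/
inductive Track (m : ℕ) where
  | fst (i : Fin m)
  | snd (i : Fin m)
  | length
  | top
  | zero
  deriving DecidableEq, Fintype

namespace Track

/-- The number on a track; `c` is the part of the greatest value that has been delayed. -/
def val (m w r s n c : ℕ) : Track m → ℕ
  | fst i => fld m i r
  | snd i => fld w i s
  | length => n
  | top => c + 16 * (2 ^ n.size - 1)
  | zero => 0

/-- The least significant digit of the number on a track. -/
def digit {m : ℕ} (a b : Fin m → Bool) (o : Option Bool) (c : Fin 16) : Track m → ℕ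
  | fst i => (a i).toNat
  | snd i => (b i).toNat
  | length => (o.getD false).toNat
  | top => c % 2
  | zero => 0

/-- The track of the component with the name `i`. -/
def first (m i : ℕ) : Track m := if h : i < m then fst ⟨i, h⟩ else zero

theorem val_first (m w r s n c i : ℕ) : val m w r s n c (first m i) = fld m i r := by
  unfold first
  split_ifs with h
  · rfl
  · rw [fld_of_le (by omega)]; rfl

theorem val_snd (m w r s n c : ℕ) (i : Fin m) : val m w r s n c (snd i) = fld w i s := rfl

theorem val_length (m w r s n c : ℕ) : val m w r s n c length = n := rfl

end Track

/-- The part of the greatest value of a variable that is delayed after a step. -/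
def nextDelay (o : Option Bool) (c : Fin 16) : Fin 16 :=
  ⟨c / 2 + 8 * o.isSome.toNat, by have := c.2; have := Bool.toNat_lt o.isSome; omega⟩

/-- The higher digits decide, and the lowest one matters only for a tie. Reading from the least
significant digit, a new digit therefore overrides the comparison so far. -/
theorem compare_eq_then (x y : ℕ) :
    compare x y = (compare (x / 2) (y / 2)).then (compare (x % 2) (y % 2)) := by
  rcases lt_trichotomy (x / 2) (y / 2) with h | h | h
  · rw [compare_lt_iff_lt.2 h, compare_lt_iff_lt.2 (by omega)]; rfl
  · rw [compare_eq_iff_eq.2 h]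
    rcases lt_trichotomy (x % 2) (y % 2) with h' | h' | h'
    · rw [compare_lt_iff_lt.2 h', compare_lt_iff_lt.2 (by omega)]; rfl
    · rw [compare_eq_iff_eq.2 h', compare_eq_iff_eq.2 (by omega)]; rfl
    · rw [compare_gt_iff_gt.2 h', compare_gt_iff_gt.2 (by omega)]; rfl
  · rw [compare_gt_iff_gt.2 h, compare_gt_iff_gt.2 (by omega)]; rfl

/-- The number consists of ones, as many as `n` has digits, so it can be produced while `n` is being
read. -/
theorem two_pow_size_sub_one (n : ℕ) :
    2 ^ n.size - 1 = (if n = 0 then 0 else 1) + 2 * (2 ^ (n / 2).size - 1) := by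
  split_ifs with h
  · simp [h]
  · have h1 : n.size = (n / 2).size + 1 := by
      have h2 : Nat.bit n.bodd (n / 2) = n := by
        rw [← Nat.div2_val]; exact Nat.bit_bodd_div2 n
      conv_lhs => rw [← h2]
      exact Nat.size_bit (by rwa [h2])
    have : 0 < 2 ^ (n / 2).size := by positivity
    rw [h1, pow_succ]
    omega

namespace FmSystem

/-- The result of the comparisons of all tracks, given the comparisons `cm` of the digits that
have been read and the numbers formed by the digits that have not been read. -/
def comparisons {m : ℕ} (w r s n c : ℕ) (cm : Track m → Track m → Ordering) :
    Track m → Track m → Ordering :=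
  fun x y => (compare (Track.val m w r s n c x) (Track.val m w r s n c y)).then (cm x y)

/-- The invariant of the automaton: consuming a block moves information from the unread numbers into
the stored comparisons of digits and leaves the final result unchanged. -/
theorem comparisons_step {m : ℕ} (hm : 0 < m) {w : ℕ} (hw : 0 < w) {r s n : ℕ} (c : Fin 16)
    (cm : Track m → Track m → Ordering) {a b : Fin m → Bool} {o : Option Bool}
    (ha : ∀ i : Fin m, a i = (r % 2 ^ m).testBit i) (hb : ∀ i : Fin m, b i = (s % 2 ^ w).testBit i)
    (ho : o = if n = 0 then none else some n.bodd) :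
    comparisons w r s n c cm = comparisons w (r / 2 ^ m) (s / 2 ^ w) (n / 2) (nextDelay o c)
      (fun x y => (compare (Track.digit a b o c x) (Track.digit a b o c y)).then (cm x y)) := by
  have h1 : ∀ x, Track.val m w r s n c x % 2 = Track.digit a b o c x := by
    intro x
    cases x with
    | fst i => rw [Track.val, fld_mod_two hm, ← ha]; rfl
    | snd i => rw [Track.val, fld_mod_two hw, ← hb]; rfl
    | length =>
      simp only [Track.val, Track.digit, ho]
      split_ifs with h
      · simp [h]
      · rw [Nat.mod_two_of_bodd]; rfl
    | top => simp only [Track.val, Track.digit]; omega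
    | zero => rfl
  have h2 : ∀ x, Track.val m w r s n c x / 2 =
      Track.val m w (r / 2 ^ m) (s / 2 ^ w) (n / 2) (nextDelay o c) x := by
    intro x
    cases x with
    | fst i => exact fld_div_two hm _ _
    | snd i => exact fld_div_two hw _ _
    | length => rfl
    | top =>
      -- The register holds the next four digits of the greatest value. A step drops the lowest one
      -- and lets a one enter at the place of value 8 for every digit of `n`. Started with 15, it
      -- produces `n.size + 4` ones, which is `domSize n - 1`.
      simp only [Track.val, nextDelay, ho]
      rw [two_pow_size_sub_one n]
      split_ifs with h <;> simp <;> omega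
    | zero => simp [Track.val]
  funext x y
  simp only [comparisons]
  rw [compare_eq_then, h1, h1, h2, h2, Ordering.then_assoc]

variable (F : FmSystem)

/-- The bits of the description of a circuit as a function of the comparisons of the tracks. -/
def accepts (q : CircuitQuery) (t t' : ℕ) (cm : Track F.m → Track F.m → Ordering) : Bool :=
  decide (∀ i, cm (.fst i) .top ≠ .gt) &&
    match q with
    | .isInput => match F.l[t]? with
      | some (.inp i) => decide (cm (.first _ i) (.snd ⟨0, F.m_pos⟩) = .eq ∧
          cm (.snd ⟨0, F.m_pos⟩) .length = .lt)
      | _ => false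
    | .isNot => match F.l[t]? with
      | some (.neg _) => true
      | _ => false
    | .isAnd => match F.l[t]? with
      | some (.lt i j) => decide (cm (.first _ i) (.first _ j) = .lt)
      | some (.ltn i) => decide (cm (.first _ i) .length = .lt)
      | some (.and _ _) => true
      | _ => false
    | .isOr => match F.l[t]? with
      | none => true
      | some (.lt i j) => decide (cm (.first _ i) (.first _ j) ≠ .lt)
      | some (.ltn i) => decide (cm (.first _ i) .length ≠ .lt)
      | some (.inp i) => decide (cm (.first _ i) .length ≠ .lt)
      | some (.ex _ _) => true
      | _ => false
    | .isThreshold => match F.l[t]? with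
      | some (.cnt _ _ y) => decide (cm (.first _ y) (.snd ⟨0, F.m_pos⟩) = .eq)
      | _ => false
    | .isWire => decide ((∀ i, cm (.snd i) .top ≠ .gt) ∧ t' ∈ F.childTags t ∧
        ∀ i : Fin F.m, F.bindsAt t i = false → cm (.fst i) (.snd i) = .eq)
    | .isOutUsed => decide (t = F.l.idxOf F.used ∧
        cm (.fst ⟨0, F.m_pos⟩) (.snd ⟨0, F.m_pos⟩) = .eq ∧
        ∀ i : Fin F.m, (i : ℕ) ≠ 0 → cm (.fst i) .zero = .eq)
    | .isOutBit => decide (t = F.l.idxOf F.bit ∧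
        cm (.fst ⟨0, F.m_pos⟩) (.snd ⟨0, F.m_pos⟩) = .eq ∧
        ∀ i : Fin F.m, (i : ℕ) ≠ 0 → cm (.fst i) .zero = .eq)

/-- The number of digits of the second argument of a query that are read in one step. -/
def rate (q : CircuitQuery) : ℕ := if q = .isWire then F.m else 1

theorem rate_pos (q : CircuitQuery) : 0 < F.rate q := by
  unfold rate; split_ifs
  · exact F.m_pos
  · exact one_pos

/-- The tag in the second argument of a query. -/
def sndTag (q : CircuitQuery) (b : ℕ) : ℕ := if q = .isWire then b % 2 ^ F.m else 0

/-- The second argument of a query without its tag. -/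
def sndRest (q : CircuitQuery) (b : ℕ) : ℕ := if q = .isWire then b / 2 ^ F.m else b

/-- The existence of a gate becomes a comparison of each component with `domSize n - 1`, written in
the form in which the automaton generates that number. -/
theorem lt_size_iff (n a : ℕ) :
    a < (F.circuit n).size ↔
      ∀ i : Fin F.m, fld F.m i (a / 2 ^ F.m) ≤ 15 + 16 * (2 ^ n.size - 1) := by
  have h1 : 15 + 16 * (2 ^ n.size - 1) + 1 = 2 ^ digitCount n := by
    have : 0 < 2 ^ n.size := by positivity
    rw [digitCount, pow_add]; omega
  have h2 : a < (F.circuit n).size ↔ a / 2 ^ F.m < (2 ^ F.m) ^ digitCount n := by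
    rw [Nat.div_lt_iff_lt_mul (by positivity), ← pow_succ]; rfl
  rw [h2]
  constructor
  · intro h i
    have := fld_lt F.m_pos i h
    omega
  · intro h
    refine lt_of_fld_lt F.m_pos fun i hi => ?_
    have := h ⟨i, hi⟩
    simp only at this
    omega

/-- Output gates are recognized by comparisons alone: the component `0` is the output position and
all other components vanish. -/
theorem update_zero_eq_iff {n t a b : ℕ} (ht : t < 2 ^ F.m) (ha : a < (F.circuit n).size) :
    (∃ j : Fin (domSize n), (j : ℕ) = b ∧
      F.gateNum n t (Function.update (0 : ℕ → ℕ) 0 (j : ℕ)) = a) ↔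
      a % 2 ^ F.m = t ∧ fld F.m 0 (a / 2 ^ F.m) = b ∧
        ∀ i : Fin F.m, (i : ℕ) ≠ 0 → fld F.m i (a / 2 ^ F.m) = 0 := by
  have hA := F.envOf_lt ⟨a, ha⟩
  simp only [envOf] at hA
  constructor
  · rintro ⟨j, rfl, rfl⟩
    have h1 : F.envOf (F.gateNum n t (Function.update (0 : ℕ → ℕ) 0 (j : ℕ))) =
        Function.update (0 : ℕ → ℕ) 0 (j : ℕ) := by
      refine F.envOf_gateNum ht (fun i _ => ?_) (fun i hi => ?_)
      · by_cases h : i = 0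
        · subst h; simp
        · rw [Function.update_of_ne h]; exact domSize_pos _
      · have := F.m_pos
        rw [Function.update_of_ne (by omega)]; rfl
    refine ⟨F.gateNum_mod ht _, ?_, fun i hi => ?_⟩
    · exact (congrFun h1 0).trans (by simp)
    · exact (congrFun h1 i).trans (by rw [Function.update_of_ne hi]; rfl)
  · rintro ⟨h1, h2, h3⟩
    refine ⟨⟨b, h2 ▸ hA 0⟩, rfl, ?_⟩
    have h4 := F.eq_gateNum (n := n) ⟨a, ha⟩
    simp only [h1] at h4
    refine Eq.trans ?_ h4.symm
    congr 1
    funext i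
    by_cases hi : i = 0
    · subst hi; simp [envOf, h2]
    · rw [Function.update_of_ne hi]
      by_cases hi' : i < F.m
      · exact (h3 ⟨i, hi'⟩ hi).symm
      · exact (F.envOf_of_le _ (by omega)).symm

/-- Kinds and wires are decided by the tags and by equalities and inequalities between components,
`n`, zero and the greatest value. The automaton starts with no digits read, so with ties everywhere,
and with the delay register 15. -/
theorem describe_eq (n : ℕ) (q : CircuitQuery) (a b : ℕ) :
    (F.circuit n).describe q a b = F.accepts q (a % 2 ^ F.m) (F.sndTag q b)
      (comparisons (F.rate q) (a / 2 ^ F.m) (F.sndRest q b) n 15 fun _ _ => .eq) := by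
  classical
  have hcm : (comparisons (F.rate q) (a / 2 ^ F.m) (F.sndRest q b) n 15 fun _ _ => .eq) =
      fun x y => compare (Track.val F.m (F.rate q) (a / 2 ^ F.m) (F.sndRest q b) n 15 x)
        (Track.val F.m (F.rate q) (a / 2 ^ F.m) (F.sndRest q b) n 15 y) := by
    funext x y; simp [comparisons]
  rw [hcm, TCCircuit.describe, accepts.eq_def]
  by_cases ha : a < (F.circuit n).size
  swap
  · rw [decide_eq_false (by rintro ⟨g, rfl, -⟩; exact ha g.2), decide_eq_false]
    · rfl
    · rw [lt_size_iff] at ha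
      simpa [Track.val, compare_le_iff_le] using ha
  rw [decide_eq_true (p := ∀ i, _) (by
    simpa [Track.val, compare_le_iff_le] using (F.lt_size_iff n a).1 ha), Bool.true_and]
  have hex : ∀ P : Fin (F.circuit n).size → Prop,
      (∃ g : Fin (F.circuit n).size, (g : ℕ) = a ∧ P g) ↔ P ⟨a, ha⟩ := by
    intro P
    constructor
    · rintro ⟨g, rfl, h⟩; exact h
    · intro h; exact ⟨_, rfl, h⟩
  have hk : (F.circuit n).kind ⟨a, ha⟩ = F.kindAt n (a % 2 ^ F.m) (a / 2 ^ F.m) := rfl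
  rw [Bool.eq_iff_iff, decide_eq_true_eq, hex]
  cases q with
  | isInput =>
    simp only [hk, kindAt]
    rcases F.l[a % 2 ^ F.m]? with _ | φ
    · simp
    · cases φ with
      | inp i =>
        simp [Fm.gateKind, Track.val_first, Track.val_snd, Track.val_length, rate, sndRest, fld_one,
          compare_lt_iff_lt]
        constructor
        · rintro ⟨j, rfl, h⟩
          split_ifs at h with h'
          simp only [GateKind.input.injEq] at h
          rw [← h]
          exact ⟨rfl, h'⟩
        · rintro ⟨rfl, h⟩
          exact ⟨⟨_, h⟩, rfl, by simp [h]⟩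
      | lt | ltn => simp only [Fm.gateKind]; split_ifs <;> simp
      | _ => simp [Fm.gateKind]
  | isNot =>
    simp only [hk, kindAt]
    rcases F.l[a % 2 ^ F.m]? with _ | φ
    · simp
    · cases φ with
      | inp | lt | ltn => simp only [Fm.gateKind]; split_ifs <;> simp
      | _ => simp [Fm.gateKind]
  | isAnd =>
    simp only [hk, kindAt]
    rcases F.l[a % 2 ^ F.m]? with _ | φ
    · simp
    · cases φ with
      | inp | lt | ltn =>
        simp only [Fm.gateKind, Track.val_first, Track.val_length, compare_lt_iff_lt]
        split_ifs <;> simp_all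
      | _ => simp [Fm.gateKind]
  | isOr =>
    simp only [hk, kindAt]
    rcases F.l[a % 2 ^ F.m]? with _ | φ
    · simp
    · cases φ with
      | inp | lt | ltn =>
        simp only [Fm.gateKind, Track.val_first, Track.val_length, compare_lt_iff_lt, ne_eq]
        split_ifs <;> simp_all
      | _ => simp [Fm.gateKind]
  | isThreshold =>
    simp only [hk, kindAt]
    rcases F.l[a % 2 ^ F.m]? with _ | φ
    · simp
    · cases φ with
      | inp | lt | ltn => simp only [Fm.gateKind]; split_ifs <;> simp
      | _ => simp [Fm.gateKind, Track.val_first, Track.val_snd, rate, sndRest, fld_one]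
  | isWire =>
    have hw : ∀ h, (F.circuit n).wire ⟨a, ha⟩ h =
      F.wireAt (a % 2 ^ F.m) (a / 2 ^ F.m) (h % 2 ^ F.m) (h / 2 ^ F.m) := fun _ => rfl
    simp only [hw, wireAt, Bool.and_eq_true, decide_eq_true_eq, Track.val, rate, sndRest, sndTag,
      if_true, compare_eq_iff_eq, ne_eq, compare_gt_iff_gt, not_lt]
    constructor
    · rintro ⟨h, rfl, h1, h2⟩
      exact ⟨(F.lt_size_iff n h).1 h.2, h1, fun i hi => h2 i i.2 hi⟩
    · rintro ⟨h1, h2, h3⟩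
      exact ⟨⟨b, (F.lt_size_iff n b).2 h1⟩, rfl, h2, fun f hf hb => h3 ⟨f, hf⟩ hb⟩
  | isOutUsed =>
    have h := F.update_zero_eq_iff (b := b) (F.idxOf_lt F.used_mem) ha
    simp only [Track.val, rate, sndRest, compare_eq_iff_eq, decide_eq_true_eq, reduceCtorEq,
      if_false, fld_one, ← h]
    exact ⟨fun ⟨j, h1, h2⟩ => ⟨j, h1, congrArg Fin.val h2⟩, fun ⟨j, h1, h2⟩ => ⟨j, h1, Fin.ext h2⟩⟩
  | isOutBit =>
    have h := F.update_zero_eq_iff (b := b) (F.idxOf_lt F.bit_mem) ha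
    simp only [Track.val, rate, sndRest, compare_eq_iff_eq, decide_eq_true_eq, reduceCtorEq,
      if_false, fld_one, ← h]
    exact ⟨fun ⟨j, h1, h2⟩ => ⟨j, h1, congrArg Fin.val h2⟩, fun ⟨j, h1, h2⟩ => ⟨j, h1, Fin.ext h2⟩⟩

end FmSystem

/-! ### The machine that computes the descriptions of the circuits -/

/-- The number with the given binary digits, least significant digit first. -/
def bval (s : List Bool) : ℕ := s.foldr Nat.bit 0

theorem testBit_bval (s : List Bool) (i : ℕ) : (bval s).testBit i = (s[i]?).getD false := by
  induction s generalizing i with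
  | nil => simp [bval]
  | cons b s ih =>
    cases i with
    | zero => simp [bval]
    | succ i => simpa [bval, Nat.testBit_bit_succ] using ih i

theorem bval_drop (s : List Bool) (k : ℕ) : bval (s.drop k) = bval s / 2 ^ k := by
  apply Nat.eq_of_testBit_eq
  intro i
  rw [testBit_bval, Nat.testBit_div_two_pow, testBit_bval, List.getElem?_drop, add_comm]

theorem bval_bits (n : ℕ) : bval n.bits = n := by
  induction n using Nat.binaryRec' with
  | zero => simp [bval]
  | bit b m hb ih =>
    rw [Nat.bits_append_bit m b hb]
    simp only [bval, List.foldr_cons] at *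
    rw [ih]

theorem getElem?_bits_zero (n : ℕ) : n.bits[0]? = if n = 0 then none else some n.bodd := by
  induction n using Nat.binaryRec' with
  | zero => simp
  | bit b m hb ih =>
    have h0 : Nat.bit b m ≠ 0 := by
      rw [Nat.bit_ne_zero_iff]
      exact hb
    rw [Nat.bits_append_bit m b hb, if_neg h0, Nat.bodd_bit]
    rfl

/-- The stacks of the machine: input, output, and the arguments of the query in reverse and in
normal order. -/
inductive QStack where
  | inp
  | out
  | revA
  | revB
  | argA
  | argB
  deriving DecidableEq

instance : Fintype QStack :=
  ⟨{.inp, .out, .revA, .revB, .argA, .argB}, fun k => by cases k <;> simp⟩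

instance : Fintype Ordering :=
  ⟨{.lt, .eq, .gt}, fun k => by cases k <;> simp⟩

/-- The stack alphabets. -/
@[reducible] def QStack.Γ : QStack → Type
  | inp => QuerySymbol
  | _ => Bool

/-- The labels of the program of the machine. -/
inductive QLabel where
  | start
  | readA
  | readB
  | turnA
  | turnB
  | tags
  | loop
  deriving DecidableEq

instance : Fintype QLabel :=
  ⟨{.start, .readA, .readB, .turnA, .turnB, .tags, .loop}, fun k => by cases k <;> simp⟩

/-- The internal states of the machine. -/
structure QState (m : ℕ) where
  q : CircuitQuery
  t : Fin m → Bool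
  t' : Fin m → Bool
  a : Fin m → Bool
  b : Fin m → Bool
  c : Fin 16
  cm : Track m → Track m → Ordering
  live : Bool
  o : Option Bool

noncomputable instance (m : ℕ) : Fintype (QState m) :=
  Fintype.ofInjective
    (fun v : QState m => ((v.q, v.t, v.t'), (v.a, v.b, v.c), (v.cm, v.live, v.o)))
    fun v w h => by cases v; cases w; simp only [Prod.mk.injEq] at h; simp [h]

namespace QState

variable {m : ℕ}

/-- The initial state. -/
def start (m : ℕ) : QState m :=
  ⟨.isInput, fun _ => false, fun _ => false, fun _ => false, fun _ => false, 15,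
    fun _ _ => .eq, false, none⟩

/-- Store a symbol as the query. -/
def setQuery (v : QState m) : Option QuerySymbol → QState m
  | some (.query q) => { v with q := q }
  | _ => v

/-- Store a digit that has been read. -/
def setDigit (v : QState m) : Option Bool → QState m
  | some b => { v with o := some b, live := true }
  | none => { v with o := none }

/-- Store a digit that has been read from the input. -/
def setInput (v : QState m) : Option QuerySymbol → QState m
  | some (.bit b) => v.setDigit (some b)
  | _ => v.setDigit none

/-- Store the `i`-th digit of a block of digits of the first argument. -/
def setA (i : ℕ) (v : QState m) (o : Option Bool) : QState m :=
  { v with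
    a := fun x => if x = i then o.getD false else v.a x
    live := v.live || o.isSome }

/-- Store the `i`-th digit of a block of digits of the second argument. -/
def setB (i : ℕ) (v : QState m) (o : Option Bool) : QState m :=
  { v with
    b := fun x => if x = i then o.getD false else v.b x
    live := v.live || o.isSome }

/-- Prepare for reading blocks of digits. -/
def clear (v : QState m) : QState m :=
  { v with a := fun _ => false, b := fun _ => false, live := false }

/-- Use blocks of digits as tags. -/
def setTags (v : QState m) : QState m := { v with t := v.a, t' := v.b }

/-- Process blocks of digits. -/
def advance (v : QState m) : QState m :=
  { v with
    c := nextDelay v.o v.c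
    cm := fun x y =>
      (compare (Track.digit v.a v.b v.o v.c x) (Track.digit v.a v.b v.o v.c y)).then (v.cm x y) }

end QState

/-! ### Reading blocks of digits from stacks -/

section PopN

variable {K : Type} [DecidableEq K] {Γ : K → Type} {Λ σ : Type}

/-- Pop `j` symbols from a stack. -/
def popN (k : K) (f : ℕ → σ → Option (Γ k) → σ) :
    ℕ → ℕ → Turing.TM2.Stmt Γ Λ σ → Turing.TM2.Stmt Γ Λ σ
  | 0, _, q => q
  | j + 1, i, q => .pop k (f i) (popN k f j (i + 1) q)

/-- The effect of `popN` on the internal state. -/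
def runN {β : Type} (f : ℕ → σ → Option β → σ) : ℕ → ℕ → σ → List β → σ
  | 0, _, v, _ => v
  | j + 1, i, v, s => runN f j (i + 1) (f i v s.head?) s.tail

/-- The pops belong to one statement, so a whole block is read within a single step of the machine.
-/
theorem stepAux_popN (k : K) (f : ℕ → σ → Option (Γ k) → σ) (j i : ℕ)
    (q : Turing.TM2.Stmt Γ Λ σ) (v : σ) (S : ∀ k, List (Γ k)) :
    Turing.TM2.stepAux (popN k f j i q) v S =
      Turing.TM2.stepAux q (runN f j i v (S k)) (Function.update S k ((S k).drop j)) := by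
  induction j generalizing i v S with
  | zero => simp [popN, runN]
  | succ j ih =>
    rw [popN, Turing.TM2.stepAux, ih]
    simp [runN]

end PopN

namespace QState

variable {m : ℕ}

/-- Digits beyond the end of the stack are stored as zeros, which pads arguments of different
lengths; `live` records whether a digit was actually present. -/
theorem runN_setA (j i : ℕ) (v : QState m) (s : List Bool) :
    runN setA j i v s =
      { v with
        a := fun x => if i ≤ x ∧ (x : ℕ) < i + j then (s[(x : ℕ) - i]?).getD false else v.a x
        live := v.live || (decide (0 < j) && !s.isEmpty) } := by
  induction j generalizing i v s with
  | zero =>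
    have : ∀ x : Fin m, ¬ (i ≤ (x : ℕ) ∧ (x : ℕ) < i + 0) := by omega
    simp only [runN, this, if_false]
    simp
  | succ j ih =>
    rw [runN, ih, setA]
    simp only [mk.injEq, true_and, and_true]
    constructor
    · funext x
      rcases lt_trichotomy (x : ℕ) i with h | h | h
      · rw [if_neg (by omega), if_neg (by omega), if_neg (by omega)]
      · rw [if_neg (by omega), if_pos h, if_pos (by omega), ← h, Nat.sub_self]
        cases s <;> rfl
      · by_cases h' : (x : ℕ) < i + (j + 1)
        · rw [if_pos (by omega), if_pos (by omega), List.getElem?_tail]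
          congr 3; omega
        · rw [if_neg (by omega), if_neg (by omega), if_neg (by omega)]
    · cases s <;> simp

theorem runN_setB (j i : ℕ) (v : QState m) (s : List Bool) :
    runN setB j i v s =
      { v with
        b := fun x => if i ≤ x ∧ (x : ℕ) < i + j then (s[(x : ℕ) - i]?).getD false else v.b x
        live := v.live || (decide (0 < j) && !s.isEmpty) } := by
  induction j generalizing i v s with
  | zero =>
    have : ∀ x : Fin m, ¬ (i ≤ (x : ℕ) ∧ (x : ℕ) < i + 0) := by omega
    simp only [runN, this, if_false]
    simp
  | succ j ih =>
    rw [runN, ih, setB]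
    simp only [mk.injEq, true_and, and_true]
    constructor
    · funext x
      rcases lt_trichotomy (x : ℕ) i with h | h | h
      · rw [if_neg (by omega), if_neg (by omega), if_neg (by omega)]
      · rw [if_neg (by omega), if_pos h, if_pos (by omega), ← h, Nat.sub_self]
        cases s <;> rfl
      · by_cases h' : (x : ℕ) < i + (j + 1)
        · rw [if_pos (by omega), if_pos (by omega), List.getElem?_tail]
          congr 3; omega
        · rw [if_neg (by omega), if_neg (by omega), if_neg (by omega)]
    · cases s <;> simp

end QState

/-- The contents of the stacks. -/
def qstk (i : List QuerySymbol) (o ra rb a b : List Bool) : ∀ k : QStack, List k.Γ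
  | .inp => i
  | .out => o
  | .revA => ra
  | .revB => rb
  | .argA => a
  | .argB => b

section Stacks

variable (i i' : List QuerySymbol) (o o' ra ra' rb rb' a a' b b' : List Bool)

theorem update_inp : Function.update (qstk i o ra rb a b) .inp (i' : List (QStack.Γ .inp)) = qstk i' o ra rb a b := by
  funext k; cases k <;> rfl

theorem update_out : Function.update (qstk i o ra rb a b) .out (o' : List (QStack.Γ .out)) = qstk i o' ra rb a b := by
  funext k; cases k <;> rfl

theorem update_revA : Function.update (qstk i o ra rb a b) .revA (ra' : List (QStack.Γ .revA)) = qstk i o ra' rb a b := by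
  funext k; cases k <;> rfl

theorem update_revB : Function.update (qstk i o ra rb a b) .revB (rb' : List (QStack.Γ .revB)) = qstk i o ra rb' a b := by
  funext k; cases k <;> rfl

theorem update_argA : Function.update (qstk i o ra rb a b) .argA (a' : List (QStack.Γ .argA)) = qstk i o ra rb a' b := by
  funext k; cases k <;> rfl

theorem update_argB : Function.update (qstk i o ra rb a b) .argB (b' : List (QStack.Γ .argB)) = qstk i o ra rb a b' := by
  funext k; cases k <;> rfl

end Stacks

/-- The configuration `c'` is reached from `c` in at most `N` steps. -/
def ReachesIn {α : Type} (f : α → Option α) (N : ℕ) (c c' : α) : Prop :=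
  ∃ k ≤ N, (flip bind f)^[k] (some c) = some c'

theorem ReachesIn.refl {α : Type} (f : α → Option α) (c : α) : ReachesIn f 0 c c :=
  ⟨0, le_rfl, rfl⟩

theorem ReachesIn.head {α : Type} {f : α → Option α} {N : ℕ} {c c₁ c' : α}
    (h : f c = some c₁) (h' : ReachesIn f N c₁ c') : ReachesIn f (N + 1) c c' := by
  obtain ⟨k, hk, h'⟩ := h'
  refine ⟨k + 1, by omega, ?_⟩
  rw [Function.iterate_succ_apply]
  change (flip bind f)^[k] (f c) = _
  rw [h, h']

theorem ReachesIn.trans {α : Type} {f : α → Option α} {N N' : ℕ} {c c₁ c' : α}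
    (h : ReachesIn f N c c₁) (h' : ReachesIn f N' c₁ c') : ReachesIn f (N + N') c c' := by
  obtain ⟨k, hk, h⟩ := h
  obtain ⟨k', hk', h'⟩ := h'
  refine ⟨k' + k, by omega, ?_⟩
  rw [Function.iterate_add_apply, h, h']

/-! ### The program and its running time -/

namespace FmSystem

variable (F : FmSystem)

/-- The result in a state in which the arguments have been read completely. -/
def result (v : QState F.m) : Bool :=
  F.accepts v.q (Nat.ofBits v.t) (Nat.ofBits v.t') (comparisons (F.rate v.q) 0 0 0 v.c v.cm)

open Turing.TM2.Stmt in
/-- The end of the main loop: repeat the loop if a digit has been read. -/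
def finishLoop : Turing.TM2.Stmt QStack.Γ QLabel (QState F.m) :=
  pop .inp QState.setInput <| branch (fun v => v.live)
    (load QState.advance <| goto fun _ => .loop)
    (push .out F.result <| load (fun _ => QState.start F.m) halt)

open Turing.TM2.Stmt in
/-- The program of the machine. -/
def program : QLabel → Turing.TM2.Stmt QStack.Γ QLabel (QState F.m)
  | .start => pop .inp QState.setQuery <| goto fun _ => .readA
  | .readA => pop .inp QState.setInput <| branch (fun v => v.o.isSome)
      (push .revA (fun v => v.o.getD false) <| goto fun _ => .readA) (goto fun _ => .readB)
  | .readB => pop .inp QState.setInput <| branch (fun v => v.o.isSome)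
      (push .revB (fun v => v.o.getD false) <| goto fun _ => .readB) (goto fun _ => .turnA)
  | .turnA => pop .revA QState.setDigit <| branch (fun v => v.o.isSome)
      (push .argA (fun v => v.o.getD false) <| goto fun _ => .turnA) (goto fun _ => .turnB)
  | .turnB => pop .revB QState.setDigit <| branch (fun v => v.o.isSome)
      (push .argB (fun v => v.o.getD false) <| goto fun _ => .turnB) (goto fun _ => .tags)
  | .tags => popN .argA QState.setA F.m 0 <| branch (fun v => decide (v.q = .isWire))
      (popN .argB QState.setB F.m 0 <| load QState.setTags <| goto fun _ => .loop)
      (load QState.setTags <| goto fun _ => .loop)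
  | .loop => load QState.clear <| popN .argA QState.setA F.m 0 <|
      branch (fun v => decide (v.q = .isWire))
        (popN .argB QState.setB F.m 0 F.finishLoop) (popN .argB QState.setB 1 0 F.finishLoop)

/-- A configuration of the machine. -/
abbrev QCfg := Turing.TM2.Cfg QStack.Γ QLabel (QState F.m)

theorem step_start (v : QState F.m) (q : CircuitQuery) (i : List QuerySymbol)
    (o ra rb a b : List Bool) :
    Turing.TM2.step F.program ⟨some .start, v, qstk (.query q :: i) o ra rb a b⟩ =
      some ⟨some .readA, { v with q := q }, qstk i o ra rb a b⟩ := by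
  simp only [Turing.TM2.step, program, Turing.TM2.stepAux, update_inp]
  rfl

/-- The state after the digits of an argument have been read. -/
def afterRead (v : QState F.m) (s : List Bool) : QState F.m :=
  { v with o := none, live := v.live || !s.isEmpty }

/-- Moving an argument to a stack reverses it; the phase `turnA` reverses it again, so that the
least significant digit ends on top. -/
theorem reaches_readA (v : QState F.m) (s : List Bool) (i : List QuerySymbol)
    (o ra rb a b : List Bool) :
    ReachesIn (Turing.TM2.step F.program) (s.length + 1)
      ⟨some .readA, v, qstk (s.map .bit ++ .sep :: i) o ra rb a b⟩
      ⟨some .readB, F.afterRead v s, qstk i o (s.reverse ++ ra) rb a b⟩ := by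
  induction s generalizing v ra with
  | nil =>
    refine ReachesIn.head ?_ (ReachesIn.refl _ _)
    simp only [Turing.TM2.step, program, Turing.TM2.stepAux, update_inp]
    simp [qstk, QState.setInput, QState.setDigit, afterRead]
  | cons x s ih =>
    have h := ih { v with o := some x, live := true } (x :: ra)
    refine ReachesIn.head (c₁ := ⟨some .readA, { v with o := some x, live := true },
      qstk (s.map .bit ++ .sep :: i) o (x :: ra) rb a b⟩) ?_ ?_
    · simp only [Turing.TM2.step, program, Turing.TM2.stepAux, update_inp, update_revA]
      simp [qstk, QState.setInput, QState.setDigit]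
    · convert h using 2 <;> simp [afterRead]

theorem reaches_readB (v : QState F.m) (s : List Bool) (i : List QuerySymbol)
    (o ra rb a b : List Bool) :
    ReachesIn (Turing.TM2.step F.program) (s.length + 1)
      ⟨some .readB, v, qstk (s.map .bit ++ .sep :: i) o ra rb a b⟩
      ⟨some .turnA, F.afterRead v s, qstk i o ra (s.reverse ++ rb) a b⟩ := by
  induction s generalizing v rb with
  | nil =>
    refine ReachesIn.head ?_ (ReachesIn.refl _ _)
    simp only [Turing.TM2.step, program, Turing.TM2.stepAux, update_inp]
    simp [qstk, QState.setInput, QState.setDigit, afterRead]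
  | cons x s ih =>
    have h := ih { v with o := some x, live := true } (x :: rb)
    refine ReachesIn.head (c₁ := ⟨some .readB, { v with o := some x, live := true },
      qstk (s.map .bit ++ .sep :: i) o ra (x :: rb) a b⟩) ?_ ?_
    · simp only [Turing.TM2.step, program, Turing.TM2.stepAux, update_inp, update_revB]
      simp [qstk, QState.setInput, QState.setDigit]
    · convert h using 2 <;> simp [afterRead]

theorem reaches_turnA (v : QState F.m) (s : List Bool) (i : List QuerySymbol)
    (o rb a b : List Bool) :
    ReachesIn (Turing.TM2.step F.program) (s.length + 1)
      ⟨some .turnA, v, qstk i o s rb a b⟩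
      ⟨some .turnB, F.afterRead v s, qstk i o [] rb (s.reverse ++ a) b⟩ := by
  induction s generalizing v a with
  | nil =>
    refine ReachesIn.head ?_ (ReachesIn.refl _ _)
    simp only [Turing.TM2.step, program, Turing.TM2.stepAux, update_revA]
    simp [qstk, QState.setDigit, afterRead]
  | cons x s ih =>
    have h := ih { v with o := some x, live := true } (x :: a)
    refine ReachesIn.head (c₁ := ⟨some .turnA, { v with o := some x, live := true },
      qstk i o s rb (x :: a) b⟩) ?_ ?_
    · simp only [Turing.TM2.step, program, Turing.TM2.stepAux, update_revA, update_argA]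
      simp [qstk, QState.setDigit]
    · convert h using 2 <;> simp [afterRead]

theorem reaches_turnB (v : QState F.m) (s : List Bool) (i : List QuerySymbol)
    (o ra a b : List Bool) :
    ReachesIn (Turing.TM2.step F.program) (s.length + 1)
      ⟨some .turnB, v, qstk i o ra s a b⟩
      ⟨some .tags, F.afterRead v s, qstk i o ra [] a (s.reverse ++ b)⟩ := by
  induction s generalizing v b with
  | nil =>
    refine ReachesIn.head ?_ (ReachesIn.refl _ _)
    simp only [Turing.TM2.step, program, Turing.TM2.stepAux, update_revB]
    simp [qstk, QState.setDigit, afterRead]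
  | cons x s ih =>
    have h := ih { v with o := some x, live := true } (x :: b)
    refine ReachesIn.head (c₁ := ⟨some .turnB, { v with o := some x, live := true },
      qstk i o ra s a (x :: b)⟩) ?_ ?_
    · simp only [Turing.TM2.step, program, Turing.TM2.stepAux, update_revB, update_argB]
      simp [qstk, QState.setDigit]
    · convert h using 2 <;> simp [afterRead]

/-- The first `w` elements of a list, as a block of `m` digits. -/
def block (w : ℕ) {m : ℕ} (s : List Bool) (x : Fin m) : Bool :=
  if (x : ℕ) < w then (s[(x : ℕ)]?).getD false else false

theorem block_eq (w : ℕ) {m : ℕ} (s : List Bool) (x : Fin m) :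
    block w s x = (bval s % 2 ^ w).testBit x := by
  rw [block, Nat.testBit_mod_two_pow, testBit_bval]
  by_cases h : (x : ℕ) < w <;> simp [h]

theorem ofBits_block {m : ℕ} (s : List Bool) :
    Nat.ofBits (block m s : Fin m → Bool) = bval s % 2 ^ m := by
  rw [← Nat.ofBits_testBit (bval s) m]
  congr 1
  funext x
  rw [block_eq, Nat.testBit_mod_two_pow]
  simp

/-- The number of digits of the tag in the second argument. -/
def tagRate (q : CircuitQuery) : ℕ := if q = .isWire then F.m else 0

/-- The main loop overwrites all other components of the state, so only these five need to be known.
For queries other than `isWire` nothing is popped from the second argument, and its tag is the block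
of zeros already in the state. -/
theorem step_tags (v : QState F.m) (hv' : v.b = fun _ => false) (i : List QuerySymbol) (a b : List Bool) :
    ∃ w : QState F.m, Turing.TM2.step F.program ⟨some .tags, v, qstk i [] [] [] a b⟩ =
      some ⟨some .loop, w, qstk i [] [] [] (a.drop F.m) (b.drop (F.tagRate v.q))⟩ ∧
      w.q = v.q ∧ w.t = block F.m a ∧ w.t' = block (F.tagRate v.q) b ∧ w.c = v.c ∧
      w.cm = v.cm := by
  refine ⟨(runN QState.setB (F.tagRate v.q) 0 (runN QState.setA F.m 0 v a) b).setTags, ?_, ?_⟩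
  · simp only [Turing.TM2.step, program, Turing.TM2.stepAux, stepAux_popN]
    by_cases hq : v.q = .isWire
    · have hq' : (runN QState.setA F.m 0 v (qstk i [] [] [] a b .argA)).q = .isWire := by
        rw [QState.runN_setA]; exact hq
      rw [decide_eq_true hq', cond_true, update_argA, update_argB]
      simp only [tagRate, hq, if_true]
      rfl
    · have hq' : (runN QState.setA F.m 0 v (qstk i [] [] [] a b .argA)).q ≠ .isWire := by
        rw [QState.runN_setA]; exact hq
      rw [decide_eq_false hq', cond_false, update_argA]
      simp only [tagRate, hq, if_false]
      rfl
  · rw [QState.runN_setA, QState.runN_setB]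
    refine ⟨rfl, ?_, ?_, rfl, rfl⟩
    · funext x; simp [QState.setTags, block]
    · funext x; simp [QState.setTags, block, hv']

/-- The state after blocks of digits have been read. -/
def afterBlocks (v : QState F.m) (i : List QuerySymbol) (a b : List Bool) : QState F.m :=
  QState.setInput { v with
    a := block F.m a
    b := block (F.rate v.q) b
    live := !a.isEmpty || !b.isEmpty } i.head?

theorem step_loop (v : QState F.m) (i : List QuerySymbol) (a b : List Bool) :
    Turing.TM2.step F.program ⟨some .loop, v, qstk i [] [] [] a b⟩ =
      some (if (F.afterBlocks v i a b).live then
        ⟨some .loop, (F.afterBlocks v i a b).advance,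
          qstk i.tail [] [] [] (a.drop F.m) (b.drop (F.rate v.q))⟩
      else ⟨none, QState.start F.m, qstk i.tail [F.result (F.afterBlocks v i a b)] [] []
          (a.drop F.m) (b.drop (F.rate v.q))⟩) := by
  have key : ∀ (w : QState F.m) (a' b' : List Bool),
      Turing.TM2.stepAux F.finishLoop w (qstk i [] [] [] a' b') =
      if (w.setInput i.head?).live then
        ⟨some QLabel.loop, (w.setInput i.head?).advance, qstk i.tail [] [] [] a' b'⟩
      else ⟨none, QState.start F.m, qstk i.tail [F.result (w.setInput i.head?)] [] [] a' b'⟩ := by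
    intro w a' b'
    simp only [finishLoop, Turing.TM2.stepAux, update_inp, update_out]
    cases h : (w.setInput i.head?).live <;> simp [qstk, h]
  by_cases hq : v.q = .isWire
  · have hw : F.afterBlocks v i a b = QState.setInput (runN QState.setB F.m 0
        (runN QState.setA F.m 0 v.clear a) b) i.head? := by
      rw [afterBlocks, QState.runN_setA, QState.runN_setB]
      congr 1
      have := F.m_pos
      simp only [QState.clear, rate, hq, if_true, QState.mk.injEq, true_and, and_true]
      refine ⟨?_, ?_, ?_⟩
      · funext x; simp [block]
      · funext x; simp [block]
      · simp [this]
    simp only [Turing.TM2.step, program, Turing.TM2.stepAux, stepAux_popN]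
    have hq' : (runN QState.setA F.m 0 v.clear (qstk i [] [] [] a b .argA)).q = .isWire := by
      rw [QState.runN_setA]; exact hq
    rw [decide_eq_true hq', cond_true, update_argA, update_argB, key, hw]
    simp only [rate, hq, if_true]
    rfl
  · have hw : F.afterBlocks v i a b = QState.setInput (runN QState.setB 1 0
        (runN QState.setA F.m 0 v.clear a) b) i.head? := by
      rw [afterBlocks, QState.runN_setA, QState.runN_setB]
      congr 1
      have := F.m_pos
      simp only [QState.clear, rate, hq, if_false, QState.mk.injEq, true_and, and_true]
      refine ⟨?_, ?_, ?_⟩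
      · funext x; simp [block]
      · funext x; simp [block]
      · simp [this]
    simp only [Turing.TM2.step, program, Turing.TM2.stepAux, stepAux_popN]
    have hq' : (runN QState.setA F.m 0 v.clear (qstk i [] [] [] a b .argA)).q ≠ .isWire := by
      rw [QState.runN_setA]; exact hq
    rw [decide_eq_false hq', cond_false, update_argA, update_argB, key, hw]
    simp only [rate, hq, if_false]
    rfl

theorem afterBlocks_eq (v : QState F.m) (n : ℕ) (a b : List Bool) :
    F.afterBlocks v (n.bits.map .bit) a b =
      { v with
        a := block F.m a
        b := block (F.rate v.q) b
        live := !n.bits.isEmpty || !a.isEmpty || !b.isEmpty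
        o := if n = 0 then none else some n.bodd } := by
  rw [← getElem?_bits_zero]
  rcases n.bits with _ | ⟨x, s⟩ <;> simp [afterBlocks, QState.setInput, QState.setDigit]

/-- Induction on the number of unread digits: every pass that finds a digit shortens the total, and
`comparisons_step` keeps the result unchanged. Once nothing is left, the residual numbers are zero
and the stored comparisons are the answer. -/
theorem reaches_loop (N : ℕ) (v : QState F.m) (n : ℕ) (a b : List Bool)
    (hN : n.bits.length + a.length + b.length ≤ N) :
    ReachesIn (Turing.TM2.step F.program) (N + 1)
      ⟨some .loop, v, qstk (n.bits.map .bit) [] [] [] a b⟩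
      ⟨none, QState.start F.m, qstk [] [F.accepts v.q (Nat.ofBits v.t) (Nat.ofBits v.t')
        (comparisons (F.rate v.q) (bval a) (bval b) n v.c v.cm)] [] [] [] []⟩ := by
  induction N using Nat.strong_induction_on generalizing v n a b with
  | _ N ih =>
    by_cases h0 : n.bits.length + a.length + b.length = 0
    · have h1 : n.bits = [] := List.length_eq_zero_iff.1 (by omega)
      have h2 : a = [] := List.length_eq_zero_iff.1 (by omega)
      have h3 : b = [] := List.length_eq_zero_iff.1 (by omega)
      have h4 : n = 0 := by rw [← bval_bits n, h1]; rfl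
      obtain ⟨k, hk, h⟩ := ReachesIn.head (N := 0) (F.step_loop v (n.bits.map .bit) a b)
        (ReachesIn.refl _ _)
      refine ⟨k, by omega, h.trans ?_⟩
      rw [afterBlocks_eq]
      subst h2 h3 h4
      rw [if_neg (by simp)]
      simp [result, bval]
    · have hlive : (!n.bits.isEmpty || !a.isEmpty || !b.isEmpty) = true := by
        rcases hn : n.bits with _ | _ <;> rcases a with _ | _ <;> rcases b with _ | _ <;>
          simp_all
      have hm := F.m_pos
      have hr := F.rate_pos v.q
      have htail : (n.bits.map QuerySymbol.bit).tail = (n / 2).bits.map .bit := by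
        rw [← List.map_tail, ← Nat.div2_bits_eq_tail, Nat.div2_val]
      have hlen : (n / 2).bits.length = n.bits.length - 1 := by
        rw [← Nat.div2_val, Nat.div2_bits_eq_tail, List.length_tail]
      have h := ih (N - 1) (by omega) (F.afterBlocks v (n.bits.map .bit) a b).advance (n / 2)
        (a.drop F.m) (b.drop (F.rate v.q)) (by
          simp only [List.length_drop, hlen]
          omega)
      have hstep := F.step_loop v (n.bits.map .bit) a b
      rw [if_pos (by rw [afterBlocks_eq]; exact hlive), htail] at hstep
      have h2 := ReachesIn.head hstep h
      rw [Nat.sub_add_cancel (by omega)] at h2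
      obtain ⟨k, hk, h2⟩ := h2
      refine ⟨k, by omega, h2.trans ?_⟩
      rw [afterBlocks_eq]
      simp only [QState.advance]
      rw [comparisons_step hm hr (r := bval a) (s := bval b) (n := n) v.c v.cm
        (fun x => block_eq F.m a x) (fun x => block_eq (F.rate v.q) b x) rfl, bval_drop, bval_drop]

/-- The machine that computes the descriptions of the circuits. -/
noncomputable def machine : Turing.FinTM2 where
  K := QStack
  k₀ := .inp
  k₁ := .out
  Γ := QStack.Γ
  Λ := QLabel
  main := .start
  σ := QState F.m
  initialState := QState.start F.m
  Γk₀Fin := inferInstanceAs (Fintype QuerySymbol)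
  m := F.program

/-- Each digit of `a` and `b` is handled at most three times (moved, moved back, compared) and each
digit of `n` once, which gives the factor 3; the summand 10 covers the changes of phase. -/
theorem reaches_machine (q : CircuitQuery) (a b n : ℕ) :
    ReachesIn (Turing.TM2.step F.program) (3 * (queryWord (q, a, b, n)).length + 10)
      ⟨some .start, QState.start F.m, qstk (queryWord (q, a, b, n)) [] [] [] [] []⟩
      ⟨none, QState.start F.m,
        qstk [] [(F.circuit n).describe q a b] [] [] [] []⟩ := by
  have hA := F.reaches_readA { QState.start F.m with q := q } a.bits
    (b.bits.map .bit ++ .sep :: n.bits.map .bit) [] [] [] [] []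
  have hB := F.reaches_readB (F.afterRead { QState.start F.m with q := q } a.bits) b.bits
    (n.bits.map .bit) [] (a.bits.reverse ++ []) [] [] []
  have h1 := (ReachesIn.head (F.step_start (QState.start F.m) q _ _ _ _ _ _) hA).trans hB
  have hA' := F.reaches_turnA (F.afterRead (F.afterRead { QState.start F.m with q := q } a.bits)
    b.bits) (a.bits.reverse ++ []) (n.bits.map .bit) [] (b.bits.reverse ++ []) [] []
  have hB' := F.reaches_turnB (F.afterRead (F.afterRead (F.afterRead
    { QState.start F.m with q := q } a.bits) b.bits) (a.bits.reverse ++ []))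
    (b.bits.reverse ++ []) (n.bits.map .bit) [] [] ((a.bits.reverse ++ []).reverse ++ []) []
  have h2 := (h1.trans hA').trans hB'
  obtain ⟨w, hw, hwq, hwt, hwt', hwc, hwcm⟩ := F.step_tags (F.afterRead (F.afterRead (F.afterRead
    (F.afterRead { QState.start F.m with q := q } a.bits) b.bits) (a.bits.reverse ++ []))
      (b.bits.reverse ++ [])) rfl (n.bits.map .bit) a.bits b.bits
  have h3 := F.reaches_loop _ w n (a.bits.drop F.m) (b.bits.drop (F.tagRate q)) le_rfl
  have e1 : (a.bits.reverse ++ []).reverse ++ [] = a.bits := by simp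
  have e2 : (b.bits.reverse ++ []).reverse ++ [] = b.bits := by simp
  rw [e1, e2] at h2
  obtain ⟨k, hk, h⟩ := h2.trans (ReachesIn.head hw h3)
  refine ⟨k, hk.trans ?_, h.trans ?_⟩
  · simp only [queryWord, binWord, List.length_cons, List.length_append, List.length_map,
      List.length_drop, List.length_reverse, List.length_nil]
    omega
  · have hq : w.q = q := hwq
    have hc : w.c = 15 := hwc
    have hcm : w.cm = fun _ _ => .eq := hwcm
    have ht : Nat.ofBits w.t = a % 2 ^ F.m := by rw [hwt, ofBits_block, bval_bits]
    have ht' : Nat.ofBits w.t' = F.sndTag q b := by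
      rw [hwt', sndTag]
      change Nat.ofBits (block (F.tagRate q) b.bits) = _
      rw [tagRate]
      split_ifs with h
      · rw [ofBits_block, bval_bits]
      · apply Nat.eq_of_testBit_eq
        intro i
        by_cases hi : i < F.m
        · rw [Nat.testBit_ofBits_lt _ _ hi]; simp [block]
        · rw [Nat.testBit_ofBits_ge _ _ (by omega)]; simp
    have hs : bval (b.bits.drop (F.tagRate q)) = F.sndRest q b := by
      rw [bval_drop, bval_bits, tagRate, sndRest]
      split_ifs <;> simp
    rw [F.describe_eq, hq, hc, hcm, ht, ht', hs, bval_drop, bval_bits]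
    rfl

theorem dLogTimeUniform_circuit : DLogTimeUniform F.circuit := by
  refine ⟨⟨⟨F.machine, Equiv.refl _, Equiv.refl _⟩, fun N => 3 * N + 10, fun t => ?_⟩, 10,
    fun N => by change 3 * N + 10 ≤ _; omega⟩
  obtain ⟨q, a, b, n⟩ := t
  have h := F.reaches_machine q a b n
  have e1 : Turing.initList F.machine (queryWord (q, a, b, n)) =
      (⟨some .start, QState.start F.m, qstk (queryWord (q, a, b, n)) [] [] [] [] []⟩ : F.QCfg) := by
    unfold Turing.initList
    congr 1
    funext k
    cases k <;> rfl
  -- A halting configuration must have the initial internal state and nothing on the stacks but the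
  -- output; hence the reset at the end of the program.
  have e2 : Turing.haltList F.machine [(F.circuit n).describe q a b] =
      (⟨none, QState.start F.m, qstk [] [(F.circuit n).describe q a b] [] [] [] []⟩ : F.QCfg) := by
    unfold Turing.haltList
    congr 1
    funext k
    cases k <;> rfl
  refine ⟨⟨h.choose, ?_⟩, h.choose_spec.1⟩
  have h' := h.choose_spec.2
  have e3 : List.map (Equiv.refl QuerySymbol).invFun (queryWord (q, a, b, n)) =
      queryWord (q, a, b, n) := List.map_id _
  refine Eq.trans ?_ (h'.trans (congrArg some e2.symm))
  refine congrArg _ (congrArg some (Eq.trans ?_ e1))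
  exact congrArg (Turing.initList F.machine) e3

theorem isUniformTC0_circuit : IsUniformTC0 F.circuit :=
  ⟨F.circuit_depth, F.circuit_size, F.dLogTimeUniform_circuit⟩

end FmSystem

/-! ### Path width and interval representations -/

/-- The graph with the vertices `X` and the adjacency relation `A` has a representation by intervals
of natural numbers such that no number lies in more than `k + 1` intervals. -/
def HasIntervals (A : ℕ → ℕ → Prop) (X : Finset ℕ) (k : ℕ) : Prop :=
  ∃ l r : ℕ → ℕ, (∀ v ∈ X, l v ≤ r v) ∧ (∀ u ∈ X, ∀ v ∈ X, A u v → l u ≤ r v ∧ l v ≤ r u) ∧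
    ∀ i, (X.filter fun v => l v ≤ i ∧ i ≤ r v).card ≤ k + 1

theorem HasIntervals.mono {A B : ℕ → ℕ → Prop} {X Y : Finset ℕ} {k : ℕ} (h : HasIntervals A X k)
    (hYX : Y ⊆ X) (hBA : ∀ u ∈ Y, ∀ v ∈ Y, B u v → A u v) : HasIntervals B Y k := by
  obtain ⟨l, r, h1, h2, h3⟩ := h
  exact ⟨l, r, fun v hv => h1 v (hYX hv),
    fun u hu v hv huv => h2 u (hYX hu) v (hYX hv) (hBA u hu v hv huv),
    fun i => (Finset.card_le_card (Finset.filter_subset_filter _ hYX)).trans (h3 i)⟩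

/-- The decomposition with a single bag shows that the minimum is attained. The truncated
subtraction is harmless, since m - 1 ≤ k and m ≤ k + 1 are equivalent for natural numbers. -/
theorem pathWidth_le_iff_exists {V : Type*} [Fintype V] {G : SimpleGraph V} {k : ℕ} :
    pathWidth G ≤ k ↔ ∃ D : PathDecomposition G, ∀ i, (D.bag i).card ≤ k + 1 := by
  have hne : (Set.range fun D : PathDecomposition G => D.width).Nonempty := by
    have : Nonempty (PathDecomposition G) :=
      ⟨⟨0, fun _ => Finset.univ, fun v => ⟨0, Finset.mem_univ v⟩,
        fun u v _ => ⟨0, Finset.mem_univ u, Finset.mem_univ v⟩,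
        fun v _ j _ _ _ _ _ => Finset.mem_univ v⟩⟩
    exact Set.range_nonempty _
  constructor
  · intro h
    obtain ⟨D, hD⟩ := Nat.sInf_mem hne
    refine ⟨D, fun i => ?_⟩
    have h1 : D.width ≤ k := hD.trans_le h
    have h2 : (D.bag i).card ≤ Finset.univ.sup fun i => (D.bag i).card :=
      Finset.le_sup (f := fun i => (D.bag i).card) (Finset.mem_univ i)
    unfold PathDecomposition.width at h1
    omega
  · rintro ⟨D, hD⟩
    have h1 : pathWidth G ≤ D.width := Nat.sInf_le (Set.mem_range_self D)
    refine h1.trans ?_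
    have : (Finset.univ.sup fun i => (D.bag i).card) ≤ k + 1 := Finset.sup_le fun i _ => hD i
    unfold PathDecomposition.width
    omega

/-- The bags that contain a vertex range from a first to a last one and give its interval;
conversely, the intervals through a point form a bag. -/
theorem pathWidth_le_iff {n : ℕ} {G : SimpleGraph (Fin n)} {A : ℕ → ℕ → Prop}
    (hA : ∀ u v : Fin n, G.Adj u v ↔ A u v) {k : ℕ} :
    pathWidth G ≤ k ↔ HasIntervals A (Finset.range n) k := by
  classical
  rw [pathWidth_le_iff_exists]
  constructor
  · rintro ⟨D, hD⟩
    let idx : Fin n → Finset (Fin (D.len + 1)) := fun v => Finset.univ.filter fun i => v ∈ D.bag i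
    have hidx : ∀ v, (idx v).Nonempty := fun v => by
      obtain ⟨i, hi⟩ := D.vertex_mem v
      exact ⟨i, by simp [idx, hi]⟩
    have hmem : ∀ v i, i ∈ idx v ↔ v ∈ D.bag i := fun v i => by simp [idx]
    refine ⟨fun v => if h : v < n then ((idx ⟨v, h⟩).min' (hidx _) : ℕ) else 0,
      fun v => if h : v < n then ((idx ⟨v, h⟩).max' (hidx _) : ℕ) else 0, ?_, ?_, ?_⟩
    · intro v hv
      rw [Finset.mem_range] at hv
      simp only [hv, dif_pos]
      exact Fin.le_def.1 ((idx ⟨v, hv⟩).min'_le_max' (hidx _))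
    · intro u hu v hv huv
      rw [Finset.mem_range] at hu hv
      simp only [hu, hv, dif_pos]
      obtain ⟨i, h1, h2⟩ := D.edge_mem ⟨u, hu⟩ ⟨v, hv⟩ ((hA _ _).2 huv)
      rw [← hmem] at h1 h2
      exact ⟨Fin.le_def.1 ((Finset.min'_le _ _ h1).trans (Finset.le_max' _ _ h2)),
        Fin.le_def.1 ((Finset.min'_le _ _ h2).trans (Finset.le_max' _ _ h1))⟩
    · intro i
      by_cases hi : i < D.len + 1
      · refine le_trans ?_ (hD ⟨i, hi⟩)
        rw [← Finset.card_map Fin.valEmbedding (s := D.bag ⟨i, hi⟩)]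
        refine Finset.card_le_card fun v hv => ?_
        simp only [Finset.mem_filter, Finset.mem_range] at hv
        obtain ⟨hv, h1, h2⟩ := hv
        simp only [hv, dif_pos] at h1 h2
        refine Finset.mem_map.2 ⟨⟨v, hv⟩, ?_, rfl⟩
        exact D.connected _ ((idx ⟨v, hv⟩).min' (hidx _)) ⟨i, hi⟩ ((idx ⟨v, hv⟩).max' (hidx _))
          h1 h2 ((hmem _ _).1 (Finset.min'_mem _ _)) ((hmem _ _).1 (Finset.max'_mem _ _))
      · rw [Finset.card_eq_zero.2]
        · omega
        · refine Finset.filter_eq_empty_iff.2 fun v hv h => ?_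
          rw [Finset.mem_range] at hv
          simp only [hv, dif_pos] at h
          have := ((idx ⟨v, hv⟩).max' (hidx _)).2
          omega
  · rintro ⟨l, r, h1, h2, h3⟩
    have hr : ∀ v : Fin n, r v ≤ (Finset.range n).sup r := fun v =>
      Finset.le_sup (Finset.mem_range.2 v.2)
    have hl : ∀ v : Fin n, l v ≤ r v := fun v => h1 v (Finset.mem_range.2 v.2)
    refine ⟨⟨(Finset.range n).sup r,
      fun i => Finset.univ.filter fun v : Fin n => l v ≤ i ∧ i ≤ r v, ?_, ?_, ?_⟩, ?_⟩
    · intro v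
      have := hr v
      have := hl v
      exact ⟨⟨l v, by omega⟩, by simp; omega⟩
    · intro u v huv
      obtain ⟨h4, h5⟩ := h2 u (Finset.mem_range.2 u.2) v (Finset.mem_range.2 v.2) ((hA u v).1 huv)
      have := hr u
      have := hr v
      have := hl u
      have := hl v
      -- Two intersecting intervals share the larger of their left endpoints.
      exact ⟨⟨max (l u) (l v), by omega⟩, by simp; omega, by simp; omega⟩
    · intro v i j m hij hjm hi hm
      simp only [Finset.mem_filter, Finset.mem_univ, true_and] at hi hm ⊢
      have := Fin.le_def.1 hij
      have := Fin.le_def.1 hjm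
      omega
    · intro i
      refine le_trans ?_ (h3 i)
      rw [← Finset.card_map Fin.valEmbedding]
      refine Finset.card_le_card fun v hv => ?_
      obtain ⟨w, hw, rfl⟩ := Finset.mem_map.1 hv
      simpa using hw

/-- Intervals are transported along an injective relabeling; the kernel needs this because it
renumbers the surviving vertices. -/
theorem hasIntervals_image {A : ℕ → ℕ → Prop} {X : Finset ℕ} {f : ℕ → ℕ} (hf : Set.InjOn f X)
    {k : ℕ} : HasIntervals (fun u v => A (f u) (f v)) X k ↔ HasIntervals A (X.image f) k := by
  constructor
  · rintro ⟨l, r, h1, h2, h3⟩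
    have hinv : ∀ x ∈ X, Function.invFunOn f X (f x) = x := fun x hx =>
      hf.leftInvOn_invFunOn hx
    refine ⟨l ∘ Function.invFunOn f X, r ∘ Function.invFunOn f X, ?_, ?_, fun i => ?_⟩
    · intro v hv
      obtain ⟨x, hx, rfl⟩ := Finset.mem_image.1 hv
      simpa [hinv x hx] using h1 x hx
    · intro u hu v hv huv
      obtain ⟨x, hx, rfl⟩ := Finset.mem_image.1 hu
      obtain ⟨y, hy, rfl⟩ := Finset.mem_image.1 hv
      simpa [hinv x hx, hinv y hy] using h2 x hx y hy huv
    · refine le_trans (le_of_eq ?_) (h3 i)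
      rw [Finset.filter_image, Finset.card_image_of_injOn (hf.mono fun x hx => (Finset.mem_filter.1 hx).1)]
      congr 1
      refine Finset.filter_congr fun x hx => ?_
      simp [hinv x hx]
  · rintro ⟨l, r, h1, h2, h3⟩
    refine ⟨l ∘ f, r ∘ f, fun v hv => h1 _ (Finset.mem_image_of_mem f hv),
      fun u hu v hv huv => h2 _ (Finset.mem_image_of_mem f hu) _ (Finset.mem_image_of_mem f hv) huv,
      fun i => le_trans (le_of_eq ?_) (h3 i)⟩
    rw [Finset.filter_image, Finset.card_image_of_injOn (hf.mono fun x hx => (Finset.mem_filter.1 hx).1)]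
    rfl

/-- The vertices of a vertex cover and one further vertex form a bag. -/
theorem hasIntervals_of_cover {A : ℕ → ℕ → Prop} {X S : Finset ℕ}
    (hS : ∀ u ∈ X, ∀ v ∈ X, A u v → u ∈ S ∨ v ∈ S) {k : ℕ}
    (hk : S.card ≤ k) : HasIntervals A X k := by
  classical
  -- Cover vertices occupy the whole line up to the greatest vertex; every other vertex occupies
  -- only the point that is its own number.
  refine ⟨fun v => if v ∈ S then 0 else v, fun v => if v ∈ S then X.sup id else v, ?_, ?_, ?_⟩
  · intro v _
    simp only
    split_ifs <;> omega
  · intro u hu v hv huv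
    have h1 : u ≤ X.sup id := Finset.le_sup (f := id) hu
    have h2 : v ≤ X.sup id := Finset.le_sup (f := id) hv
    have h3 : u ∈ S ∨ v ∈ S := hS u hu v hv huv
    simp only
    split_ifs <;> first | omega | tauto
  · intro i
    refine (Finset.card_le_card (t := insert i S) fun v hv => ?_).trans
      ((Finset.card_insert_le _ _).trans (by omega))
    simp only [Finset.mem_filter] at hv
    rw [Finset.mem_insert]
    by_cases h : v ∈ S
    · exact Or.inr h
    · simp only [h, if_false] at hv
      exact Or.inl (by omega)

/-- Vertices with many common neighbors share a bag. -/
theorem HasIntervals.add_edges {A B : ℕ → ℕ → Prop} {X : Finset ℕ} {k : ℕ}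
    (h : HasIntervals A X k)
    (hB : ∀ u ∈ X, ∀ v ∈ X, B u v → A u v ∨ ∃ Z ⊆ X, k < Z.card ∧ u ∉ Z ∧ v ∉ Z ∧
      ∀ z ∈ Z, A u z ∧ A v z) : HasIntervals B X k := by
  classical
  obtain ⟨l, r, h1, h2, h3⟩ := h
  have key : ∀ u ∈ X, ∀ v ∈ X, ∀ Z ⊆ X, k < Z.card → u ∉ Z → (∀ z ∈ Z, A u z ∧ A v z) →
      l u ≤ r v := by
    intro u hu v hv Z hZ hk huZ hz
    by_contra hlt
    -- If the interval of `v` ends before that of `u` begins, every common neighbor has to bridge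
    -- the gap and contains `l u`. Together with `u` itself, these are at least k + 2 intervals
    -- through one point.
    have h4 : insert u Z ⊆ X.filter fun w => l w ≤ l u ∧ l u ≤ r w := by
      intro w hw
      rcases Finset.mem_insert.1 hw with rfl | hw
      · exact Finset.mem_filter.2 ⟨hu, le_rfl, h1 _ hu⟩
      · have h5 := h2 u hu w (hZ hw) (hz w hw).1
        have h6 := h2 v hv w (hZ hw) (hz w hw).2
        exact Finset.mem_filter.2 ⟨hZ hw, by omega, by omega⟩
    have h5 := (Finset.card_le_card h4).trans (h3 (l u))
    rw [Finset.card_insert_of_notMem huZ] at h5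
    omega
  refine ⟨l, r, h1, fun u hu v hv huv => ?_, h3⟩
  rcases hB u hu v hv huv with h | ⟨Z, hZ, hk, huZ, hvZ, hz⟩
  · exact h2 u hu v hv h
  · exact ⟨key u hu v hv Z hZ hk huZ hz, key v hv u hu Z hZ hk hvZ fun z h => (hz z h).symm⟩

/-- A simplicial vertex can be added if every pair of its neighbors lies in the neighborhood of
another simplicial vertex. -/
theorem HasIntervals.insert_vertex {A : ℕ → ℕ → Prop} {X : Finset ℕ} {k v : ℕ}
    (h : HasIntervals A X k) (hv : v ∉ X) (hvv : ¬ A v v)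
    (hsymm : ∀ u ∈ insert v X, ∀ w ∈ insert v X, A u w → A w u)
    (hclique : ∀ x ∈ X, ∀ y ∈ X, A v x → A v y → x ≠ y → A x y)
    (hpair : ∀ x ∈ X, ∀ y ∈ X, A v x → A v y → ∃ w ∈ X, A w x ∧ A w y ∧ ¬ A v w ∧
      ∀ a ∈ X, ∀ b ∈ X, A w a → A w b → a ≠ b → A a b) :
    HasIntervals A (insert v X) k := by
  classical
  obtain ⟨l, r, h1, h2, h3⟩ := h
  let N := X.filter fun x => A v x
  have hNmem : ∀ x, x ∈ N ↔ x ∈ X ∧ A v x := fun x => Finset.mem_filter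
  rcases N.eq_empty_or_nonempty with hN | hN
  · have hno : ∀ x ∈ X, ¬ A v x := fun x hx hvx => by
      have := (hNmem x).2 ⟨hx, hvx⟩
      simp [hN] at this
    let t := X.sup r + 1
    -- Without neighbors, `v` gets a new point to the right of all intervals.
    refine ⟨fun u => if u = v then t else l u, fun u => if u = v then t else r u, ?_, ?_, ?_⟩
    · intro u hu
      simp only
      split_ifs with huv
      · exact le_rfl
      · exact h1 u (Finset.mem_of_mem_insert_of_ne hu huv)
    · intro u hu w hw huw
      have hu' : u ≠ v := by
        rintro rfl
        rcases Finset.mem_insert.1 hw with rfl | hw'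
        · exact hvv huw
        · exact hno w hw' huw
      have hw' : w ≠ v := by
        rintro rfl
        exact hno u (Finset.mem_of_mem_insert_of_ne hu hu') (hsymm _ hu _ hw huw)
      simp only [hu', hw', if_false]
      exact h2 u (Finset.mem_of_mem_insert_of_ne hu hu') w (Finset.mem_of_mem_insert_of_ne hw hw')
        huw
    · intro i
      by_cases hi : i = t
      · refine (Finset.card_le_card (t := {v}) fun u hu => ?_).trans (by simp)
        simp only [Finset.mem_filter] at hu
        rw [Finset.mem_singleton]
        by_contra huv
        simp only [huv, if_false] at hu
        have : r u ≤ X.sup r := Finset.le_sup (Finset.mem_of_mem_insert_of_ne hu.1 huv)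
        omega
      · refine (Finset.card_le_card fun u hu => ?_).trans (h3 i)
        simp only [Finset.mem_filter] at hu ⊢
        by_cases huv : u = v
        · simp only [huv, if_true] at hu
          omega
        · simp only [huv, if_false] at hu
          exact ⟨Finset.mem_of_mem_insert_of_ne hu.1 huv, hu.2⟩
  · obtain ⟨x, hx, hxmax⟩ := Finset.exists_max_image N l hN
    obtain ⟨y, hy, hymin⟩ := Finset.exists_min_image N r hN
    rw [hNmem] at hx hy
    obtain ⟨w, hw, hwx, hwy, hvw, hwc⟩ := hpair x hx.1 y hy.1 hx.2 hy.2
    let C := insert w (X.filter fun x => A w x)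
    have hCX : ∀ u ∈ C, u ∈ X := fun u hu => by
      rcases Finset.mem_insert.1 hu with rfl | hu
      · exact hw
      · exact (Finset.mem_filter.1 hu).1
    -- The closed neighborhood of `w` is a clique, so its intervals intersect pairwise, and the
    -- greatest left endpoint is a common point (Helly's theorem on the line).
    obtain ⟨c, hc, hcmax⟩ := Finset.exists_max_image C l ⟨w, Finset.mem_insert_self _ _⟩
    have hC : ∀ u ∈ C, l u ≤ l c ∧ l c ≤ r u := by
      intro u hu
      refine ⟨hcmax u hu, ?_⟩
      by_cases huc : c = u
      · subst huc; exact h1 c (hCX c hc)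
      rcases Finset.mem_insert.1 hu with rfl | hu'
      · rcases Finset.mem_insert.1 hc with rfl | hc'
        · exact absurd rfl huc
        · exact (h2 u hw c (hCX c hc) (Finset.mem_filter.1 hc').2).2
      · rcases Finset.mem_insert.1 hc with rfl | hc'
        · exact (h2 c hw u (hCX u hu) (Finset.mem_filter.1 hu').2).1
        · exact (h2 c (hCX c hc) u (hCX u hu) (hwc c (hCX c hc) u (hCX u hu)
            (Finset.mem_filter.1 hc').2 (Finset.mem_filter.1 hu').2 huc)).1
    set i := l c with hi
    have hwC := hC w (Finset.mem_insert_self _ _)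
    have hxC := hC x (Finset.mem_insert_of_mem (Finset.mem_filter.2 ⟨hx.1, hwx⟩))
    have hyC := hC y (Finset.mem_insert_of_mem (Finset.mem_filter.2 ⟨hy.1, hwy⟩))
    have hNi : ∀ u ∈ X, A v u → l u ≤ i ∧ i ≤ r u := fun u hu hvu => by
      have h4 := hxmax u ((hNmem u).2 ⟨hu, hvu⟩)
      have h5 := hymin u ((hNmem u).2 ⟨hu, hvu⟩)
      omega
    have hwi : ∀ u ∈ X, A w u → l u ≤ i ∧ i ≤ r u := fun u hu hwu =>
      hC u (Finset.mem_insert_of_mem (Finset.mem_filter.2 ⟨hu, hwu⟩))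
    have hwv : w ≠ v := fun h => hv (h ▸ hw)
    -- Every point j is doubled to 2j and 2j + 1. At the common point i, `w` shrinks to the first
    -- copy and `v` is placed on the second; this loses no edge, since all neighbors of either
    -- contain i.
    let l' : ℕ → ℕ := fun u => if u = v then 2 * i + 1 else if u = w then 2 * i else 2 * l u
    let r' : ℕ → ℕ := fun u => if u = v then 2 * i + 1 else if u = w then 2 * i else 2 * r u + 1
    have hlv : l' v = 2 * i + 1 := if_pos rfl
    have hrv : r' v = 2 * i + 1 := if_pos rfl
    have hlw : l' w = 2 * i := by simp only [l', hwv, if_false, if_true]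
    have hrw : r' w = 2 * i := by simp only [r', hwv, if_false, if_true]
    have hlu : ∀ u, u ≠ v → u ≠ w → l' u = 2 * l u := fun u h h' => by
      simp only [l', h, h', if_false]
    have hru : ∀ u, u ≠ v → u ≠ w → r' u = 2 * r u + 1 := fun u h h' => by
      simp only [r', h, h', if_false]
    have hadj : ∀ u ∈ insert v X, ∀ z ∈ insert v X, A u z → l' u ≤ r' z := by
      intro u hu z hz huz
      have hzu := hsymm u hu z hz huz
      by_cases huv : u = v
      · subst huv
        have hzv : z ≠ u := by rintro rfl; exact hvv huz
        have hzw : z ≠ w := by rintro rfl; exact hvw huz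
        have := hNi z (Finset.mem_of_mem_insert_of_ne hz hzv) huz
        rw [hlv, hru z hzv hzw]
        omega
      have huX := Finset.mem_of_mem_insert_of_ne hu huv
      by_cases hzv : z = v
      · subst hzv
        have huw : u ≠ w := by rintro rfl; exact hvw hzu
        have := hNi u huX hzu
        rw [hrv, hlu u huv huw]
        omega
      have hzX := Finset.mem_of_mem_insert_of_ne hz hzv
      by_cases huw : u = w
      · subst huw
        by_cases hzw : z = u
        · rw [hzw, hlw, hrw]
        · have := hwi z hzX huz
          rw [hlw, hru z hzv hzw]
          omega
      · by_cases hzw : z = w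
        · subst hzw
          have := hwi u huX hzu
          rw [hrw, hlu u huv huw]
          omega
        · have := (h2 u huX z hzX huz).1
          rw [hlu u huv huw, hru z hzv hzw]
          omega
    refine ⟨l', r', ?_, fun u hu z hz huz => ⟨hadj u hu z hz huz,
      hadj z hz u hu (hsymm u hu z hz huz)⟩, fun j => ?_⟩
    · intro u hu
      by_cases huv : u = v
      · rw [huv, hlv, hrv]
      · by_cases huw : u = w
        · rw [huw, hlw, hrw]
        · have := h1 u (Finset.mem_of_mem_insert_of_ne hu huv)
          rw [hlu u huv huw, hru u huv huw]
          omega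
    · have hwmem : w ∈ X.filter fun u => l u ≤ i ∧ i ≤ r u := Finset.mem_filter.2 ⟨hw, hwC⟩
      by_cases hj : j = 2 * i + 1
      -- At the second copy of i, `v` takes the place of `w`, so the number of intervals does not
      -- exceed that at i before.
      · refine (Finset.card_le_card
          (t := insert v ((X.filter fun u => l u ≤ i ∧ i ≤ r u).erase w)) fun u hu => ?_).trans ?_
        · simp only [Finset.mem_filter] at hu
          by_cases huv : u = v
          · exact Finset.mem_insert.2 (Or.inl huv)
          · refine Finset.mem_insert_of_mem (Finset.mem_erase.2 ?_)
            have huw : u ≠ w := by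
              rintro rfl
              rw [hrw] at hu
              omega
            rw [hlu u huv huw, hru u huv huw] at hu
            exact ⟨huw, Finset.mem_filter.2 ⟨Finset.mem_of_mem_insert_of_ne hu.1 huv,
              by omega, by omega⟩⟩
        · refine (Finset.card_insert_le _ _).trans ?_
          rw [Finset.card_erase_add_one hwmem]
          exact h3 i
      · refine (Finset.card_le_card fun u hu => ?_).trans (h3 (j / 2))
        simp only [Finset.mem_filter] at hu ⊢
        by_cases huv : u = v
        · rw [huv, hlv, hrv] at hu
          omega
        · refine ⟨Finset.mem_of_mem_insert_of_ne hu.1 huv, ?_⟩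
          by_cases huw : u = w
          · rw [huw, hlw, hrw] at hu
            have : j / 2 = i := by omega
            rw [this, huw]
            exact hwC
          · rw [hlu u huv huw, hru u huv huw] at hu
            omega

/-! ### The reduced graph -/

/-- A graph on the vertices `0, …, order - 1` together with a set of vertices. -/
structure CoverGraph where
  order : ℕ
  Adj : ℕ → ℕ → Prop
  Cov : ℕ → Prop

namespace CoverGraph

variable (G : CoverGraph)

/-- The adjacency relation is symmetric and irreflexive, and the set is a vertex cover. -/
structure Good : Prop where
  symm : ∀ u < G.order, ∀ v < G.order, G.Adj u v → G.Adj v u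
  irrefl : ∀ u < G.order, ¬ G.Adj u u
  cover : ∀ u < G.order, ∀ v < G.order, G.Adj u v → G.Cov u ∨ G.Cov v

open Classical in
/-- The number of vertices of the cover. -/
noncomputable def covCard : ℕ := ((Finset.range G.order).filter G.Cov).card

open Classical in
/-- The common neighbors of two vertices outside of the cover. -/
noncomputable def common (u v : ℕ) : Finset ℕ :=
  (Finset.range G.order).filter fun z => ¬ G.Cov z ∧ G.Adj u z ∧ G.Adj v z

/-- Adjacency in the graph in which vertices of the cover with many common neighbors are joined. -/
def Adj' (u v : ℕ) : Prop :=
  G.Adj u v ∨ (u ≠ v ∧ G.Cov u ∧ G.Cov v ∧ G.covCard < (G.common u v).card)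

/-- A vertex outside of the cover whose neighborhood is a clique. -/
def Simp (v : ℕ) : Prop :=
  ¬ G.Cov v ∧ ∀ x < G.order, ∀ y < G.order, G.Adj v x → G.Adj v y → x ≠ y → G.Adj' x y

/-- `w` is the least simplicial vertex adjacent to both `x` and `y`. -/
def LeastFor (w x y : ℕ) : Prop :=
  G.Simp w ∧ G.Adj w x ∧ G.Adj w y ∧ ∀ w' < w, ¬ (G.Simp w' ∧ G.Adj w' x ∧ G.Adj w' y)

/-- The vertices of the reduced graph. -/
def Keep (v : ℕ) : Prop :=
  v < G.order ∧
    (G.Cov v ∨ ¬ G.Simp v ∨ ∃ x < G.order, ∃ y < G.order, G.LeastFor v x y)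

open Classical in
/-- The set of vertices of the reduced graph. -/
noncomputable def kept : Finset ℕ := (Finset.range G.order).filter G.Keep

/-! ### Correctness and size of the reduced graph -/

variable {G}

theorem mem_kept {v : ℕ} : v ∈ G.kept ↔ G.Keep v := by
  classical
  rw [kept, Finset.mem_filter, Finset.mem_range]
  exact ⟨fun h => h.2, fun h => ⟨h.1, h⟩⟩

theorem Good.adj'_symm (hG : G.Good) {u v : ℕ} (hu : u < G.order) (hv : v < G.order)
    (h : G.Adj' u v) : G.Adj' v u := by
  rcases h with h | ⟨h1, h2, h3, h4⟩
  · exact Or.inl (hG.symm u hu v hv h)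
  · refine Or.inr ⟨h1.symm, h3, h2, ?_⟩
    have : G.common v u = G.common u v := by
      unfold common
      congr 1
      funext z
      rw [and_comm (a := G.Adj v z)]
    rwa [this]

theorem Good.not_adj' (hG : G.Good) {u : ℕ} (hu : u < G.order) : ¬ G.Adj' u u := by
  rintro (h | ⟨h, -⟩)
  · exact hG.irrefl u hu h
  · exact h rfl

/-- The first rule adds edges inside the cover only, so neighborhoods of the other vertices stay the
same. -/
theorem adj'_iff_of_not_cov {u v : ℕ} (h : ¬ G.Cov u ∨ ¬ G.Cov v) : G.Adj' u v ↔ G.Adj u v := by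
  unfold Adj'
  tauto

theorem Good.adj'_cover (hG : G.Good) {u v : ℕ} (hu : u < G.order) (hv : v < G.order)
    (h : G.Adj' u v) : G.Cov u ∨ G.Cov v := by
  rcases h with h | h
  · exact hG.cover u hu v hv h
  · exact Or.inl h.2.1

/-- The reduced graph has path width at most `k` if and only if the graph has. -/
theorem Good.hasIntervals_iff (hG : G.Good) (k : ℕ) :
    HasIntervals G.Adj (Finset.range G.order) k ↔ HasIntervals G.Adj' G.kept k := by
  classical
  have hsub : G.kept ⊆ Finset.range G.order := Finset.filter_subset _ _
  rcases le_or_gt G.covCard k with hk | hk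
  · have hcov : ∀ u, u < G.order → G.Cov u → u ∈ (Finset.range G.order).filter G.Cov :=
      fun u hu h => Finset.mem_filter.2 ⟨Finset.mem_range.2 hu, h⟩
    -- For k ≥ s, both graphs are represented by the cover and one further vertex per bag.
    -- Afterwards k < s, so more than s common neighbors are more than k.
    refine iff_of_true (hasIntervals_of_cover (S := (Finset.range G.order).filter G.Cov) ?_ hk)
      (hasIntervals_of_cover (S := (Finset.range G.order).filter G.Cov) ?_ hk)
    · intro u hu v hv h
      rw [Finset.mem_range] at hu hv
      exact (hG.cover u hu v hv h).imp (hcov u hu) (hcov v hv)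
    · intro u hu v hv h
      replace hu := Finset.mem_range.1 (hsub hu)
      replace hv := Finset.mem_range.1 (hsub hv)
      exact (hG.adj'_cover hu hv h).imp (hcov u hu) (hcov v hv)
  constructor
  · intro h
    refine (h.add_edges (B := G.Adj') fun u _ v _ huv => ?_).mono hsub fun _ _ _ _ h => h
    rcases huv with h | ⟨h1, h2, h3, h4⟩
    · exact Or.inl h
    · refine Or.inr ⟨G.common u v, Finset.filter_subset _ _, hk.trans h4, ?_, ?_, ?_⟩
      · intro h; exact (Finset.mem_filter.1 h).2.1 h2
      · intro h; exact (Finset.mem_filter.1 h).2.1 h3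
      · intro z h; exact (Finset.mem_filter.1 h).2.2
  · intro h
    -- The deleted vertices are put back one at a time, in any order, with the added edges still
    -- present.
    have key : ∀ Y ⊆ Finset.range G.order \ G.kept, HasIntervals G.Adj' (Y ∪ G.kept) k := by
      intro Y
      induction Y using Finset.induction_on with
      | empty => intro _; simpa using h
      | insert v Y hvY ih =>
        intro hY
        have hvr := hY (Finset.mem_insert_self v Y)
        rw [Finset.mem_sdiff, Finset.mem_range] at hvr
        have hlt : ∀ u ∈ insert v (Y ∪ G.kept), u < G.order := by
          intro u hu
          rw [Finset.mem_insert, Finset.mem_union] at hu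
          rcases hu with rfl | hu | hu
          · exact hvr.1
          · exact Finset.mem_range.1 (Finset.mem_sdiff.1 (hY (Finset.mem_insert_of_mem hu))).1
          · exact Finset.mem_range.1 (hsub hu)
        have hlt' : ∀ u ∈ Y ∪ G.kept, u < G.order := fun u hu =>
          hlt u (Finset.mem_insert_of_mem hu)
        have hnk : ¬ G.Keep v := fun h => hvr.2 (mem_kept.2 h)
        have hsv : G.Simp v := by
          by_contra h
          exact hnk ⟨hvr.1, Or.inr (Or.inl h)⟩
        rw [Finset.insert_union]
        refine (ih fun u hu => hY (Finset.mem_insert_of_mem hu)).insert_vertex ?_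
          (hG.not_adj' hvr.1) (fun u hu w hw => hG.adj'_symm (hlt u hu) (hlt w hw)) ?_ ?_
        · rw [Finset.mem_union]
          exact fun h => h.elim hvY hvr.2
        · intro x hx y hy hvx hvy hxy
          rw [adj'_iff_of_not_cov (Or.inl hsv.1)] at hvx hvy
          exact hsv.2 x (hlt' x hx) y (hlt' y hy) hvx hvy hxy
        · intro x hx y hy hvx hvy
          rw [adj'_iff_of_not_cov (Or.inl hsv.1)] at hvx hvy
          -- The vertex `v` itself is a candidate, so the least simplicial vertex for the pair
          -- exists and is at most `v`. It was kept, hence it is available.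
          have hex : ∃ w, G.Simp w ∧ G.Adj w x ∧ G.Adj w y := ⟨v, hsv, hvx, hvy⟩
          obtain ⟨hw1, hw2, hw3⟩ := Nat.find_spec hex
          have hwv : Nat.find hex ≤ v := Nat.find_min' hex ⟨hsv, hvx, hvy⟩
          have hwlt : Nat.find hex < G.order := hwv.trans_lt hvr.1
          refine ⟨Nat.find hex, Finset.mem_union_right _ (mem_kept.2 ⟨hwlt, Or.inr (Or.inr
            ⟨x, hlt' x hx, y, hlt' y hy, hw1, hw2, hw3, fun w' hw' => Nat.find_min hex hw'⟩)⟩),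
            Or.inl hw2, Or.inl hw3, ?_, ?_⟩
          · rw [adj'_iff_of_not_cov (Or.inl hsv.1)]
            intro h
            exact (hG.cover v hvr.1 _ hwlt h).elim hsv.1 hw1.1
          · intro a ha b hb hwa hwb hab
            rw [adj'_iff_of_not_cov (Or.inl hw1.1)] at hwa hwb
            exact hw1.2 a (hlt' a ha) b (hlt' b hb) hwa hwb hab
    have h2 := key _ subset_rfl
    rw [Finset.sdiff_union_of_subset hsub] at h2
    exact h2.mono subset_rfl fun u _ v _ h => Or.inl h

/-- The reduced graph has `O(s³)` vertices, where `s` is the number of vertices of the cover. -/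
theorem Good.card_kept_le (hG : G.Good) : G.kept.card ≤ 3 * G.covCard ^ 3 := by
  classical
  set C := (Finset.range G.order).filter G.Cov with hC
  have hCcard : C.card = G.covCard := rfl
  -- Every surviving vertex outside of the cover is charged to a pair of its neighbors: a
  -- non-simplicial one to a pair that is still non-adjacent and so has at most s common neighbors,
  -- a simplicial one to a pair for which it is the least. A pair is charged at most s + 1 times.
  let T : ℕ × ℕ → Finset ℕ := fun p =>
    (if (G.common p.1 p.2).card ≤ G.covCard then G.common p.1 p.2 else ∅) ∪
      (Finset.range G.order).filter fun w => G.LeastFor w p.1 p.2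
  have hT : ∀ p ∈ C ×ˢ C, (T p).card ≤ G.covCard + 1 := by
    intro p _
    refine (Finset.card_union_le _ _).trans (Nat.add_le_add ?_ ?_)
    · split_ifs with h
      · exact h
      · simp
    · rw [Finset.card_le_one]
      intro a ha b hb
      obtain ⟨-, ha1, ha2, ha3, ha4⟩ := Finset.mem_filter.1 ha
      obtain ⟨-, hb1, hb2, hb3, hb4⟩ := Finset.mem_filter.1 hb
      rcases lt_trichotomy a b with h | h | h
      · exact absurd ⟨ha1, ha2, ha3⟩ (hb4 a h)
      · exact h
      · exact absurd ⟨hb1, hb2, hb3⟩ (ha4 b h)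
  have hsub : G.kept ⊆ C ∪ (C ×ˢ C).biUnion T := by
    intro v hv
    obtain ⟨hvn, hv⟩ := mem_kept.1 hv
    rw [Finset.mem_union]
    by_cases hcov : G.Cov v
    · exact Or.inl (Finset.mem_filter.2 ⟨Finset.mem_range.2 hvn, hcov⟩)
    · have hnb : ∀ x < G.order, G.Adj v x → x ∈ C := fun x hx h =>
        Finset.mem_filter.2 ⟨Finset.mem_range.2 hx, (hG.cover v hvn x hx h).resolve_left hcov⟩
      refine Or.inr (Finset.mem_biUnion.2 ?_)
      rcases hv with hv | hv | ⟨x, hx, y, hy, hv⟩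
      · exact absurd hv hcov
      · simp only [Simp, not_and, not_forall] at hv
        obtain ⟨x, hx, y, hy, hvx, hvy, hxy, hadj⟩ := hv hcov
        have hle : (G.common x y).card ≤ G.covCard := by
          by_contra hlt
          exact hadj (Or.inr ⟨hxy, (Finset.mem_filter.1 (hnb x hx hvx)).2,
            (Finset.mem_filter.1 (hnb y hy hvy)).2, not_le.1 hlt⟩)
        refine ⟨(x, y), Finset.mem_product.2 ⟨hnb x hx hvx, hnb y hy hvy⟩,
          Finset.mem_union_left _ ?_⟩
        rw [if_pos hle]
        exact Finset.mem_filter.2 ⟨Finset.mem_range.2 hvn, hcov, hG.symm v hvn x hx hvx,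
          hG.symm v hvn y hy hvy⟩
      · exact ⟨(x, y), Finset.mem_product.2 ⟨hnb x hx hv.2.1, hnb y hy hv.2.2.1⟩,
          Finset.mem_union_right _ (Finset.mem_filter.2 ⟨Finset.mem_range.2 hvn, hv⟩)⟩
  have h1 := (Finset.card_le_card hsub).trans ((Finset.card_union_le _ _).trans
    (Nat.add_le_add_left (Finset.card_biUnion_le_card_mul _ _ _ hT) _))
  rw [Finset.card_product, hCcard] at h1
  refine h1.trans ?_
  rcases Nat.eq_zero_or_pos G.covCard with h0 | h0
  · simp [h0]
  · have h2 : G.covCard ^ 1 ≤ G.covCard ^ 3 := Nat.pow_le_pow_right h0 (by norm_num)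
    have h3 : G.covCard ^ 2 ≤ G.covCard ^ 3 := Nat.pow_le_pow_right h0 (by norm_num)
    calc _ = G.covCard ^ 1 + G.covCard ^ 2 + G.covCard ^ 3 := by ring
      _ ≤ _ := by omega

end CoverGraph

/-! ### Words and instances -/

/-- The condition excludes superfluous zeros at the most significant end; without it, `Nat.bits`
would return a shorter list. -/
theorem bits_bval {s : List Bool} (h : ∀ h : s ≠ [], s.getLast h = true) : (bval s).bits = s := by
  induction s with
  | nil => simp [bval]
  | cons b s ih =>
    have h1 : bval (b :: s) = Nat.bit b (bval s) := rfl
    have h2 : (bval s).bits = s := by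
      refine ih fun hs => ?_
      have := h (by simp)
      rwa [List.getLast_cons hs] at this
    rw [h1, Nat.bits_append_bit _ _ fun h0 => ?_, h2]
    have h3 : s = [] := by rw [← h2, h0]; rfl
    subst h3
    simpa using h (by simp)

theorem getLast_bits (n : ℕ) (h : n.bits ≠ []) : n.bits.getLast h = true := by
  induction n using Nat.binaryRec' with
  | zero => simp at h
  | bit b m hb ih =>
    simp only [Nat.bits_append_bit m b hb] at h ⊢
    by_cases hm : m.bits = []
    · have h0 : m = 0 := by rw [← bval_bits m, hm]; rfl
      simp [hm, hb h0]
    · rw [List.getLast_cons hm]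
      exact ih hm

/-- The position in an encoding of the binary representation of `k`. -/
def tailPos (n : ℕ) : ℕ := n + 1 + n * n + n

theorem tailPos_mono {m n : ℕ} (h : m ≤ n) : tailPos m ≤ tailPos n := by
  have := Nat.mul_le_mul h h
  unfold tailPos; omega

theorem mul_add_lt_mul {n u v : ℕ} (hu : u < n) (hv : v < n) : u * n + v < n * n := by
  have := Nat.mul_le_mul_right n (show u + 1 ≤ n from hu)
  rw [add_mul] at this
  omega

/-- These are the zones of an encoding: order in unary, separator, matrix, characteristic vector,
and binary digits of k. -/
theorem pos_cases (n j : ℕ) : j < n ∨ j = n ∨ (∃ u < n, ∃ v < n, j = n + 1 + (u * n + v)) ∨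
    (∃ v < n, j = n + 1 + n * n + v) ∨ ∃ i, j = tailPos n + i := by
  rcases lt_trichotomy j n with h | h | h
  · exact Or.inl h
  · exact Or.inr (Or.inl h)
  · refine Or.inr (Or.inr ?_)
    rcases lt_or_ge j (n + 1 + n * n) with h1 | h1
    · have hn : 0 < n := Nat.pos_of_ne_zero fun h0 => by subst h0; omega
      refine Or.inl ⟨(j - (n + 1)) / n, ?_, (j - (n + 1)) % n, Nat.mod_lt _ hn, ?_⟩
      · rw [Nat.div_lt_iff_lt_mul hn]; omega
      · have := Nat.div_add_mod (j - (n + 1)) n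
        rw [mul_comm n] at this
        omega
    · rcases lt_or_ge j (tailPos n) with h2 | h2
      · exact Or.inr (Or.inl ⟨j - (n + 1 + n * n), by unfold tailPos at h2; omega, by omega⟩)
      · exact Or.inr (Or.inr ⟨j - tailPos n, by omega⟩)

namespace PWInstance

variable (I : PWInstance)

theorem length_encode : I.encode.length = tailPos I.order + I.k.bits.length := by
  simp only [encode, tailPos, List.length_append, List.length_replicate, List.length_cons,
    List.length_ofFn]
  omega

theorem encode_lt {j : ℕ} (h : j < I.order) : I.encode[j]? = some true := by
  rw [encode, List.getElem?_append_left (by simpa using h)]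
  simp [h]

theorem encode_order : I.encode[I.order]? = some false := by
  rw [encode, List.getElem?_append_right (by simp)]
  simp

open Classical in
theorem encode_after (j : ℕ) : I.encode[I.order + 1 + j]? =
    (List.ofFn (fun p : Fin (I.order * I.order) =>
      decide (I.graph.Adj p.divNat p.modNat)) ++
      (List.ofFn (fun v : Fin I.order => decide (v ∈ I.S)) ++
        I.k.bits))[j]? := by
  rw [encode, List.getElem?_append_right (by simp; omega), List.length_replicate,
    show I.order + 1 + j - I.order = j + 1 by omega, List.getElem?_cons_succ]

theorem encode_adj (u v : Fin I.order) :
    I.encode[I.order + 1 + ((u : ℕ) * I.order + v)]? = some true ↔ I.graph.Adj u v := by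
  have h := mul_add_lt_mul u.2 v.2
  have h0 : 0 < I.order := u.pos
  have e1 : (⟨(u : ℕ) * I.order + v, h⟩ : Fin (I.order * I.order)).divNat = u := by
    apply Fin.ext
    simp only [Fin.coe_divNat]
    rw [mul_comm, Nat.mul_add_div h0, Nat.div_eq_of_lt v.2, add_zero]
  have e2 : (⟨(u : ℕ) * I.order + v, h⟩ : Fin (I.order * I.order)).modNat = v := by
    apply Fin.ext
    simp only [Fin.coe_modNat]
    rw [mul_comm, Nat.mul_add_mod, Nat.mod_eq_of_lt v.2]
  rw [encode_after, List.getElem?_append_left (by simpa using h), List.getElem?_ofFn, dif_pos h,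
    e1, e2]
  simp

theorem encode_cov (v : Fin I.order) :
    I.encode[I.order + 1 + I.order * I.order + v]? = some true ↔ v ∈ I.S := by
  rw [add_assoc (I.order + 1), encode_after, List.getElem?_append_right (by simp),
    List.length_ofFn, Nat.add_sub_cancel_left, List.getElem?_append_left (by simp),
    List.getElem?_ofFn, dif_pos v.2]
  simp

theorem encode_tail (i : ℕ) : I.encode[tailPos I.order + i]? = I.k.bits[i]? := by
  rw [tailPos, add_assoc (I.order + 1), add_assoc (I.order + 1), encode_after,
    List.getElem?_append_right (by simp; omega), List.length_ofFn,
    List.getElem?_append_right (by simp; omega), List.length_ofFn]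
  congr 1
  omega

theorem encode_true_iff (j : ℕ) : I.encode[j]? = some true ↔ j < I.order ∨
    (∃ u v : Fin I.order, j = I.order + 1 + ((u : ℕ) * I.order + v) ∧ I.graph.Adj u v) ∨
    (∃ v : Fin I.order, j = I.order + 1 + I.order * I.order + v ∧ v ∈ I.S) ∨
    ∃ i, j = tailPos I.order + i ∧ I.k.bits[i]? = some true := by
  constructor
  · intro h
    rcases pos_cases I.order j with hj | rfl | ⟨u, hu, v, hv, rfl⟩ | ⟨v, hv, rfl⟩ | ⟨i, rfl⟩
    · exact Or.inl hj
    · rw [encode_order] at h; simp at h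
    · exact Or.inr (Or.inl ⟨⟨u, hu⟩, ⟨v, hv⟩, rfl, (I.encode_adj ⟨u, hu⟩ ⟨v, hv⟩).1 h⟩)
    · exact Or.inr (Or.inr (Or.inl ⟨⟨v, hv⟩, rfl, (I.encode_cov ⟨v, hv⟩).1 h⟩))
    · exact Or.inr (Or.inr (Or.inr ⟨i, rfl, by rwa [encode_tail] at h⟩))
  · rintro (h | ⟨u, v, rfl, h⟩ | ⟨v, rfl, h⟩ | ⟨i, rfl, h⟩)
    · exact I.encode_lt h
    · exact (I.encode_adj u v).2 h
    · exact (I.encode_cov v).2 h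
    · rwa [encode_tail]

end PWInstance

/-! ### Decoding of words -/

theorem bool_list_ext {x y : List Bool} (h : x.length = y.length)
    (h' : ∀ i : ℕ, x[i]? = some true ↔ y[i]? = some true) : x = y := by
  refine List.ext_getElem h fun i h1 h2 => ?_
  have := h' i
  rw [List.getElem?_eq_getElem h1, List.getElem?_eq_getElem h2] at this
  simp only [Option.some.injEq] at this
  exact Bool.eq_iff_iff.2 this

/-- The number of leading ones. -/
def leadingOnes (x : List Bool) : ℕ := (x.takeWhile id).length

theorem le_leadingOnes_iff (x : List Bool) (c : ℕ) :
    c ≤ leadingOnes x ↔ ∀ i < c, x[i]? = some true := by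
  induction x generalizing c with
  | nil =>
    simp only [leadingOnes, List.takeWhile_nil, List.length_nil]
    constructor
    · intro h i hi; omega
    · intro h
      by_contra hc
      simpa using h 0 (by omega)
  | cons b x ih =>
    cases c with
    | zero => simp
    | succ c =>
      cases b with
      | false =>
        simp only [leadingOnes, List.takeWhile_cons, id]
        constructor
        · intro h; simp at h
        · intro h; simpa using h 0 (by omega)
      | true =>
        have : leadingOnes (true :: x) = leadingOnes x + 1 := by simp [leadingOnes]
        rw [this, Nat.add_le_add_iff_right, ih]
        constructor
        · intro h i hi
          cases i with
          | zero => rfl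
          | succ i => exact h i (by omega)
        · intro h i hi
          exact h (i + 1) (by omega)

theorem leadingOnes_le (x : List Bool) : leadingOnes x ≤ x.length :=
  (List.takeWhile_prefix _).length_le

theorem getElem?_leadingOnes (x : List Bool) : x[leadingOnes x]? ≠ some true := by
  intro h
  have h1 : leadingOnes x + 1 ≤ leadingOnes x := by
    rw [le_leadingOnes_iff]
    intro i hi
    rcases Nat.lt_succ_iff_lt_or_eq.1 hi with h' | rfl
    · exact (le_leadingOnes_iff x _).1 le_rfl i h'
    · exact h
  omega

/-- The graph and the set of vertices encoded in a word. -/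
def wordGraph (x : List Bool) : CoverGraph where
  order := leadingOnes x
  Adj u v := x[leadingOnes x + 1 + (u * leadingOnes x + v)]? = some true
  Cov v := x[leadingOnes x + 1 + leadingOnes x * leadingOnes x + v]? = some true

/-- The word encodes an instance in which the set is a vertex cover. -/
structure WellFormed (x : List Bool) : Prop where
  le : tailPos (leadingOnes x) ≤ x.length
  good : (wordGraph x).Good
  last : x.length = tailPos (leadingOnes x) ∨ x[x.length - 1]? = some true

/-- The number `k` encoded in a word. -/
def wordK (x : List Bool) : ℕ := bval (x.drop (tailPos (leadingOnes x)))

theorem bits_wordK {x : List Bool} (hx : WellFormed x) :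
    (wordK x).bits = x.drop (tailPos (leadingOnes x)) := by
  refine bits_bval fun h => ?_
  have hlt : tailPos (leadingOnes x) < x.length := by
    by_contra hlt
    exact h (List.drop_eq_nil_of_le (by omega))
  have h1 := hx.last.resolve_left (by omega)
  rw [List.getLast_drop, List.getLast_eq_getElem]
  rw [List.getElem?_eq_getElem (by omega)] at h1
  simpa using h1

/-- The instance on the vertices `0, …, n - 1` with the given relation as adjacency. -/
noncomputable def mkInstance (n : ℕ) (R : ℕ → ℕ → Prop) (M : ℕ → Prop) (k : ℕ) : PWInstance where
  order := n
  graph := SimpleGraph.fromRel fun u v => R u v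
  k := k
  S := @Finset.filter _ (fun v : Fin n => M v) (Classical.decPred _) Finset.univ

/-- `SimpleGraph.fromRel` symmetrizes the relation and removes loops, which changes nothing for a
symmetric irreflexive relation. -/
theorem mkInstance_adj {n : ℕ} {R : ℕ → ℕ → Prop} (hs : ∀ u < n, ∀ v < n, R u v → R v u)
    (hi : ∀ u < n, ¬ R u u) (M : ℕ → Prop) (k : ℕ) (u v : Fin n) :
    (mkInstance n R M k).graph.Adj u v ↔ R u v := by
  change (SimpleGraph.fromRel fun u v : Fin n => R u v).Adj u v ↔ _
  rw [SimpleGraph.fromRel_adj]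
  constructor
  · rintro ⟨-, h | h⟩
    · exact h
    · exact hs v v.2 u u.2 h
  · intro h
    exact ⟨fun huv => hi u u.2 (by rwa [huv] at h ⊢), Or.inl h⟩

theorem mkInstance_mem (n : ℕ) (R : ℕ → ℕ → Prop) (M : ℕ → Prop) (k : ℕ) (v : Fin n) :
    v ∈ (mkInstance n R M k).S ↔ M v := by
  classical
  change v ∈ Finset.filter _ _ ↔ _
  simp

theorem mkInstance_isYes {n : ℕ} {R : ℕ → ℕ → Prop} (hs : ∀ u < n, ∀ v < n, R u v → R v u)
    (hi : ∀ u < n, ¬ R u u) {M : ℕ → Prop} (hc : ∀ u < n, ∀ v < n, R u v → M u ∨ M v) (k : ℕ) :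
    (mkInstance n R M k).IsYes ↔ HasIntervals R (Finset.range n) k := by
  have h1 : (mkInstance n R M k).graph.IsVertexCover ((mkInstance n R M k).S : Set (Fin (mkInstance n R M k).order)) := by
    intro u v huv
    have h2 := hc u u.2 v v.2 ((mkInstance_adj hs hi M k u v).1 huv)
    exact h2.imp (fun h => (mkInstance_mem n R M k u).2 h) fun h => (mkInstance_mem n R M k v).2 h
  rw [PWInstance.IsYes, and_iff_right h1]
  exact pathWidth_le_iff (mkInstance_adj hs hi M k)

theorem mkInstance_card (n : ℕ) (R : ℕ → ℕ → Prop) (M : ℕ → Prop) (k : ℕ) [DecidablePred M] :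
    (mkInstance n R M k).S.card = ((Finset.range n).filter M).card := by
  rw [← Finset.card_map Fin.valEmbedding]
  congr 1
  ext v
  simp only [Finset.mem_map, Finset.mem_filter, Finset.mem_range, Fin.valEmbedding_apply]
  constructor
  · rintro ⟨w, hw, rfl⟩
    exact ⟨w.2, (mkInstance_mem n R M k w).1 hw⟩
  · rintro ⟨hv, hM⟩
    exact ⟨⟨v, hv⟩, (mkInstance_mem n R M k ⟨v, hv⟩).2 hM, rfl⟩

/-- The instance encoded in a word. -/
noncomputable def wordInstance (x : List Bool) : PWInstance :=
  mkInstance (leadingOnes x) (wordGraph x).Adj (wordGraph x).Cov (wordK x)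

/-- Agreement is checked zone by zone. Together with `wellFormed_encode`, this identifies the
well-formed words with the encodings of triples whose set is a vertex cover. -/
theorem encode_wordInstance {x : List Bool} (hx : WellFormed x) : (wordInstance x).encode = x := by
  have hbits := bits_wordK hx
  have ho : (wordInstance x).order = leadingOnes x := rfl
  have hk : (wordInstance x).k = wordK x := rfl
  refine bool_list_ext ?_ fun j => ?_
  · rw [PWInstance.length_encode, ho, hk, hbits, List.length_drop]
    have := hx.le
    omega
  · rcases pos_cases (leadingOnes x) j with hj | rfl | ⟨u, hu, v, hv, rfl⟩ | ⟨v, hv, rfl⟩ |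
      ⟨i, rfl⟩
    · rw [PWInstance.encode_lt _ hj]
      exact iff_of_true rfl ((le_leadingOnes_iff x _).1 le_rfl j hj)
    · rw [← ho, PWInstance.encode_order]
      exact iff_of_false (by simp) (getElem?_leadingOnes x)
    · exact ((wordInstance x).encode_adj ⟨u, hu⟩ ⟨v, hv⟩).trans
        (mkInstance_adj hx.good.symm hx.good.irrefl _ _ ⟨u, hu⟩ ⟨v, hv⟩)
    · exact ((wordInstance x).encode_cov ⟨v, hv⟩).trans (mkInstance_mem _ _ _ _ ⟨v, hv⟩)
    · rw [← ho, PWInstance.encode_tail, hk, hbits, List.getElem?_drop, ho]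

theorem leadingOnes_encode (I : PWInstance) : leadingOnes I.encode = I.order := by
  refine le_antisymm ?_ ?_
  · by_contra h
    have := (le_leadingOnes_iff I.encode _).1 le_rfl I.order (by omega)
    rw [I.encode_order] at this
    simp at this
  · rw [le_leadingOnes_iff]
    exact fun i hi => I.encode_lt hi

theorem wellFormed_encode {I : PWInstance}
    (hI : I.graph.IsVertexCover (I.S : Set (Fin I.order))) : WellFormed I.encode := by
  have hadj : ∀ u v : Fin I.order, (wordGraph I.encode).Adj u v ↔ I.graph.Adj u v := by
    intro u v
    simp only [wordGraph, leadingOnes_encode]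
    exact I.encode_adj u v
  have hcov : ∀ v : Fin I.order, (wordGraph I.encode).Cov v ↔ v ∈ I.S := by
    intro v
    simp only [wordGraph, leadingOnes_encode]
    exact I.encode_cov v
  have ho : (wordGraph I.encode).order = I.order := leadingOnes_encode I
  refine ⟨?_, ⟨?_, ?_, ?_⟩, ?_⟩
  · rw [I.length_encode, leadingOnes_encode]; omega
  · intro u hu v hv h
    rw [ho] at hu hv
    exact (hadj ⟨v, hv⟩ ⟨u, hu⟩).2 ((hadj ⟨u, hu⟩ ⟨v, hv⟩).1 h).symm
  · intro u hu h
    rw [ho] at hu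
    exact I.graph.loopless.irrefl _ ((hadj ⟨u, hu⟩ ⟨u, hu⟩).1 h)
  · intro u hu v hv h
    rw [ho] at hu hv
    have := hI ((hadj ⟨u, hu⟩ ⟨v, hv⟩).1 h)
    exact this.imp (fun h => (hcov ⟨u, hu⟩).2 h) fun h => (hcov ⟨v, hv⟩).2 h
  · rw [leadingOnes_encode, I.length_encode]
    rcases Nat.eq_zero_or_pos I.k.bits.length with h | h
    · exact Or.inl (by omega)
    · refine Or.inr ?_
      rw [Nat.add_sub_assoc h, I.encode_tail, List.getElem?_eq_getElem (by omega),
        ← List.getLast_eq_getElem (List.length_pos_iff.1 h), getLast_bits]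

/-! ### The kernelization -/

namespace CoverGraph

variable (G : CoverGraph)

theorem finite_keep : (Set.ofPred G.Keep).Finite :=
  (Set.finite_Iio G.order).subset fun _ hv => hv.1

theorem toFinset_keep : G.finite_keep.toFinset = G.kept := by
  ext v
  rw [Set.Finite.mem_toFinset, mem_kept]
  rfl

theorem nth_keep {u : ℕ} (hu : u < G.kept.card) : G.Keep (Nat.nth G.Keep u) :=
  Nat.nth_mem_of_lt_card G.finite_keep (by rwa [toFinset_keep])

theorem nth_injOn : Set.InjOn (Nat.nth G.Keep) (Finset.range G.kept.card) := by
  have h := Nat.nth_injOn G.finite_keep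
  rw [toFinset_keep] at h
  exact h.mono fun x hx => Finset.mem_range.1 hx

theorem image_nth : (Finset.range G.kept.card).image (Nat.nth G.Keep) = G.kept := by
  have h := Nat.image_nth_Iio_card G.finite_keep
  rw [toFinset_keep] at h
  apply Finset.coe_injective
  rw [Finset.coe_image, Finset.coe_range, h]
  ext v
  exact mem_kept.symm

theorem card_kept_le_order : G.kept.card ≤ G.order := by
  classical
  exact (Finset.card_filter_le _ _).trans_eq (Finset.card_range _)

/-- The `u`-th vertex of the reduced graph is the vertex before which there are `u` vertices of the
reduced graph. -/
theorem nth_keep_eq_iff [DecidablePred G.Keep] {u v : ℕ} (hu : u < G.kept.card) :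
    Nat.nth G.Keep u = v ↔ G.Keep v ∧ ((Finset.range v).filter G.Keep).card = u := by
  rw [← Nat.count_eq_card_filter_range]
  constructor
  · rintro rfl
    exact ⟨G.nth_keep hu, Nat.count_nth fun hf => by
      have : hf.toFinset = G.kept := by
        rw [← G.toFinset_keep]
      rwa [this]⟩
  · rintro ⟨hv, rfl⟩
    exact Nat.nth_count hv

end CoverGraph

/-- The instance on the reduced graph. -/
noncomputable def kernelInstance (x : List Bool) : PWInstance :=
  mkInstance (wordGraph x).kept.card
    (fun u v => (wordGraph x).Adj' (Nat.nth (wordGraph x).Keep u) (Nat.nth (wordGraph x).Keep v))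
    (fun v => (wordGraph x).Cov (Nat.nth (wordGraph x).Keep v)) (wordK x)

/-- A yes-instance. -/
def yesInstance : PWInstance := ⟨0, ⊥, 0, ∅⟩

/-- A no-instance. -/
def noInstance : PWInstance := ⟨2, ⊤, 0, ∅⟩

open Classical in
/-- The instance to which a word is mapped by the kernelization. -/
noncomputable def kernelTarget (x : List Bool) : PWInstance :=
  if WellFormed x then
    if tailPos (leadingOnes x) + (wordGraph x).covCard < x.length then yesInstance
    else kernelInstance x
  else noInstance

/-- The kernelization. -/
noncomputable def kernelization (x : List Bool) : List Bool := (kernelTarget x).encode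

theorem yesInstance_isYes : yesInstance.IsYes := by
  refine ⟨fun u => u.elim0, ?_⟩
  rw [pathWidth_le_iff_exists]
  exact ⟨⟨0, fun _ => ∅, fun v => v.elim0, fun v => v.elim0, fun v => v.elim0⟩, fun i => by simp⟩

theorem noInstance_not_isYes : ¬ noInstance.IsYes := by
  rintro ⟨h, -⟩
  have := h (show noInstance.graph.Adj (0 : Fin 2) (1 : Fin 2) by
    change (⊤ : SimpleGraph (Fin 2)).Adj 0 1
    simp)
  have he : noInstance.S = ∅ := rfl
  rw [he] at this
  exact this.elim (Finset.notMem_empty _) (Finset.notMem_empty _)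

theorem encode_yesInstance : yesInstance.encode = [false] := by
  simp [PWInstance.encode, yesInstance]

theorem encode_noInstance :
    noInstance.encode = [true, true, false, false, true, true, false, false, false] := by
  simp [PWInstance.encode, noInstance, List.ofFn_succ, Fin.divNat, Fin.modNat]
  exact ⟨(@decide_eq_false_iff_not _ _).2 (Finset.notMem_empty _),
    (@decide_eq_false_iff_not _ _).2 (Finset.notMem_empty _)⟩

theorem card_wordInstance (x : List Bool) : (wordInstance x).S.card = (wordGraph x).covCard := by
  classical
  exact mkInstance_card _ _ _ _

/-! ### The kernelization on well-formed words -/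

section Kernel

variable {x : List Bool} (hx : WellFormed x)

include hx

theorem param_of_wellFormed : pathWidthVC.param x = (wordGraph x).covCard := by
  rw [← card_wordInstance x, ← pathWidthVC_param_encode, encode_wordInstance hx]

theorem mem_language_iff_of_wellFormed : x ∈ pathWidthVC.language ↔
    HasIntervals (wordGraph x).Adj (Finset.range (wordGraph x).order) (wordK x) := by
  have h := mem_pathWidthVC_encode (wordInstance x)
  rw [encode_wordInstance hx] at h
  exact h.trans (mkInstance_isYes hx.good.symm hx.good.irrefl hx.good.cover _)

/-- The kernel is the reduced graph, renumbered along the increasing enumeration of the surviving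
vertices, with k unchanged. -/
theorem kernelInstance_isYes_iff : (kernelInstance x).IsYes ↔ x ∈ pathWidthVC.language := by
  have hlt : ∀ u < (wordGraph x).kept.card,
      Nat.nth (wordGraph x).Keep u < (wordGraph x).order := fun u hu =>
    ((wordGraph x).nth_keep hu).1
  rw [mem_language_iff_of_wellFormed hx, hx.good.hasIntervals_iff, ← (wordGraph x).image_nth,
    ← hasIntervals_image (wordGraph x).nth_injOn]
  exact mkInstance_isYes (fun u hu v hv => hx.good.adj'_symm (hlt u hu) (hlt v hv))
    (fun u hu => hx.good.not_adj' (hlt u hu)) (fun u hu v hv => hx.good.adj'_cover (hlt u hu) (hlt v hv)) _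

/-- The hypothesis says that k has more than s binary digits. A number is at least its number of
digits, so k > s, and the cover with one further vertex per bag gives the decomposition. -/
theorem mem_language_of_lt (h : tailPos (leadingOnes x) + (wordGraph x).covCard < x.length) :
    x ∈ pathWidthVC.language := by
  classical
  rw [mem_language_iff_of_wellFormed hx]
  refine hasIntervals_of_cover
    (S := (Finset.range (wordGraph x).order).filter (wordGraph x).Cov) ?_ ?_
  · intro u hu v hv huv
    have h1 := hx.good.cover u (Finset.mem_range.1 hu) v (Finset.mem_range.1 hv) huv
    exact h1.imp (fun h => Finset.mem_filter.2 ⟨hu, h⟩) fun h => Finset.mem_filter.2 ⟨hv, h⟩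
  · have h1 : (wordK x).size ≤ wordK x := Nat.size_le.2 Nat.lt_two_pow_self
    rw [← Nat.size_eq_bits_len, bits_wordK hx, List.length_drop] at h1
    have h2 : ((Finset.range (wordGraph x).order).filter (wordGraph x).Cov).card =
      (wordGraph x).covCard := rfl
    omega

theorem length_encode_kernelInstance : (kernelInstance x).encode.length =
    tailPos (wordGraph x).kept.card + (x.length - tailPos (leadingOnes x)) := by
  rw [PWInstance.length_encode]
  change tailPos (wordGraph x).kept.card + (wordK x).bits.length = _
  rw [bits_wordK hx, List.length_drop]

/-- This expresses the ones of the kernel through the input word, in a form that formulas can state.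
The digits of k are those of the input, at shifted positions. -/
theorem encode_kernelInstance_iff (j : ℕ) : (kernelInstance x).encode[j]? = some true ↔
    j < (wordGraph x).kept.card ∨
    (∃ u < (wordGraph x).kept.card, ∃ v < (wordGraph x).kept.card,
      j = (wordGraph x).kept.card + 1 + (u * (wordGraph x).kept.card + v) ∧
        (wordGraph x).Adj' (Nat.nth (wordGraph x).Keep u) (Nat.nth (wordGraph x).Keep v)) ∨
    (∃ v < (wordGraph x).kept.card,
      j = (wordGraph x).kept.card + 1 + (wordGraph x).kept.card * (wordGraph x).kept.card + v ∧
        (wordGraph x).Cov (Nat.nth (wordGraph x).Keep v)) ∨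
    ∃ i, j = tailPos (wordGraph x).kept.card + i ∧
      x[tailPos (leadingOnes x) + i]? = some true := by
  have hlt : ∀ u < (wordGraph x).kept.card,
      Nat.nth (wordGraph x).Keep u < (wordGraph x).order := fun u hu =>
    ((wordGraph x).nth_keep hu).1
  have hadj := mkInstance_adj (n := (wordGraph x).kept.card)
    (R := fun u v => (wordGraph x).Adj' (Nat.nth (wordGraph x).Keep u)
      (Nat.nth (wordGraph x).Keep v))
    (fun u hu v hv => hx.good.adj'_symm (hlt u hu) (hlt v hv))
    (fun u hu => hx.good.not_adj' (hlt u hu))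
    (fun v => (wordGraph x).Cov (Nat.nth (wordGraph x).Keep v)) (wordK x)
  have hk : (kernelInstance x).k.bits = x.drop (tailPos (leadingOnes x)) := bits_wordK hx
  rw [PWInstance.encode_true_iff, hk]
  simp only [List.getElem?_drop]
  refine or_congr Iff.rfl (or_congr ?_ (or_congr ?_ Iff.rfl))
  · constructor
    · rintro ⟨u, v, h1, h2⟩
      exact ⟨u, u.2, v, v.2, h1, (hadj u v).1 h2⟩
    · rintro ⟨u, hu, v, hv, h1, h2⟩
      exact ⟨⟨u, hu⟩, ⟨v, hv⟩, h1, (hadj ⟨u, hu⟩ ⟨v, hv⟩).2 h2⟩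
  · constructor
    · rintro ⟨v, h1, h2⟩
      exact ⟨v, v.2, h1, (mkInstance_mem _ _ _ _ v).1 h2⟩
    · rintro ⟨v, hv, h1, h2⟩
      exact ⟨⟨v, hv⟩, h1, (mkInstance_mem _ _ _ _ ⟨v, hv⟩).2 h2⟩

end Kernel

/-! ### Size bounds and the kernelization property -/

theorem order_kernelTarget_le (x : List Bool) :
    (kernelTarget x).order ≤ 3 * pathWidthVC.param x ^ 3 + 3 := by
  unfold kernelTarget
  split_ifs with hx h
  · exact Nat.zero_le _
  · rw [param_of_wellFormed hx]
    exact hx.good.card_kept_le.trans (Nat.le_add_right _ _)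
  · exact le_add_left (by decide : 2 ≤ 3)

/-- The summand `pathWidthVC.param x` bounds the digits of k, since longer k have been answered with
the fixed yes-instance; 9 is the length of the fixed no-instance. -/
theorem length_kernelization_le (x : List Bool) :
    (kernelization x).length ≤ tailPos (3 * pathWidthVC.param x ^ 3) + pathWidthVC.param x + 9 := by
  unfold kernelization kernelTarget
  split_ifs with hx h
  · rw [encode_yesInstance, List.length_singleton]; omega
  · rw [length_encode_kernelInstance hx, param_of_wellFormed hx]
    have h1 := tailPos_mono hx.good.card_kept_le
    omega
  · rw [encode_noInstance]
    simp

theorem length_kernelization_le_domSize (x : List Bool) :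
    (kernelization x).length ≤ domSize x.length := by
  have hD := FmSystem.lt_domSize x.length
  unfold kernelization kernelTarget
  split_ifs with hx h
  · rw [encode_yesInstance, List.length_singleton]; omega
  · rw [length_encode_kernelInstance hx]
    have h1 := tailPos_mono (wordGraph x).card_kept_le_order
    have h2 := hx.le
    have h3 : (wordGraph x).order = leadingOnes x := rfl
    rw [h3] at h1
    omega
  · rw [encode_noInstance]
    simp only [List.length_cons, List.length_nil]
    omega

theorem computable_bound : Computable fun s : ℕ => tailPos (3 * s ^ 3) + s + 9 := by
  have h0 : Primrec fun s : ℕ => s := Primrec.id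
  have hn : Primrec fun s : ℕ => 3 * (s * s * s) :=
    Primrec.nat_mul.comp (Primrec.const 3)
      (Primrec.nat_mul.comp (Primrec.nat_mul.comp h0 h0) h0)
  have ht : Primrec fun s : ℕ => tailPos (3 * (s * s * s)) :=
    Primrec.nat_add.comp (Primrec.nat_add.comp (Primrec.succ.comp hn)
      (Primrec.nat_mul.comp hn hn)) hn
  have h := Primrec.nat_add.comp (Primrec.nat_add.comp ht h0) (Primrec.const 9)
  refine (h.of_eq fun s => ?_).to_comp
  rw [pow_succ, pow_two]

theorem isKernelization : pathWidthVC.IsKernelization kernelization := by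
  refine ⟨fun x => ?_, _, computable_bound, length_kernelization_le⟩
  rw [kernelization, mem_pathWidthVC_encode]
  unfold kernelTarget
  split_ifs with hx h
  · exact iff_of_true (mem_language_of_lt hx h) yesInstance_isYes
  · exact (kernelInstance_isYes_iff hx).symm
  · refine iff_of_false ?_ noInstance_not_isYes
    rintro ⟨I, rfl, hI, -⟩
    -- A yes-instance has a vertex cover as its set, so its encoding would be well-formed.
    exact hx (wellFormed_encode hI)

/-! ### Definable relations and functions -/

/-- A relation between words and tuples of numbers is definable if it is expressed by a formula, on
tuples of elements of the domain. -/
def Definable (k : ℕ) (P : List Bool → (Fin k → ℕ) → Prop) : Prop :=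
  ∃ φ : Fm, ∀ (x : List Bool) (v : ℕ → ℕ), (∀ i, v i < domSize x.length) →
    (φ.sat x (domSize x.length) v ↔ P x fun i => v i)

/-- A function on words and tuples of numbers is definable if the relation `c ≤ f` is. -/
def DefinableFun (k : ℕ) (f : List Bool → (Fin k → ℕ) → ℕ) : Prop :=
  Definable (k + 1) fun x v => v (Fin.last k) ≤ f x fun i => v i.castSucc

/-! ### Closure properties of definable relations -/

namespace Definable

variable {k : ℕ}

theorem congr {P Q : List Bool → (Fin k → ℕ) → Prop} (hP : Definable k P)
    (h : ∀ x v, (∀ i, v i < domSize x.length) → (P x v ↔ Q x v)) : Definable k Q := by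
  obtain ⟨φ, hφ⟩ := hP
  exact ⟨φ, fun x v hv => (hφ x v hv).trans (h x _ fun i => hv i)⟩

theorem lt (s t : Fin k) : Definable k fun _ v => v s < v t :=
  ⟨.lt s t, fun _ _ _ => Iff.rfl⟩

theorem lt_length (s : Fin k) : Definable k fun x v => v s < x.length :=
  ⟨.ltn s, fun _ _ _ => Iff.rfl⟩

theorem input (s : Fin k) : Definable k fun x v => x[v s]? = some true :=
  ⟨.inp s, fun _ _ _ => Iff.rfl⟩

variable {P Q : List Bool → (Fin k → ℕ) → Prop}

theorem not (hP : Definable k P) : Definable k fun x v => ¬ P x v := by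
  obtain ⟨φ, hφ⟩ := hP
  exact ⟨.neg φ, fun x v hv => not_congr (hφ x v hv)⟩

theorem and (hP : Definable k P) (hQ : Definable k Q) : Definable k fun x v => P x v ∧ Q x v := by
  obtain ⟨φ, hφ⟩ := hP
  obtain ⟨ψ, hψ⟩ := hQ
  exact ⟨.and φ ψ, fun x v hv => and_congr (hφ x v hv) (hψ x v hv)⟩

theorem or (hP : Definable k P) (hQ : Definable k Q) : Definable k fun x v => P x v ∨ Q x v :=
  (hP.not.and hQ.not).not.congr fun _ _ _ => by tauto

theorem imp (hP : Definable k P) (hQ : Definable k Q) : Definable k fun x v => P x v → Q x v :=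
  (hP.and hQ.not).not.congr fun _ _ _ => by tauto

theorem le (s t : Fin k) : Definable k fun _ v => v s ≤ v t :=
  (lt t s).not.congr fun _ _ _ => not_lt

theorem eq (s t : Fin k) : Definable k fun _ v => v s = v t :=
  ((le s t).and (le t s)).congr fun _ _ _ => le_antisymm_iff.symm

/-- Variables are named by their position from the left, so a further argument at the end leaves the
formula as it is. -/
theorem weaken (hP : Definable k P) : Definable (k + 1) fun x v => P x fun i => v i.castSucc := hP

/-- Here the bound in c ≤ f is the last argument and moves from variable `k` to `k + 1`. The formula
is reused after copying that value into variable `k` by an existential quantifier. -/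
theorem weaken_fun {f : List Bool → (Fin k → ℕ) → ℕ} (hf : DefinableFun k f) :
    DefinableFun (k + 1) fun x v => f x fun i => v i.castSucc := by
  obtain ⟨φ, hφ⟩ := hf
  refine ⟨.ex k (.and (.neg (.lt k (k + 1))) (.and (.neg (.lt (k + 1) k)) φ)), fun x v hv => ?_⟩
  have h : ∀ i : Fin k, Function.update v k (v (k + 1)) i = v i := fun i =>
    Function.update_of_ne (ne_of_lt i.2) _ _
  have hk : ∀ a, Function.update v k a (k + 1) = v (k + 1) := fun a =>
    Function.update_of_ne (Nat.succ_ne_self k) _ _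
  have key := hφ x (Function.update v k (v (k + 1))) fun i => by
    rcases eq_or_ne i k with rfl | h
    · rw [Function.update_self]; exact hv _
    · rw [Function.update_of_ne h]; exact hv i
  simp only [Fin.val_last, Function.update_self, Fin.val_castSucc, h] at key
  simp only [Fm.sat, Function.update_self, hk, Fin.val_last, Fin.val_castSucc]
  rw [← key]
  constructor
  · rintro ⟨a, -, h1, h2, h3⟩
    rwa [show a = v (k + 1) by omega] at h3
  · intro h
    exact ⟨v (k + 1), hv _, by omega, by omega, h⟩

theorem exists_lt {P : List Bool → (Fin k → ℕ) → ℕ → Prop}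
    (hP : Definable (k + 1) fun x v => P x (fun i => v i.castSucc) (v (Fin.last k))) :
    Definable k fun x v => ∃ a < domSize x.length, P x v a := by
  obtain ⟨φ, hφ⟩ := hP
  refine ⟨.ex k φ, fun x v hv => exists_congr fun a => and_congr_right fun ha => ?_⟩
  rw [hφ x _ fun i => ?_]
  · have h : ∀ i : Fin k, Function.update v k a (i.castSucc : Fin (k + 1)) = v i := fun i =>
      Function.update_of_ne (ne_of_lt i.2) _ _
    simp only [h, Fin.val_last, Function.update_self]
  · rcases eq_or_ne i k with rfl | h
    · rwa [Function.update_self]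
    · rw [Function.update_of_ne h]; exact hv i

theorem forall_lt {P : List Bool → (Fin k → ℕ) → ℕ → Prop}
    (hP : Definable (k + 1) fun x v => P x (fun i => v i.castSucc) (v (Fin.last k))) :
    Definable k fun x v => ∀ a < domSize x.length, P x v a :=
  (exists_lt (P := fun x v a => ¬ P x v a) hP.not).not.congr fun _ _ _ => by simp

/-- Substitution of a variable. -/
theorem subst {P : List Bool → (Fin k → ℕ) → ℕ → Prop}
    (hP : Definable (k + 1) fun x v => P x (fun i => v i.castSucc) (v (Fin.last k))) (s : Fin k) :
    Definable k fun x v => P x v (v s) :=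
  (exists_lt (P := fun x v a => a = v s ∧ P x v a) ((eq (Fin.last k) s.castSucc).and hP)).congr
    fun _ v hv => ⟨fun ⟨_, _, h, h'⟩ => h ▸ h', fun h => ⟨v s, hv s, rfl, h⟩⟩

theorem le_fun {f : List Bool → (Fin k → ℕ) → ℕ} (hf : DefinableFun k f) (s : Fin k) :
    Definable k fun x v => v s ≤ f x v :=
  subst (P := fun x v a => a ≤ f x v) hf s

/-- The strict inequality needs a witness above `v s`, which does not exist if `v s` is the greatest
element of the domain. -/
theorem succ_le_fun {f : List Bool → (Fin k → ℕ) → ℕ} (hf : DefinableFun k f) (s : Fin k) :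
    Definable k fun x v => v s + 1 < domSize x.length ∧ v s < f x v :=
  (exists_lt (P := fun x v a => v s < a ∧ a ≤ f x v)
    ((lt s.castSucc (Fin.last k)).and hf)).congr fun x v _ =>
    ⟨fun ⟨a, ha, h, h'⟩ => ⟨by omega, by omega⟩, fun h => ⟨v s + 1, h.1, by omega, h.2⟩⟩

/-- Positions of the word lie well below the end of the domain, so the proviso of `succ_le_fun` is
fulfilled automatically. -/
theorem lt_length_and_lt_fun {f : List Bool → (Fin k → ℕ) → ℕ} (hf : DefinableFun k f)
    (s : Fin k) : Definable k fun x v => v s < x.length ∧ v s < f x v :=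
  ((lt_length s).and (succ_le_fun hf s)).congr fun x v _ => by
    have := FmSystem.lt_domSize x.length
    constructor <;> intro h <;> refine ⟨h.1, ?_⟩ <;> omega

theorem lt_length_and_eq_fun {f : List Bool → (Fin k → ℕ) → ℕ} (hf : DefinableFun k f)
    (s : Fin k) : Definable k fun x v => v s < x.length ∧ v s = f x v :=
  ((lt_length s).and ((le_fun hf s).and (succ_le_fun hf s).not)).congr fun x v _ => by
    have := FmSystem.lt_domSize x.length
    constructor <;> intro h <;> refine ⟨h.1, ?_⟩ <;> omega

/-- Values of `f` may exceed the domain, but the word has no bit there. It suffices to quantify over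
its positions. -/
theorem input_fun {f : List Bool → (Fin k → ℕ) → ℕ} (hf : DefinableFun k f) :
    Definable k fun x v => x[f x v]? = some true :=
  (exists_lt (P := fun x v a => (a < x.length ∧ a = f x v) ∧ x[a]? = some true)
    ((lt_length_and_eq_fun (weaken_fun hf) (Fin.last k)).and
      (input (Fin.last k)))).congr fun x v _ => by
    constructor
    · rintro ⟨_, -, ⟨-, rfl⟩, h⟩; exact h
    · intro h
      obtain ⟨h1, -⟩ := List.getElem?_eq_some_iff.1 h
      have := FmSystem.lt_domSize x.length
      exact ⟨_, by omega, ⟨h1, rfl⟩, h⟩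

end Definable

/-! ### Closure properties of definable functions -/

namespace DefinableFun

open Definable

variable {k : ℕ}

theorem congr {f g : List Bool → (Fin k → ℕ) → ℕ} (hf : DefinableFun k f)
    (h : ∀ x v, (∀ i, v i < domSize x.length) → ∀ c < domSize x.length, c ≤ f x v ↔ c ≤ g x v) :
    DefinableFun k g :=
  Definable.congr hf fun x _ hv => h x _ (fun i => hv i.castSucc) _ (hv (Fin.last k))

/-- The cardinality of a definable set of pairs. -/
theorem card_pairs {P : List Bool → (Fin k → ℕ) → ℕ → ℕ → Prop}
    (hP : Definable (k + 2) fun x v => P x (fun i => v i.castSucc.castSucc)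
      (v (Fin.last k).castSucc) (v (Fin.last (k + 1))))
    {S : List Bool → (Fin k → ℕ) → Finset (ℕ × ℕ)}
    (hS : ∀ x v p, p ∈ S x v ↔ p.1 < domSize x.length ∧ p.2 < domSize x.length ∧ P x v p.1 p.2) :
    DefinableFun k fun x v => (S x v).card := by
  obtain ⟨φ, hφ⟩ := hP
  -- The bound to compare with is stored in variable `k`, which the counting quantifier binds; it is
  -- first copied to variable `k + 2`.
  refine ⟨.ex (k + 2) (.and (.neg (.lt (k + 2) k)) (.and (.neg (.lt k (k + 2)))
    (.cnt k φ (k + 2)))), fun x v hv => ?_⟩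
  have hk : ∀ a, Function.update v (k + 2) a k = v k := fun a =>
    Function.update_of_ne (by omega) _ _
  simp only [Fm.sat, Function.update_self, hk, Fin.val_last, Fin.val_castSucc]
  classical
  have key : ∀ a < domSize x.length, ((Finset.range (domSize x.length) ×ˢ
      Finset.range (domSize x.length)).filter fun p => Fm.sat x (domSize x.length)
        (Function.update (Function.update (Function.update v (k + 2) a) k p.1) (k + 1) p.2) φ) =
      S x fun i => v i := by
    intro a ha
    ext p
    rw [hS, Finset.mem_filter, Finset.mem_product, Finset.mem_range, Finset.mem_range, and_assoc]
    refine and_congr_right fun hp1 => and_congr_right fun hp2 => ?_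
    rw [hφ]
    · have h1 : ∀ i : Fin k, Function.update (Function.update (Function.update v (k + 2) a) k p.1)
          (k + 1) p.2 i = v i := fun i => by
        rw [Function.update_of_ne, Function.update_of_ne, Function.update_of_ne] <;> omega
      have h2 : Function.update (Function.update (Function.update v (k + 2) a) k p.1)
          (k + 1) p.2 k = p.1 := by
        rw [Function.update_of_ne (by omega), Function.update_self]
      simp only [Fin.val_last, Fin.val_castSucc, h1, h2, Function.update_self]
    · intro i
      simp only [Function.update_apply]
      split_ifs
      exacts [hp2, hp1, ha, hv i]
  constructor
  · rintro ⟨a, ha, h1, h2, h3⟩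
    rw [key a ha] at h3
    rwa [show a = v k by omega] at h3
  · intro h
    refine ⟨v k, hv k, lt_irrefl _, lt_irrefl _, ?_⟩
    rwa [key _ (hv k)]

theorem var (s : Fin k) : DefinableFun k fun _ v => v s :=
  Definable.le (Fin.last k) s.castSucc

/-- By induction, using that v ≤ n + 1 holds if and only if a ≤ n for all a < v. -/
theorem const (n : ℕ) : DefinableFun k fun _ _ => n := by
  induction n with
  | zero =>
    refine (Definable.forall_lt (P := fun _ v a => ¬ a < v (Fin.last k))
      (Definable.lt _ _).not).congr fun x v hv => ?_
    change _ ↔ v (Fin.last k) ≤ 0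
    refine ⟨fun h => ?_, fun h a _ => by omega⟩
    by_contra hc
    exact h 0 ((Nat.zero_le _).trans_lt (hv (Fin.last k))) (by omega)
  | succ n ih =>
    refine (Definable.forall_lt (P := fun _ v a => a < v (Fin.last k) → a ≤ n)
      ((Definable.lt _ _).imp ?_)).congr fun x v hv => ?_
    · exact le_fun (k := k + 2) (weaken_fun (weaken_fun ih)) _
    · change _ ↔ v (Fin.last k) ≤ n + 1
      refine ⟨fun h => ?_, fun h a _ _ => by omega⟩
      by_contra hc
      have := h (v (Fin.last k) - 1) ((Nat.sub_le _ _).trans_lt (hv _)) (by omega)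
      omega

theorem length : DefinableFun k fun x _ => x.length := by
  refine (Definable.forall_lt (P := fun x v a => a < v (Fin.last k) → a < x.length)
    ((Definable.lt _ _).imp (lt_length _))).congr fun x v hv => ?_
  change _ ↔ v (Fin.last k) ≤ x.length
  refine ⟨fun h => ?_, fun h a _ _ => by omega⟩
  by_contra hc
  have := h (v (Fin.last k) - 1) ((Nat.sub_le _ _).trans_lt (hv _)) (by omega)
  omega

variable {f g : List Bool → (Fin k → ℕ) → ℕ}

/-- The product counts a rectangle of pairs; this is why the counting quantifier binds two
variables. The sides start at 1, since only relations c ≤ f are at hand, and are cut off at the end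
of the domain. -/
theorem mul (hf : DefinableFun k f) (hg : DefinableFun k g) :
    DefinableFun k fun x v => f x v * g x v := by
  have hpos : ∀ s : Fin (k + 2), Definable (k + 2) fun _ v => ¬ v s ≤ 0 := fun s =>
    (le_fun (const 0) s).not
  refine (card_pairs (P := fun x v a b => (¬ a ≤ 0 ∧ a ≤ f x v) ∧ (¬ b ≤ 0 ∧ b ≤ g x v))
    (((hpos _).and (le_fun (weaken_fun (weaken_fun hf)) _)).and
      ((hpos _).and (le_fun (weaken_fun (weaken_fun hg)) _)))
    (S := fun x v => Finset.Icc 1 (Nat.min (f x v) (domSize x.length - 1)) ×ˢ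
        Finset.Icc 1 (Nat.min (g x v) (domSize x.length - 1))) fun x v p => ?_).congr
    fun x v _ c hc => ?_
  · have hD := FmSystem.lt_domSize x.length
    simp only [Finset.mem_product, Finset.mem_Icc, Nat.le_min]
    omega
  rw [Finset.card_product, Nat.card_Icc, Nat.card_Icc, Nat.add_sub_cancel, Nat.add_sub_cancel]
  have hc' : c ≤ domSize x.length - 1 := by omega
  constructor
  · intro h
    exact h.trans (Nat.mul_le_mul (Nat.min_le_left _ _) (Nat.min_le_left _ _))
  · intro h
    rcases Nat.eq_zero_or_pos c with rfl | hc0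
    · exact Nat.zero_le _
    have hf0 : 0 < f x v := Nat.pos_of_ne_zero fun h0 => by rw [h0] at h; omega
    have hg0 : 0 < g x v := Nat.pos_of_ne_zero fun h0 => by rw [h0] at h; omega
    have hf1 : 0 < Nat.min (f x v) (domSize x.length - 1) := Nat.le_min.2 ⟨hf0, by omega⟩
    have hg1 : 0 < Nat.min (g x v) (domSize x.length - 1) := Nat.le_min.2 ⟨hg0, by omega⟩
    -- If a side is cut off and the other one is not empty, the rectangle still has at least
    -- `domSize x.length - 1` elements, so no bound from the domain is affected.
    rcases le_total (f x v) (domSize x.length - 1) with h2 | h2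
    · rcases le_total (g x v) (domSize x.length - 1) with h3 | h3
      · rwa [show Nat.min (f x v) _ = f x v from min_eq_left h2,
          show Nat.min (g x v) _ = g x v from min_eq_left h3]
      · rw [show Nat.min (g x v) _ = _ from min_eq_right h3]
        exact hc'.trans (Nat.le_mul_of_pos_left _ hf1)
    · rw [show Nat.min (f x v) _ = _ from min_eq_right h2]
      exact hc'.trans (Nat.le_mul_of_pos_right _ hg1)

/-- The sum counts two disjoint columns of pairs, marked by the first components 0 and 1. -/
theorem add (hf : DefinableFun k f) (hg : DefinableFun k g) :
    DefinableFun k fun x v => f x v + g x v := by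
  have hpos : ∀ s : Fin (k + 2), Definable (k + 2) fun _ v => v s ≤ 0 := fun s =>
    le_fun (const 0) s
  have hone : ∀ s : Fin (k + 2), Definable (k + 2) fun _ v => v s ≤ 1 := fun s =>
    le_fun (const 1) s
  refine (card_pairs (P := fun x v a b => (a ≤ 0 ∧ (¬ b ≤ 0 ∧ b ≤ f x v)) ∨
      ((a ≤ 1 ∧ ¬ a ≤ 0) ∧ (¬ b ≤ 0 ∧ b ≤ g x v)))
    (((hpos _).and ((hpos _).not.and (le_fun (weaken_fun (weaken_fun hf)) _))).or
      (((hone _).and (hpos _).not).and ((hpos _).not.and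
        (le_fun (weaken_fun (weaken_fun hg)) _))))
    (S := fun x v => ({0} ×ˢ Finset.Icc 1 (Nat.min (f x v) (domSize x.length - 1))) ∪
        ({1} ×ˢ Finset.Icc 1 (Nat.min (g x v) (domSize x.length - 1)))) fun x v p => ?_).congr
    fun x v _ c hc => ?_
  · have hD := FmSystem.lt_domSize x.length
    simp only [Finset.mem_product, Finset.mem_Icc, Nat.le_min, Finset.mem_union,
      Finset.mem_singleton]
    omega
  rw [Finset.card_union_of_disjoint]
  · rw [Finset.card_product, Finset.card_product, Nat.card_Icc, Nat.card_Icc,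
      Finset.card_singleton, Finset.card_singleton, one_mul, one_mul, Nat.add_sub_cancel,
      Nat.add_sub_cancel]
    have e1 : Nat.min (f x v) (domSize x.length - 1) = _ := Nat.min_def ..
    have e2 : Nat.min (g x v) (domSize x.length - 1) = _ := Nat.min_def ..
    rw [e1, e2]
    split_ifs <;> omega
  · rw [Finset.disjoint_left]
    intro p hp hp'
    rw [Finset.mem_product, Finset.mem_singleton] at hp hp'
    omega

/-- The cardinality of a definable set. -/
theorem card {P : List Bool → (Fin k → ℕ) → ℕ → Prop}
    (hP : Definable (k + 1) fun x v => P x (fun i => v i.castSucc) (v (Fin.last k)))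
    {S : List Bool → (Fin k → ℕ) → Finset ℕ}
    (hS : ∀ x v a, a ∈ S x v ↔ a < domSize x.length ∧ P x v a) :
    DefinableFun k fun x v => (S x v).card := by
  refine (card_pairs (P := fun x v a b => P x v a ∧ b ≤ 0)
    (hP.weaken.and (le_fun (const 0) _)) (S := fun x v => S x v ×ˢ {0}) fun x v p => ?_).congr
    fun x v _ c _ => ?_
  · have hD := FmSystem.lt_domSize x.length
    rw [Finset.mem_product, Finset.mem_singleton, hS]
    constructor
    · rintro ⟨⟨h1, h2⟩, h3⟩; exact ⟨h1, by omega, h2, by omega⟩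
    · rintro ⟨h1, -, h2, h3⟩; exact ⟨⟨h1, h2⟩, by omega⟩
  · rw [Finset.card_product, Finset.card_singleton, mul_one]

end DefinableFun

/-! ### Definability of the kernelization -/

namespace Definable

variable {k : ℕ} {f : List Bool → (Fin k → ℕ) → ℕ}

theorem fun_lt_length (hf : DefinableFun k f) : Definable k fun x v => f x v < x.length :=
  (exists_lt (P := fun x v a => a < x.length ∧ a = f x v)
    (lt_length_and_eq_fun (weaken_fun hf) (Fin.last k))).congr fun x v _ => by
    have := FmSystem.lt_domSize x.length
    exact ⟨fun ⟨a, _, h, h'⟩ => h' ▸ h, fun h => ⟨_, by omega, h, rfl⟩⟩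

theorem length_lt_fun (hf : DefinableFun k f) : Definable k fun x v => x.length < f x v :=
  (exists_lt (P := fun x v a => a ≤ f x v ∧ ¬ a ≤ x.length)
    ((le_fun (weaken_fun hf) (Fin.last k)).and
      (le_fun DefinableFun.length (Fin.last k)).not)).congr fun x v _ => by
    have := FmSystem.lt_domSize x.length
    exact ⟨fun ⟨a, _, h, h'⟩ => by omega, fun h => ⟨x.length + 1, by omega, h, by omega⟩⟩

end Definable

namespace DefinableFun

open Definable

variable {k : ℕ}

theorem tailPos {f : List Bool → (Fin k → ℕ) → ℕ} (hf : DefinableFun k f) :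
    DefinableFun k fun x v => tailPos (f x v) :=
  (((hf.add (const 1)).add (hf.mul hf)).add hf)

theorem leadingOnes : DefinableFun k fun x _ => leadingOnes x :=
  (forall_lt (P := fun x v a => a < v (Fin.last k) → x[a]? = some true)
    ((lt _ _).imp (input _))).congr fun x v hv => by
    rw [le_leadingOnes_iff]
    exact ⟨fun h i hi => h i (hi.trans (hv _)) hi, fun h i _ hi => h i hi⟩

end DefinableFun

open Definable DefinableFun

/-! ### Formulas for the reduced graph and the kernel -/

section

variable {k : ℕ}

theorem definable_lt_order (s : Fin k) : Definable k fun x v => v s < leadingOnes x :=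
  (lt_length_and_lt_fun DefinableFun.leadingOnes s).congr fun x _ _ =>
    ⟨fun h => h.2, fun h => ⟨h.trans_le (leadingOnes_le x), h⟩⟩

theorem definable_adj (s t : Fin k) : Definable k fun x v => (wordGraph x).Adj (v s) (v t) :=
  input_fun ((DefinableFun.leadingOnes.add (const 1)).add
    (((var s).mul DefinableFun.leadingOnes).add (var t)))

theorem definable_cov (s : Fin k) : Definable k fun x v => (wordGraph x).Cov (v s) :=
  input_fun (((DefinableFun.leadingOnes.add (const 1)).add
    (DefinableFun.leadingOnes.mul DefinableFun.leadingOnes)).add (var s))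

theorem exists_lt_order {P : List Bool → (Fin k → ℕ) → ℕ → Prop}
    (hP : Definable (k + 1) fun x v => P x (fun i => v i.castSucc) (v (Fin.last k))) :
    Definable k fun x v => ∃ a < leadingOnes x, P x v a :=
  (exists_lt (P := fun x v a => a < leadingOnes x ∧ P x v a)
    ((definable_lt_order _).and hP)).congr fun x v _ => by
    have h1 := leadingOnes_le x
    have h2 := FmSystem.lt_domSize x.length
    exact ⟨fun ⟨a, _, h⟩ => ⟨a, h⟩, fun ⟨a, h⟩ => ⟨a, by omega, h⟩⟩

theorem forall_lt_order {P : List Bool → (Fin k → ℕ) → ℕ → Prop}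
    (hP : Definable (k + 1) fun x v => P x (fun i => v i.castSucc) (v (Fin.last k))) :
    Definable k fun x v => ∀ a < leadingOnes x, P x v a :=
  (exists_lt_order (P := fun x v a => ¬ P x v a) hP.not).not.congr fun _ _ _ => by simp

theorem lt_domSize_of_lt_order {x : List Bool} {a : ℕ} (h : a < leadingOnes x) :
    a < domSize x.length := by
  have h1 := leadingOnes_le x
  have h2 := FmSystem.lt_domSize x.length
  omega

theorem definable_covCard : DefinableFun k fun x _ => (wordGraph x).covCard := by
  classical
  refine card (P := fun x _ a => a < leadingOnes x ∧ (wordGraph x).Cov a)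
    ((definable_lt_order _).and (definable_cov _))
    (S := fun x _ => (Finset.range (wordGraph x).order).filter (wordGraph x).Cov)
    fun x v a => ?_
  rw [Finset.mem_filter, Finset.mem_range]
  exact ⟨fun h => ⟨lt_domSize_of_lt_order h.1, h⟩, fun h => h.2⟩

theorem definable_common (s t : Fin k) :
    DefinableFun k fun x v => ((wordGraph x).common (v s) (v t)).card := by
  classical
  refine card (P := fun x v a => a < leadingOnes x ∧ ¬ (wordGraph x).Cov a ∧
      (wordGraph x).Adj (v s) a ∧ (wordGraph x).Adj (v t) a)
    ((definable_lt_order _).and ((definable_cov _).not.and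
      ((definable_adj s.castSucc _).and (definable_adj t.castSucc _))))
    fun x v a => ?_
  rw [CoverGraph.common, Finset.mem_filter, Finset.mem_range]
  exact ⟨fun h => ⟨lt_domSize_of_lt_order h.1, h⟩, fun h => h.2⟩

theorem CoverGraph.card_common_le (G : CoverGraph) (u v : ℕ) : (G.common u v).card ≤ G.order := by
  classical
  exact (Finset.card_filter_le _ _).trans_eq (Finset.card_range _)

/-- Two definable values are compared by naming the smaller one; it is at most the order of the
graph and thus an element of the domain. -/
theorem definable_covCard_lt (s t : Fin k) : Definable k fun x v =>
    (wordGraph x).covCard < ((wordGraph x).common (v s) (v t)).card :=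
  (exists_lt (P := fun x v a => (a < x.length ∧ a = (wordGraph x).covCard) ∧
      (a < x.length ∧ a < ((wordGraph x).common (v s) (v t)).card))
    ((lt_length_and_eq_fun definable_covCard _).and
      (lt_length_and_lt_fun (definable_common s.castSucc t.castSucc) _))).congr fun x v _ => by
    have h1 : (wordGraph x).order ≤ x.length := leadingOnes_le x
    have h2 := FmSystem.lt_domSize x.length
    have h3 := (wordGraph x).card_common_le (v s) (v t)
    constructor
    · rintro ⟨a, -, ⟨-, rfl⟩, -, h⟩; exact h
    · intro h; exact ⟨_, by omega, ⟨by omega, rfl⟩, by omega, h⟩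

theorem definable_adj' (s t : Fin k) : Definable k fun x v => (wordGraph x).Adj' (v s) (v t) :=
  (definable_adj s t).or ((Definable.eq s t).not.and
    ((definable_cov s).and ((definable_cov t).and (definable_covCard_lt s t))))

theorem definable_simp (s : Fin k) : Definable k fun x v => (wordGraph x).Simp (v s) :=
  (definable_cov s).not.and <|
    forall_lt_order (P := fun x v a => ∀ b < leadingOnes x, (wordGraph x).Adj (v s) a →
      (wordGraph x).Adj (v s) b → a ≠ b → (wordGraph x).Adj' a b) <|
    forall_lt_order (P := fun x v b => (wordGraph x).Adj (v s.castSucc) (v (Fin.last k)) →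
      (wordGraph x).Adj (v s.castSucc) b → v (Fin.last k) ≠ b →
        (wordGraph x).Adj' (v (Fin.last k)) b) <|
    (definable_adj s.castSucc.castSucc (Fin.last k).castSucc).imp <|
    (definable_adj s.castSucc.castSucc (Fin.last (k + 1))).imp <|
    (Definable.eq (Fin.last k).castSucc (Fin.last (k + 1))).not.imp <|
    definable_adj' (Fin.last k).castSucc (Fin.last (k + 1))

theorem definable_leastFor (r s t : Fin k) :
    Definable k fun x v => (wordGraph x).LeastFor (v r) (v s) (v t) :=
  (definable_simp r).and <| (definable_adj r s).and <| (definable_adj r t).and <|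
    (forall_lt (P := fun x v a => a < v r → ¬ ((wordGraph x).Simp a ∧
      (wordGraph x).Adj a (v s) ∧ (wordGraph x).Adj a (v t)))
    ((lt (Fin.last k) r.castSucc).imp ((definable_simp (Fin.last k)).and
      ((definable_adj (Fin.last k) s.castSucc).and
        (definable_adj (Fin.last k) t.castSucc))).not)).congr fun _ _ hv =>
    ⟨fun h a ha => h a (ha.trans (hv r)) ha, fun h a _ ha => h a ha⟩

theorem definable_keep (s : Fin k) : Definable k fun x v => (wordGraph x).Keep (v s) :=
  (definable_lt_order s).and <| (definable_cov s).or <| (definable_simp s).not.or <|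
    exists_lt_order (P := fun x v a => ∃ b < leadingOnes x, (wordGraph x).LeastFor (v s) a b) <|
    exists_lt_order (P := fun x v b => (wordGraph x).LeastFor (v s.castSucc) (v (Fin.last k)) b) <|
    definable_leastFor s.castSucc.castSucc (Fin.last k).castSucc (Fin.last (k + 1))

theorem definable_card_kept : DefinableFun k fun x _ => (wordGraph x).kept.card :=
  card (P := fun x _ a => (wordGraph x).Keep a) (definable_keep _) fun x v a => by
    rw [CoverGraph.mem_kept]
    exact ⟨fun h => ⟨lt_domSize_of_lt_order h.1, h⟩, fun h => h.2⟩

theorem definable_lt_card_kept (s : Fin k) :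
    Definable k fun x v => v s < (wordGraph x).kept.card :=
  (lt_length_and_lt_fun definable_card_kept s).congr fun x _ _ =>
    ⟨fun h => h.2, fun h =>
      ⟨h.trans_le ((wordGraph x).card_kept_le_order.trans (leadingOnes_le x)), h⟩⟩

/-- Counting replaces the recursive enumeration: the vertex with index u is the surviving vertex
with exactly u survivors below it. -/
theorem definable_nth_keep (s t : Fin k) : Definable k fun x v =>
    v s < (wordGraph x).kept.card ∧ Nat.nth (wordGraph x).Keep (v s) = v t := by
  classical
  have hf : DefinableFun k fun x v => ((Finset.range (v t)).filter (wordGraph x).Keep).card := by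
    refine card (P := fun x v a => a < v t ∧ (wordGraph x).Keep a)
      ((lt (Fin.last k) t.castSucc).and (definable_keep _)) fun x v a => ?_
    rw [Finset.mem_filter, Finset.mem_range]
    exact ⟨fun h => ⟨lt_domSize_of_lt_order h.2.1, h⟩, fun h => h.2⟩
  refine ((definable_lt_card_kept s).and ((definable_keep t).and
    (lt_length_and_eq_fun hf s))).congr fun x v _ => and_congr_right fun h => ?_
  rw [(wordGraph x).nth_keep_eq_iff h]
  have h1 := (wordGraph x).card_kept_le_order.trans (leadingOnes_le x)
  exact ⟨fun h => ⟨h.1, h.2.2.symm⟩, fun h' => ⟨h'.1, h.trans_le h1, h'.2.symm⟩⟩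

theorem definable_wellFormed : Definable k fun x _ => WellFormed x := by
  have h1 : Definable k fun x _ => ∀ u < leadingOnes x, ∀ v < leadingOnes x,
      (wordGraph x).Adj u v → (wordGraph x).Adj v u :=
    forall_lt_order (P := fun x _ u => ∀ v < leadingOnes x,
      (wordGraph x).Adj u v → (wordGraph x).Adj v u) <|
    forall_lt_order (P := fun x w v =>
      (wordGraph x).Adj (w (Fin.last k)) v → (wordGraph x).Adj v (w (Fin.last k))) <|
    (definable_adj (Fin.last k).castSucc (Fin.last (k + 1))).imp
      (definable_adj (Fin.last (k + 1)) (Fin.last k).castSucc)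
  have h2 : Definable k fun x _ => ∀ u < leadingOnes x, ¬ (wordGraph x).Adj u u :=
    forall_lt_order (P := fun x _ u => ¬ (wordGraph x).Adj u u)
      (definable_adj (Fin.last k) (Fin.last k)).not
  have h3 : Definable k fun x _ => ∀ u < leadingOnes x, ∀ v < leadingOnes x,
      (wordGraph x).Adj u v → (wordGraph x).Cov u ∨ (wordGraph x).Cov v :=
    forall_lt_order (P := fun x _ u => ∀ v < leadingOnes x,
      (wordGraph x).Adj u v → (wordGraph x).Cov u ∨ (wordGraph x).Cov v) <|
    forall_lt_order (P := fun x w v => (wordGraph x).Adj (w (Fin.last k)) v →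
      (wordGraph x).Cov (w (Fin.last k)) ∨ (wordGraph x).Cov v) <|
    (definable_adj (Fin.last k).castSucc (Fin.last (k + 1))).imp
      ((definable_cov (Fin.last k).castSucc).or (definable_cov (Fin.last (k + 1))))
  -- The last position is described as the greatest one, which avoids subtraction.
  have h4 : Definable k fun x _ => ∃ p < domSize x.length, x[p]? = some true ∧
      ∀ q < domSize x.length, q < x.length → q ≤ p :=
    exists_lt (P := fun x _ p => x[p]? = some true ∧
      ∀ q < domSize x.length, q < x.length → q ≤ p) <|
    (input (Fin.last k)).and <|
    forall_lt (P := fun x w q => q < x.length → q ≤ w (Fin.last k)) <|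
    (lt_length (Fin.last (k + 1))).imp (Definable.le (Fin.last (k + 1)) (Fin.last k).castSucc)
  have ht : DefinableFun k fun x _ => tailPos (leadingOnes x) :=
    DefinableFun.leadingOnes.tailPos
  refine ((length_lt_fun ht).not.and ((h1.and (h2.and h3)).and
    ((fun_lt_length ht).not.or h4))).congr fun x v _ => ?_
  have hD := FmSystem.lt_domSize x.length
  have h5 : (∃ p < domSize x.length, x[p]? = some true ∧
      ∀ q < domSize x.length, q < x.length → q ≤ p) ↔ x[x.length - 1]? = some true := by
    constructor
    · rintro ⟨p, -, h, h'⟩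
      obtain ⟨h6, -⟩ := List.getElem?_eq_some_iff.1 h
      have := h' (x.length - 1) (by omega) (by omega)
      rwa [show x.length - 1 = p by omega]
    · intro h
      exact ⟨x.length - 1, by omega, h, fun q _ hq => by omega⟩
  rw [h5]
  constructor
  · rintro ⟨a, ⟨b, c, d⟩, e⟩
    exact ⟨by omega, ⟨b, c, d⟩, e.imp (fun h => by omega) id⟩
  · rintro ⟨a, ⟨b, c, d⟩, e⟩
    exact ⟨by omega, ⟨b, c, d⟩, e.imp (fun h => by omega) id⟩

theorem definable_lt_length_kernelization (s : Fin k) :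
    Definable k fun x v => v s < (kernelization x).length := by
  have hbig : Definable k fun x _ =>
      tailPos (leadingOnes x) + (wordGraph x).covCard < x.length :=
    fun_lt_length (DefinableFun.leadingOnes.tailPos.add definable_covCard)
  -- The number of digits of k is a difference; instead, the position is written as an offset `i`
  -- into the tail, where the same offset has to exist in the input.
  have h1 : Definable k fun x v => ∃ i < domSize x.length, tailPos (leadingOnes x) + i < x.length ∧
      (v s < x.length ∧ v s = tailPos (wordGraph x).kept.card + i) :=
    exists_lt (P := fun x v i => tailPos (leadingOnes x) + i < x.length ∧
      (v s < x.length ∧ v s = tailPos (wordGraph x).kept.card + i)) <|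
    (fun_lt_length (DefinableFun.leadingOnes.tailPos.add (var _))).and
      (lt_length_and_eq_fun (definable_card_kept.tailPos.add (var _)) s.castSucc)
  -- The bounds 8 and 0 are the last positions of the fixed words, of lengths 9 and 1.
  refine ((definable_wellFormed.not.and (le_fun (const 8) s)).or
    ((definable_wellFormed.and (hbig.and (le_fun (const 0) s))).or
      (definable_wellFormed.and (hbig.not.and
        ((lt_length_and_lt_fun definable_card_kept.tailPos s).or h1))))).congr fun x v _ => ?_
  have hD := FmSystem.lt_domSize x.length
  unfold kernelization kernelTarget
  split_ifs with hx h
  · rw [encode_yesInstance, List.length_singleton]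
    simp only [hx, h, not_true, false_and, true_and, false_or, or_false]
    omega
  · rw [length_encode_kernelInstance hx]
    simp only [hx, h, not_true, not_false_iff, false_and, true_and, false_or]
    have h2 : tailPos (wordGraph x).kept.card ≤ tailPos (leadingOnes x) :=
      tailPos_mono (wordGraph x).card_kept_le_order
    have h3 := hx.le
    constructor
    · rintro (h | ⟨i, -, h4, -, h5⟩) <;> omega
    · intro h4
      rcases lt_or_ge (v s) (tailPos (wordGraph x).kept.card) with h5 | h5
      · exact Or.inl (by omega)
      · exact Or.inr ⟨v s - tailPos (wordGraph x).kept.card, by omega, by omega, by omega, by omega⟩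
  · rw [encode_noInstance]
    simp only [hx, not_false_iff, true_and, false_and, or_false, List.length_cons, List.length_nil]
    omega

theorem definable_kernelization_bit (s : Fin k) :
    Definable k fun x v => (kernelization x)[v s]? = some true := by
  have hbig : Definable k fun x _ =>
      tailPos (leadingOnes x) + (wordGraph x).covCard < x.length :=
    fun_lt_length (DefinableFun.leadingOnes.tailPos.add definable_covCard)
  -- The word of the fixed no-instance is 110011000 with one-bits exactly at the positions 0, 1, 4
  -- and 5.
  have hno : Definable k fun _ v => v s ≤ 1 ∨ (¬ v s ≤ 3 ∧ v s ≤ 5) :=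
    (le_fun (const 1) s).or ((le_fun (const 3) s).not.and (le_fun (const 5) s))
  have hadj : Definable k fun x w => ∃ u < domSize x.length, ∃ v < domSize x.length,
      ∃ a < domSize x.length, ∃ b < domSize x.length,
        (u < (wordGraph x).kept.card ∧ Nat.nth (wordGraph x).Keep u = a) ∧
        (v < (wordGraph x).kept.card ∧ Nat.nth (wordGraph x).Keep v = b) ∧
        (w s < x.length ∧ w s = (wordGraph x).kept.card + 1 + (u * (wordGraph x).kept.card + v)) ∧
        (wordGraph x).Adj' a b :=
    exists_lt (P := fun x w u => ∃ v < domSize x.length,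
      ∃ a < domSize x.length, ∃ b < domSize x.length,
        (u < (wordGraph x).kept.card ∧ Nat.nth (wordGraph x).Keep u = a) ∧
        (v < (wordGraph x).kept.card ∧ Nat.nth (wordGraph x).Keep v = b) ∧
        (w s < x.length ∧ w s = (wordGraph x).kept.card + 1 + (u * (wordGraph x).kept.card + v)) ∧
        (wordGraph x).Adj' a b) <|
    exists_lt (k := k + 1) (P := fun x w v =>
      ∃ a < domSize x.length, ∃ b < domSize x.length,
        (w (Fin.last _) < (wordGraph x).kept.card ∧
          Nat.nth (wordGraph x).Keep (w (Fin.last _)) = a) ∧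
        (v < (wordGraph x).kept.card ∧ Nat.nth (wordGraph x).Keep v = b) ∧
        (w s.castSucc < x.length ∧ w s.castSucc =
          (wordGraph x).kept.card + 1 + (w (Fin.last _) * (wordGraph x).kept.card + v)) ∧
        (wordGraph x).Adj' a b) <|
    exists_lt (k := k + 2) (P := fun x w a => ∃ b < domSize x.length,
        (w (Fin.last _).castSucc < (wordGraph x).kept.card ∧
          Nat.nth (wordGraph x).Keep (w (Fin.last _).castSucc) = a) ∧
        (w (Fin.last _) < (wordGraph x).kept.card ∧
          Nat.nth (wordGraph x).Keep (w (Fin.last _)) = b) ∧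
        (w s.castSucc.castSucc < x.length ∧ w s.castSucc.castSucc = (wordGraph x).kept.card + 1 +
          (w (Fin.last _).castSucc * (wordGraph x).kept.card + w (Fin.last _))) ∧
        (wordGraph x).Adj' a b) <|
    exists_lt (k := k + 3) (P := fun x w b =>
        (w (Fin.last _).castSucc.castSucc < (wordGraph x).kept.card ∧
          Nat.nth (wordGraph x).Keep (w (Fin.last _).castSucc.castSucc) = w (Fin.last _)) ∧
        (w (Fin.last _).castSucc < (wordGraph x).kept.card ∧
          Nat.nth (wordGraph x).Keep (w (Fin.last _).castSucc) = b) ∧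
        (w s.castSucc.castSucc.castSucc < x.length ∧ w s.castSucc.castSucc.castSucc =
          (wordGraph x).kept.card + 1 + (w (Fin.last _).castSucc.castSucc *
            (wordGraph x).kept.card + w (Fin.last _).castSucc)) ∧
        (wordGraph x).Adj' (w (Fin.last _)) b) <|
    (definable_nth_keep _ _).and <| (definable_nth_keep _ _).and <|
      (lt_length_and_eq_fun ((definable_card_kept.add (const 1)).add
        (((var _).mul definable_card_kept).add (var _))) s.castSucc.castSucc.castSucc.castSucc).and
      (definable_adj' _ _)
  have hcov : Definable k fun x w => ∃ v < domSize x.length, ∃ b < domSize x.length,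
      (v < (wordGraph x).kept.card ∧ Nat.nth (wordGraph x).Keep v = b) ∧
      (w s < x.length ∧ w s = (wordGraph x).kept.card + 1 +
        (wordGraph x).kept.card * (wordGraph x).kept.card + v) ∧ (wordGraph x).Cov b :=
    exists_lt (P := fun x w v => ∃ b < domSize x.length,
      (v < (wordGraph x).kept.card ∧ Nat.nth (wordGraph x).Keep v = b) ∧
      (w s < x.length ∧ w s = (wordGraph x).kept.card + 1 +
        (wordGraph x).kept.card * (wordGraph x).kept.card + v) ∧ (wordGraph x).Cov b) <|
    exists_lt (k := k + 1) (P := fun x w b =>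
      (w (Fin.last _) < (wordGraph x).kept.card ∧
        Nat.nth (wordGraph x).Keep (w (Fin.last _)) = b) ∧
      (w s.castSucc < x.length ∧ w s.castSucc = (wordGraph x).kept.card + 1 +
        (wordGraph x).kept.card * (wordGraph x).kept.card + w (Fin.last _)) ∧
      (wordGraph x).Cov b) <|
    (definable_nth_keep _ _).and <|
      (lt_length_and_eq_fun (((definable_card_kept.add (const 1)).add
        (definable_card_kept.mul definable_card_kept)).add (var _)) s.castSucc.castSucc).and
      (definable_cov _)
  have htail : Definable k fun x w => ∃ i < domSize x.length,
      (w s < x.length ∧ w s = tailPos (wordGraph x).kept.card + i) ∧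
        x[tailPos (leadingOnes x) + i]? = some true :=
    exists_lt (P := fun x w i => (w s < x.length ∧ w s = tailPos (wordGraph x).kept.card + i) ∧
        x[tailPos (leadingOnes x) + i]? = some true) <|
      (lt_length_and_eq_fun (definable_card_kept.tailPos.add (var _)) s.castSucc).and
      (input_fun (DefinableFun.leadingOnes.tailPos.add (var _)))
  -- The fixed yes-instance needs no disjunct, since its word is the single bit 0.
  refine ((definable_wellFormed.not.and hno).or (definable_wellFormed.and (hbig.not.and
    ((definable_lt_card_kept s).or (hadj.or (hcov.or htail)))))).congr fun x w hw => ?_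
  have hD := FmSystem.lt_domSize x.length
  unfold kernelization kernelTarget
  split_ifs with hx h
  · rw [encode_yesInstance]
    simp only [hx, h, not_true, false_and, true_and, or_false]
    rcases w s with _ | j <;> simp
  · rw [encode_kernelInstance_iff hx]
    simp only [hx, h, not_true, not_false_iff, false_and, true_and, false_or]
    have h0 : (wordGraph x).kept.card ≤ leadingOnes x := (wordGraph x).card_kept_le_order
    have h1 : leadingOnes x ≤ x.length := leadingOnes_le x
    have h2 := tailPos_mono h0
    have h3 := hx.le
    have h4 : ∀ u < (wordGraph x).kept.card, Nat.nth (wordGraph x).Keep u < leadingOnes x :=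
      fun u hu => ((wordGraph x).nth_keep hu).1
    have h5 : tailPos (wordGraph x).kept.card = (wordGraph x).kept.card + 1 +
      (wordGraph x).kept.card * (wordGraph x).kept.card + (wordGraph x).kept.card := rfl
    refine or_congr Iff.rfl (or_congr ?_ (or_congr ?_ ?_))
    · constructor
      · rintro ⟨u, -, v, -, _, -, _, -, ⟨hu, rfl⟩, ⟨hv, rfl⟩, ⟨-, h6⟩, h7⟩
        exact ⟨u, hu, v, hv, h6, h7⟩
      · rintro ⟨u, hu, v, hv, h6, h7⟩
        have h8 := mul_add_lt_mul hu hv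
        exact ⟨u, by omega, v, by omega, _, lt_domSize_of_lt_order (h4 u hu), _,
          lt_domSize_of_lt_order (h4 v hv), ⟨hu, rfl⟩, ⟨hv, rfl⟩, ⟨by omega, h6⟩, h7⟩
    · constructor
      · rintro ⟨v, -, _, -, ⟨hv, rfl⟩, ⟨-, h6⟩, h7⟩
        exact ⟨v, hv, h6, h7⟩
      · rintro ⟨v, hv, h6, h7⟩
        exact ⟨v, by omega, _, lt_domSize_of_lt_order (h4 v hv), ⟨hv, rfl⟩, ⟨by omega, h6⟩, h7⟩
    · constructor
      · rintro ⟨i, -, ⟨-, h6⟩, h7⟩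
        exact ⟨i, h6, h7⟩
      · rintro ⟨i, h6, h7⟩
        obtain ⟨h8, -⟩ := List.getElem?_eq_some_iff.1 h7
        exact ⟨i, by omega, ⟨by omega, h6⟩, h7⟩
  · rw [encode_noInstance]
    simp only [hx, not_false_iff, true_and, false_and, or_false]
    rcases w s with _ | _ | _ | _ | _ | _ | _ | _ | _ | j <;> simp

end

theorem mainTheorem8 :
    ∃ (K : List Bool → List Bool) (C : ∀ n, TCCircuit n),
      IsUniformTC0 C ∧ ComputedBy K C ∧ pathWidthVC.IsKernelization K ∧
        ∃ c : ℕ, ∀ x, ∃ I : PWInstance, K x = I.encode ∧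
          I.order ≤ c * pathWidthVC.param x ^ 3 + c := by
  -- The only free variable is the output position: one formula says that the position exists, the
  -- other one that its bit is a one.
  obtain ⟨φ, hφ⟩ := definable_lt_length_kernelization (0 : Fin 1)
  obtain ⟨ψ, hψ⟩ := definable_kernelization_bit (0 : Fin 1)
  obtain ⟨F, rfl, rfl⟩ := exists_fmSystem φ ψ
  refine ⟨kernelization, F.circuit, F.isUniformTC0_circuit, fun x => ?_, isKernelization, 3,
    fun x => ⟨kernelTarget x, rfl, order_kernelTarget_le x⟩⟩
  have hv : ∀ j < domSize x.length, ∀ i, Function.update (0 : ℕ → ℕ) 0 j i < domSize x.length := by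
    intro j hj i
    rw [Function.update_apply]
    split_ifs
    exacts [hj, FmSystem.domSize_pos _]
  refine F.circuit_outputs (length_kernelization_le_domSize x)
    (fun j hj => (hφ x _ (hv j hj)).trans (by simp)) fun j hj => ?_
  rw [hψ x _ (hv j (hj.trans_le (length_kernelization_le_domSize x)))]
  simp [List.getElem?_eq_getElem hj]
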